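/- Let $\Omega\subset\mathbb R^2$ be a bounded domain with $C^\infty$ boundary such that $\partial\Omega$ is a single simple closed curve, let $\mathbf n$ be the outward unit normal on $\partial\Omega$, and let $j:\partial\Omega\to\mathbb R$ be integrable with respect to arc length $s$. Suppose that the boundary value problem $$\begin{cases}\operatorname{div}\big([1-|\nabla\zeta|^2]\nabla\zeta\big)=0 & \text{in }\Omega,\\ [1-|\nabla\zeta|^2]\,\dfrac{\partial\zeta}{\partial\mathbf n}=j\ \text{ and }\ \displaystyle\int_{\partial\Omega}j\,ds=0 & \text{on }\partial\Omega\end{cases}$$ has a solution $\zeta\in H^3(\Omega)$ satisfying $\|\nabla\zeta\|_{L^\infty(\Omega)}\le 1$ (the boundary condition being understood in the sense of traces). For $x,y\in\partial\Omega$ let $$d(x,y)=\inf_{\tilde\gamma}\mathbf L(\tilde\gamma),$$ where the infimum is over continuous paths $\tilde\gamma$ in $\overline\Omega$ connecting $x$ and $y$, and $\mathbf L$ denotes length. Then for all $x,y\in\partial\Omega$ with $x\neq y$ one has $0<d(x,y)<\infty$ and $$\frac{1}{d(x,y)}\left|\int_\Gamma j\,ds\right|\le\frac{2}{3\sqrt3},$$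 where $\Gamma$ is either of the two arcs of $\partial\Omega$ connecting $x$ and $y$. -/

import Mathlib

open MeasureTheory Set Filter Topology
open scoped ENNReal ContDiff

/-- The plane with its Euclidean norm. -/
abbrev Plane := EuclideanSpace ℝ (Fin 2)

/-- Test functions on `Ω`: smooth, with compact support contained in `Ω`. -/
def IsTestFunction (Ω : Set Plane) (φ : Plane → ℝ) : Prop :=
  ContDiff ℝ ∞ φ ∧ HasCompactSupport φ ∧ tsupport φ ⊆ Ω

/-- `v` is the weak partial derivative `∂ᵢ u` on `Ω`. -/
def HasWeakPartial (Ω : Set Plane) (i : Fin 2) (u v : Plane → ℝ) : Prop :=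
  LocallyIntegrableOn u Ω ∧ LocallyIntegrableOn v Ω ∧
    ∀ φ : Plane → ℝ, IsTestFunction Ω φ →
      ∫ x in Ω, u x * fderiv ℝ φ x (EuclideanSpace.single i 1) = -∫ x in Ω, v x * φ x

/-- The Sobolev space `H^k(Ω)`: weak derivatives up to order `k` exist and lie in `L²(Ω)`. -/
def MemSobolevH (Ω : Set Plane) : ℕ → (Plane → ℝ) → Prop
  | 0, u => MemLp u 2 (volume.restrict Ω)
  | k + 1, u => MemLp u 2 (volume.restrict Ω) ∧
      ∀ i : Fin 2, ∃ v : Plane → ℝ, HasWeakPartial Ω i u v ∧ MemSobolevH Ω k v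

/-- `p` is the weak gradient of `u` on `Ω`. -/
def HasWeakGradient (Ω : Set Plane) (u : Plane → ℝ) (p : Plane → Plane) : Prop :=
  ∀ i : Fin 2, HasWeakPartial Ω i u (fun x => p x i)

/-- `f` is the weak divergence of the vector field `F` on `Ω`. -/
def HasWeakDiv (Ω : Set Plane) (F : Plane → Plane) (f : Plane → ℝ) : Prop :=
  LocallyIntegrableOn F Ω ∧ LocallyIntegrableOn f Ω ∧
    ∀ φ : Plane → ℝ, IsTestFunction Ω φ →
      ∫ x in Ω, fderiv ℝ φ x (F x) = -∫ x in Ω, f x * φ x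

/-- The unit tangent `γ'(s)` of a unit-speed plane curve, turned clockwise by a right angle.
It is the outward unit normal if `γ` runs along the boundary with the domain on its left. -/
noncomputable def rightNormal (γ : ℝ → Plane) (s : ℝ) : Plane :=
  !₂[deriv γ s 1, -(deriv γ s 0)]

/-- `Ω` is a smooth bounded plane domain whose boundary is one simple closed curve, and `γ` is the
`ℓ`-periodic parametrization of `∂Ω` by arc length, with `Ω` on its left. -/
structure IsSmoothJordanDomain (Ω : Set Plane) (γ : ℝ → Plane) (ℓ : ℝ) : Prop where
  isOpen : IsOpen Ω
  isConnected : IsConnected Ω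
  isBounded : Bornology.IsBounded Ω
  length_pos : 0 < ℓ
  smooth : ContDiff ℝ ∞ γ
  unit_speed : ∀ s, ‖deriv γ s‖ = 1
  periodic : Function.Periodic γ ℓ
  simple : InjOn γ (Ico 0 ℓ)
  range_eq : range γ = frontier Ω
  /-- `Ω` lies locally on one side of `∂Ω`, and `rightNormal γ` points out of `Ω`. -/
  outward : ∀ s, ∃ δ > 0, ∀ t ∈ Ioo (0 : ℝ) δ,
    γ s - t • rightNormal γ s ∈ Ω ∧ γ s + t • rightNormal γ s ∉ closure Ω

/-- `T` is the trace on `∂Ω` of `g ∈ H¹(Ω)`: some functions smooth up to the boundary tend to `g`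
in `H¹(Ω)` while their boundary values tend to `T` in `L²(∂Ω)`. The arc-length
parametrization `γ` on `(0, ℓ]` gives the measure on `∂Ω`. -/
def HasTrace (Ω : Set Plane) (γ : ℝ → Plane) (ℓ : ℝ) (g T : Plane → ℝ) : Prop :=
  MemLp g 2 (volume.restrict Ω) ∧
  MemLp (fun s => T (γ s)) 2 (volume.restrict (Ioc 0 ℓ)) ∧
  ∃ (dg : Fin 2 → Plane → ℝ) (φ : ℕ → Plane → ℝ),
    (∀ i, HasWeakPartial Ω i g (dg i) ∧ MemLp (dg i) 2 (volume.restrict Ω)) ∧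
    (∀ k, ContDiff ℝ ∞ (φ k)) ∧
    Tendsto (fun k => eLpNorm (fun x => φ k x - g x) 2 (volume.restrict Ω)) atTop (𝓝 0) ∧
    (∀ i, Tendsto (fun k => eLpNorm
      (fun x => fderiv ℝ (φ k) x (EuclideanSpace.single i 1) - dg i x) 2 (volume.restrict Ω))
      atTop (𝓝 0)) ∧
    Tendsto (fun k => eLpNorm (fun s => φ k (γ s) - T (γ s)) 2 (volume.restrict (Ioc 0 ℓ)))
      atTop (𝓝 0)

/-- The superconducting current `(1 - |p|²) p` at a point where the gradient of `ζ` is `p`. -/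
noncomputable def superCurrent (p : Plane) : Plane := (1 - ‖p‖ ^ 2) • p

/-- `ζ ∈ H³(Ω)` with `|∇ζ| ≤ 1` solves
`div ((1 - |∇ζ|²) ∇ζ) = 0` in `Ω`, `(1 - |∇ζ|²) ∂ζ/∂n = j` and `∫ j ds = 0` on `∂Ω`;
`p` is the gradient of `ζ` and `T` its boundary trace. -/
def IsOuterSolution (Ω : Set Plane) (γ : ℝ → Plane) (ℓ : ℝ) (j ζ : Plane → ℝ) : Prop :=
  MemSobolevH Ω 3 ζ ∧
  ∃ p T : Plane → Plane,
    HasWeakGradient Ω ζ p ∧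
    (∀ᵐ x ∂volume.restrict Ω, ‖p x‖ ≤ 1) ∧
    HasWeakDiv Ω (fun x => superCurrent (p x)) (fun _ => 0) ∧
    (∀ i : Fin 2, HasTrace Ω γ ℓ (fun x => p x i) (fun x => T x i)) ∧
    (∀ᵐ s ∂volume.restrict (Ioc 0 ℓ),
      (1 - ‖T (γ s)‖ ^ 2) * inner ℝ (T (γ s)) (rightNormal γ s) = j (γ s)) ∧
    IntervalIntegrable (fun s => j (γ s)) volume 0 ℓ ∧
    ∫ s in (0 : ℝ)..ℓ, j (γ s) = 0

/-- The infimum of the lengths of the continuous paths in `K` from `x` to `y`. -/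
noncomputable def intrinsicDist (K : Set Plane) (x y : Plane) : ℝ≥0∞ :=
  ⨅ (c : ℝ → Plane) (_ : ContinuousOn c (Icc 0 1)) (_ : MapsTo c (Icc 0 1) K)
    (_ : c 0 = x) (_ : c 1 = y), eVariationOn c (Icc 0 1)

/-!
The current `F = (1 - |∇ζ|²) ∇ζ` is divergence-free, and `|F| ≤ 2 / (3√3)` because `r (1 - r²)` has
this maximum on `[0, 1]`. A stream function of `F` is therefore Lipschitz with that constant along
paths in the domain, while its increment along a boundary arc is the flux `∫ j ds` through the arc.
The flux between two boundary points is thus at most `2 / (3√3)` times the length of any path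
joining them in the closed domain.

Three points need care.

* *Boundary values.* In a collar of the boundary, with normal coordinates `(s, t)`, the mean deviation
  of an `H¹` function on a thin strip from its trace tends to zero (`tendsto_average_sub_trace`):
  this is the fundamental theorem of calculus along normals for smooth functions, and passes to the
  limit. It carries the pointwise bound and the nonlinearity over to the boundary, and testing the
  equation with functions of the depth yields Green's formula up to the boundary,
  `∫_Ω ∇φ · F = ∫_∂Ω φ j ds` (`exists_bounded_current`).
* *A global stream function.* Topology of `Ω` is avoided by closing up the current in the plane:
  let `J(s) = ∫₀ˢ j`, which is periodic since the total flux vanishes. By Green's formula, `F` on `Ω`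
  together with the tangential current `J γ' ds` on `∂Ω` is a divergence-free vector measure on the
  plane. Its smoothings are smooth divergence-free fields and have stream functions by the Poincaré
  lemma (`exists_streamFunction_smoothedField`). These are Lipschitz with the right constant inside,
  constant along a parallel curve outside, and jump by `J(s)` across `γ s` (`exists_jump_estimate`).
* *Paths touching the boundary.* A path in the closed domain is first moved into the open one along a
  Lipschitz extension of the inner normal (`exists_push`), which changes its length by a factor close
  to one. Comparing the jumps at both ends gives the bound (`abs_boundaryFlux_sub_le`).
-/

/-! ### The rotation by a right angle -/

/-- The clockwise rotation of the plane by a right angle. -/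
noncomputable def rotCW : Plane →L[ℝ] Plane :=
  LinearMap.toContinuousLinearMap
    { toFun := fun v => !₂[v 1, -(v 0)]
      map_add' := fun v w => by ext i; fin_cases i <;> simp; ring
      map_smul' := fun c v => by ext i; fin_cases i <;> simp }

@[simp] theorem rotCW_zero_apply (v : Plane) : rotCW v 0 = v 1 := rfl

@[simp] theorem rotCW_one_apply (v : Plane) : rotCW v 1 = -v 0 := rfl

theorem plane_inner (v w : Plane) : inner ℝ v w = v 0 * w 0 + v 1 * w 1 := by
  simp [PiLp.inner_apply, Fin.sum_univ_two, mul_comm]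

theorem plane_norm_sq (v : Plane) : ‖v‖ ^ 2 = v 0 ^ 2 + v 1 ^ 2 := by
  rw [← real_inner_self_eq_norm_sq, plane_inner]; ring

theorem plane_ext {v w : Plane} (h0 : v 0 = w 0) (h1 : v 1 = w 1) : v = w := by
  ext i; fin_cases i <;> assumption

theorem eq_sum_single (v : Plane) :
    v = v 0 • EuclideanSpace.single 0 (1 : ℝ) + v 1 • EuclideanSpace.single 1 (1 : ℝ) := by
  apply plane_ext <;> simp

theorem norm_rotCW (v : Plane) : ‖rotCW v‖ = ‖v‖ := by
  have h : ‖rotCW v‖ ^ 2 = ‖v‖ ^ 2 := by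
    simp only [plane_norm_sq, rotCW_zero_apply, rotCW_one_apply]; ring
  exact (pow_left_inj₀ (norm_nonneg _) (norm_nonneg _) two_ne_zero).1 h

theorem inner_rotCW_self (v : Plane) : inner ℝ (rotCW v) v = 0 := by
  simp only [plane_inner, rotCW_zero_apply, rotCW_one_apply]; ring

theorem inner_self_rotCW (v : Plane) : inner ℝ v (rotCW v) = 0 := by
  rw [real_inner_comm, inner_rotCW_self]

theorem rightNormal_eq (γ : ℝ → Plane) (s : ℝ) : rightNormal γ s = rotCW (deriv γ s) := rfl

/-! ### Chords and arcs of the boundary curve -/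

theorem toIcoMod_eq_add_int_mul {ℓ : ℝ} (hp : 0 < ℓ) (x : ℝ) :
    toIcoMod hp 0 x = x + (-toIcoDiv hp 0 x : ℤ) * ℓ := by
  rw [← self_sub_toIcoDiv_zsmul, zsmul_eq_mul]; push_cast; ring

/-- The derivative of the normal along the boundary has the direction of the tangent; this is
its component there, the curvature up to sign. -/
noncomputable def normalCurvature (γ : ℝ → Plane) (s : ℝ) : ℝ :=
  inner ℝ (deriv (rightNormal γ) s) (deriv γ s)

namespace IsSmoothJordanDomain

variable {Ω : Set Plane} {γ : ℝ → Plane} {ℓ : ℝ}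

theorem contDiff_deriv (hΩ : IsSmoothJordanDomain Ω γ ℓ) : ContDiff ℝ ∞ (deriv γ) :=
  (contDiff_infty_iff_deriv.1 hΩ.smooth).2

theorem hasDerivAt (hΩ : IsSmoothJordanDomain Ω γ ℓ) (s : ℝ) : HasDerivAt γ (deriv γ s) s :=
  ((contDiff_infty_iff_deriv.1 hΩ.smooth).1 s).hasDerivAt

theorem contDiff_normal (hΩ : IsSmoothJordanDomain Ω γ ℓ) : ContDiff ℝ ∞ (rightNormal γ) :=
  rotCW.contDiff.comp hΩ.contDiff_deriv

theorem hasDerivAt_normal (hΩ : IsSmoothJordanDomain Ω γ ℓ) (s : ℝ) :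
    HasDerivAt (rightNormal γ) (deriv (rightNormal γ) s) s :=
  ((contDiff_infty_iff_deriv.1 hΩ.contDiff_normal).1 s).hasDerivAt

theorem norm_normal (hΩ : IsSmoothJordanDomain Ω γ ℓ) (s : ℝ) : ‖rightNormal γ s‖ = 1 := by
  rw [rightNormal_eq, norm_rotCW, hΩ.unit_speed]

theorem periodic_deriv (hΩ : IsSmoothJordanDomain Ω γ ℓ) : Function.Periodic (deriv γ) ℓ := by
  intro s
  rw [← deriv_comp_add_const]
  congr 1
  exact funext hΩ.periodic

theorem periodic_normal (hΩ : IsSmoothJordanDomain Ω γ ℓ) :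
    Function.Periodic (rightNormal γ) ℓ := by
  intro s
  rw [rightNormal_eq, rightNormal_eq, hΩ.periodic_deriv]

theorem deriv_normal (hΩ : IsSmoothJordanDomain Ω γ ℓ) (s : ℝ) :
    deriv (rightNormal γ) s = normalCurvature γ s • deriv γ s := by
  have h1 : inner ℝ (rightNormal γ s) (deriv (rightNormal γ) s) = 0 := by
    have h := (hΩ.hasDerivAt_normal s).norm_sq
    have hc : (fun s => ‖rightNormal γ s‖ ^ 2) = fun _ => 1 := by
      funext s; rw [hΩ.norm_normal]; norm_num
    rw [hc] at h
    have := h.unique (hasDerivAt_const s (1 : ℝ))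
    linarith
  have hu : deriv γ s 0 ^ 2 + deriv γ s 1 ^ 2 = 1 := by
    rw [← plane_norm_sq, hΩ.unit_speed]; norm_num
  rw [rightNormal_eq, plane_inner, rotCW_zero_apply, rotCW_one_apply] at h1
  unfold normalCurvature
  rw [plane_inner]
  set w := deriv (rightNormal γ) s
  apply plane_ext <;> simp only [PiLp.smul_apply, smul_eq_mul]
  · linear_combination (-w 0) * hu + deriv γ s 1 * h1
  · linear_combination (-w 1) * hu - deriv γ s 0 * h1

/-- Quantitative smoothness of the boundary: a common Lipschitz constant for tangent and normal,
which also bounds the curvature and the deviation of the curve from its tangent line. -/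
theorem exists_smoothness_bound (hΩ : IsSmoothJordanDomain Ω γ ℓ) :
    ∃ K > 0, (∀ s s', ‖rightNormal γ s - rightNormal γ s'‖ ≤ K * |s - s'|) ∧
      (∀ s s', ‖γ s' - γ s - (s' - s) • deriv γ s‖ ≤ K * (s' - s) ^ 2) ∧
      (∀ s s', ‖deriv γ s - deriv γ s'‖ ≤ K * |s - s'|) ∧
      ∀ s, |normalCurvature γ s| ≤ K := by
  have hp : Function.Periodic (deriv (rightNormal γ)) ℓ := by
    intro s
    rw [← deriv_comp_add_const]
    congr 1
    exact funext hΩ.periodic_normal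
  have hb := hp.isBounded_of_continuous hΩ.length_pos.ne'
    (contDiff_infty_iff_deriv.1 hΩ.contDiff_normal).2.continuous
  obtain ⟨K, hK0, hK⟩ := hb.exists_pos_norm_le
  have hK' : ∀ s, ‖deriv (rightNormal γ) s‖ ≤ K := fun s => hK _ (mem_range_self s)
  have hN : ∀ s s', ‖rightNormal γ s - rightNormal γ s'‖ ≤ K * |s - s'| := by
    intro s s'
    have := convex_univ.norm_image_sub_le_of_norm_deriv_le (f := rightNormal γ) (x := s') (y := s)
      (fun x _ => (hΩ.hasDerivAt_normal x).differentiableAt) (fun x _ => hK' x)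
      (mem_univ _) (mem_univ _)
    simpa using this
  have hT : ∀ s s', ‖deriv γ s - deriv γ s'‖ ≤ K * |s - s'| := by
    intro s s'
    rw [← norm_rotCW, map_sub]
    exact hN s s'
  refine ⟨K, hK0, hN, ?_, hT, ?_⟩
  · intro s s'
    have := (convex_uIcc s s').norm_image_sub_le_of_norm_hasDerivWithin_le
      (f := fun u => γ u - (u - s) • deriv γ s) (f' := fun u => deriv γ u - (1 : ℝ) • deriv γ s)
      (C := K * |s' - s|) (x := s) (y := s')
      (fun u _ => ((hΩ.hasDerivAt u).sub
        (((hasDerivAt_id u).sub_const s).smul_const (deriv γ s))).hasDerivWithinAt)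
      (fun u hu => by
        rw [one_smul]
        exact (hT u s).trans
          (mul_le_mul_of_nonneg_left (abs_sub_left_of_mem_uIcc hu) hK0.le))
      left_mem_uIcc right_mem_uIcc
    simp only [sub_self, zero_smul, sub_zero] at this
    calc _ = ‖γ s' - (s' - s) • deriv γ s - γ s‖ := by congr 1; abel
      _ ≤ _ := this
      _ = K * (|s' - s| * |s' - s|) := by rw [Real.norm_eq_abs]; ring
      _ = _ := by rw [abs_mul_abs_self]; ring
  · intro s
    have := hK' s
    rwa [hΩ.deriv_normal, norm_smul, hΩ.unit_speed, mul_one, Real.norm_eq_abs] at this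

theorem apply_add_int_mul (hΩ : IsSmoothJordanDomain Ω γ ℓ) (s : ℝ) (n : ℤ) :
    γ (s + n * ℓ) = γ s := hΩ.periodic.int_mul n s

theorem normal_add_int_mul (hΩ : IsSmoothJordanDomain Ω γ ℓ) (s : ℝ) (n : ℤ) :
    rightNormal γ (s + n * ℓ) = rightNormal γ s := hΩ.periodic_normal.int_mul n s

theorem exists_eq_add_int_mul (hΩ : IsSmoothJordanDomain Ω γ ℓ) {s s' : ℝ} (h : γ s = γ s') :
    ∃ n : ℤ, s' = s + n * ℓ := by
  have hp := hΩ.length_pos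
  have e := toIcoMod_eq_add_int_mul hp
  have h1 := hΩ.simple (toIcoMod_mem_Ico' hp s) (toIcoMod_mem_Ico' hp s') (by
    rw [e, e, hΩ.apply_add_int_mul, hΩ.apply_add_int_mul, h])
  rw [e, e] at h1
  refine ⟨toIcoDiv hp 0 s' - toIcoDiv hp 0 s, ?_⟩
  push_cast at h1 ⊢
  linarith

/-- Chords of the boundary curve are comparable to the arcs they span. -/
theorem exists_chord_arc (hΩ : IsSmoothJordanDomain Ω γ ℓ) :
    ∃ c > 0, ∀ s s', ∃ n : ℤ, c * |s' + n * ℓ - s| ≤ ‖γ s' - γ s‖ := by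
  obtain ⟨K, hK0, -, hK, -, -⟩ := hΩ.exists_smoothness_bound
  have hp := hΩ.length_pos
  have hcpt : IsCompact ((Icc 0 ℓ) ×ˢ (Icc (-(ℓ/2)) (ℓ/2) ∩ {u : ℝ | 1 / (2 * K) ≤ |u|})) :=
    isCompact_Icc.prod (isCompact_Icc.inter_right (isClosed_le continuous_const continuous_abs))
  obtain ⟨m, hm0, hm⟩ := hcpt.exists_forall_le' (f := fun z : ℝ × ℝ => ‖γ (z.1 + z.2) - γ z.1‖)
    (a := 0) (by have := hΩ.smooth.continuous; fun_prop) (by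
      rintro ⟨s, u⟩ ⟨-, hu, hu'⟩
      simp only [norm_pos_iff, ne_eq, sub_eq_zero]
      intro h
      obtain ⟨n, hn⟩ := hΩ.exists_eq_add_int_mul h
      have hu0 : u = -n * ℓ := by linear_combination -hn
      have : |u| ≤ ℓ / 2 := abs_le.2 hu
      rcases eq_or_ne n 0 with rfl | hn0
      · have hu' : 1 / (2 * K) ≤ |u| := hu'
        rw [hu0, Int.cast_zero, neg_zero, zero_mul, abs_zero] at hu'
        have : 0 < 1 / (2 * K) := by positivity
        linarith
      · have h1 : (1 : ℝ) ≤ |(n : ℝ)| := by exact_mod_cast Int.one_le_abs hn0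
        rw [hu0, abs_mul, abs_neg, abs_of_pos hp] at this
        nlinarith)
  have key : ∀ s u, |u| ≤ ℓ / 2 → min (1 / 2) (m / ℓ) * |u| ≤ ‖γ (s + u) - γ s‖ := by
    intro s u hu
    rcases le_or_gt (1 / (2 * K)) |u| with h | h
    · have hs := hm (toIcoMod hp 0 s, u)
        ⟨Ico_subset_Icc_self (toIcoMod_mem_Ico' hp s), abs_le.1 hu, h⟩
      simp only [toIcoMod_eq_add_int_mul hp] at hs
      rw [add_right_comm, hΩ.apply_add_int_mul, hΩ.apply_add_int_mul] at hs
      refine le_trans ?_ hs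
      calc min (1 / 2) (m / ℓ) * |u| ≤ (m / ℓ) * (ℓ / 2) := by
            gcongr
            exact min_le_right _ _
        _ = m / 2 := by field_simp
        _ ≤ m := by linarith
    · have h1 := hK s (s + u)
      simp only [add_sub_cancel_left] at h1
      have h2 : |u| ≤ ‖γ (s + u) - γ s‖ + K * u ^ 2 := by
        calc |u| = ‖u • deriv γ s‖ := by rw [norm_smul, hΩ.unit_speed, mul_one, Real.norm_eq_abs]
          _ = ‖(γ (s + u) - γ s) - (γ (s + u) - γ s - u • deriv γ s)‖ := by congr 1; abel
          _ ≤ _ := (norm_sub_le _ _).trans (by gcongr)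
      have h3 : K * u ^ 2 ≤ 1 / 2 * |u| := by
        rw [← sq_abs]
        rw [lt_div_iff₀ (by positivity)] at h
        nlinarith [abs_nonneg u]
      have h4 : min (1 / 2) (m / ℓ) * |u| ≤ 1 / 2 * |u| := by
        gcongr
        exact min_le_left _ _
      linarith
  refine ⟨min (1 / 2) (m / ℓ), by positivity, fun s s' => ⟨-round ((s' - s) / ℓ), ?_⟩⟩
  have h := key s (s' + (-round ((s' - s) / ℓ) : ℤ) * ℓ - s) (by
    have := abs_sub_round ((s' - s) / ℓ)
    have e : s' + (-round ((s' - s) / ℓ) : ℤ) * ℓ - s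
      = ((s' - s) / ℓ - round ((s' - s) / ℓ)) * ℓ := by push_cast; field_simp; ring
    rw [e, abs_mul, abs_of_pos hp]
    nlinarith)
  rw [add_sub_cancel, hΩ.apply_add_int_mul] at h
  exact h

end IsSmoothJordanDomain

/-! ### The collar of the boundary -/

/-- The point at signed depth `t` on the normal line through `γ s`; positive depths lead into the
domain. -/
noncomputable def collar (γ : ℝ → Plane) (s t : ℝ) : Plane := γ s - t • rightNormal γ s

/-- `δ` is a width for which the normal coordinates `(s, t)` are one-to-one up to the period, with
Jacobian `1 - t κ` close to `1`, and put positive depths inside `Ω` and negative ones outside. -/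
structure IsCollarWidth (Ω : Set Plane) (γ : ℝ → Plane) (ℓ δ : ℝ) : Prop where
  pos : 0 < δ
  jacobian : ∀ s t, |t| ≤ δ → |t * normalCurvature γ s| ≤ 1 / 2
  inj : ∀ s s' t t', |t| ≤ δ → |t'| ≤ δ → collar γ s t = collar γ s' t' →
    t = t' ∧ ∃ n : ℤ, s' + n * ℓ = s
  mem : ∀ s t, 0 < t → t ≤ δ → collar γ s t ∈ Ω
  notMem : ∀ s t, 0 < t → t ≤ δ → collar γ s (-t) ∉ closure Ω

theorem IsPreconnected.subset_of_disjoint_frontier {S U : Set Plane} (hS : IsPreconnected S)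
    (hU : IsOpen U) (hd : ∀ x ∈ S, x ∉ frontier U) (hne : (S ∩ U).Nonempty) : S ⊆ U := by
  refine hS.subset_of_closure_inter_subset hU hne ?_
  rintro x ⟨hx, hxS⟩
  by_contra h
  exact hd x hxS (by rw [hU.frontier_eq]; exact ⟨hx, h⟩)

namespace IsSmoothJordanDomain

variable {Ω : Set Plane} {γ : ℝ → Plane} {ℓ : ℝ}

theorem mem_frontier (hΩ : IsSmoothJordanDomain Ω γ ℓ) (s : ℝ) : γ s ∈ frontier Ω :=
  hΩ.range_eq ▸ mem_range_self s

theorem notMem (hΩ : IsSmoothJordanDomain Ω γ ℓ) (s : ℝ) : γ s ∉ Ω := by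
  have := hΩ.mem_frontier s
  rw [hΩ.isOpen.frontier_eq] at this
  exact this.2

theorem inner_normal_deriv (s : ℝ) : inner ℝ (rightNormal γ s) (deriv γ s) = 0 :=
  inner_rotCW_self _

theorem exists_isCollarWidth (hΩ : IsSmoothJordanDomain Ω γ ℓ) :
    ∃ δ, IsCollarWidth Ω γ ℓ δ := by
  obtain ⟨K, hK0, hN, hK, hT, hκ⟩ := hΩ.exists_smoothness_bound
  obtain ⟨c, hc0, hc⟩ := hΩ.exists_chord_arc
  have hp := hΩ.length_pos
  -- If two normals of length `δ` meet, their base points are at arc distance `|u| ≤ 2 * δ / c`, and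
  -- the curvature bound gives `|u| ≤ K * (δ + |u|) * |u|`; this `δ` makes the factor at most `1 / 2`.
  obtain ⟨δ, hδ⟩ : ∃ δ, δ = 1 / (2 * K * (2 / c + 1)) := ⟨_, rfl⟩
  have hδ0 : 0 < δ := by rw [hδ]; positivity
  have hKδ : K * δ * (2 / c + 1) = 1 / 2 := by
    rw [hδ]; field_simp
  have hinj : ∀ s s' t t', |t| ≤ δ → |t'| ≤ δ → collar γ s t = collar γ s' t' →
      t = t' ∧ ∃ n : ℤ, s' + n * ℓ = s := by
    intro s s' t t' ht ht' h
    obtain ⟨n, hn⟩ := hc s s'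
    have e1 : γ s' - γ s = t' • rightNormal γ s' - t • rightNormal γ s := by
      unfold collar at h
      have := congrArg (fun v => v + t' • rightNormal γ s' - γ s) h
      simp only [sub_add_cancel] at this
      rw [← this]; abel
    have h2 : ‖γ s' - γ s‖ ≤ 2 * δ := by
      rw [e1]
      refine (norm_sub_le _ _).trans ?_
      rw [norm_smul, norm_smul, hΩ.norm_normal, hΩ.norm_normal, Real.norm_eq_abs,
        Real.norm_eq_abs]
      linarith
    obtain ⟨u, hu⟩ : ∃ u, u = s' + n * ℓ - s := ⟨_, rfl⟩
    rw [← hu] at hn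
    have hs' : γ s' = γ (s + u) := by rw [← hΩ.apply_add_int_mul s' n]; congr 1; rw [hu]; ring
    have hν' : rightNormal γ s' = rightNormal γ (s + u) := by
      rw [← hΩ.normal_add_int_mul s' n]; congr 1; rw [hu]; ring
    have hu0 : u = 0 := by
      by_contra hne
      have hupos : 0 < |u| := abs_pos.2 hne
      have h3 := hK s (s + u)
      rw [add_sub_cancel_left, ← hs', e1] at h3
      have h4 : inner ℝ (t' • rightNormal γ s' - t • rightNormal γ s - u • deriv γ s) (deriv γ s)
          = t' * inner ℝ (rightNormal γ s' - rightNormal γ s) (deriv γ s) - u := by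
        simp only [inner_sub_left, real_inner_smul_left, inner_normal_deriv,
          real_inner_self_eq_norm_sq, hΩ.unit_speed]
        ring
      have h5 := abs_real_inner_le_norm
        (t' • rightNormal γ s' - t • rightNormal γ s - u • deriv γ s) (deriv γ s)
      rw [h4, hΩ.unit_speed, mul_one] at h5
      have h6 := abs_real_inner_le_norm (rightNormal γ s' - rightNormal γ s) (deriv γ s)
      rw [hΩ.unit_speed, mul_one, hν'] at h6
      have h7 := hN (s + u) s
      rw [add_sub_cancel_left] at h7
      have h8 : |t' * inner ℝ (rightNormal γ s' - rightNormal γ s) (deriv γ s)| ≤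
          δ * (K * |u|) := by
        rw [abs_mul, hν']
        exact mul_le_mul ht' (h6.trans h7) (abs_nonneg _) hδ0.le
      have h9 : |u| ≤ δ * (K * |u|) + K * u ^ 2 := by
        have := abs_sub_abs_le_abs_sub u
          (t' * inner ℝ (rightNormal γ s' - rightNormal γ s) (deriv γ s))
        rw [abs_sub_comm] at this
        linarith
      have h10 : |u| ≤ 2 * δ / c := by
        rw [le_div_iff₀ hc0]; linarith
      have h11 : K * u ^ 2 ≤ K * (2 * δ / c) * |u| := by
        rw [← sq_abs, sq, mul_assoc]
        gcongr
      have h12 : δ * (K * |u|) + K * (2 * δ / c) * |u| = 1 / 2 * |u| := by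
        rw [← hKδ]; ring
      linarith
    refine ⟨?_, n, by linarith⟩
    rw [hs', hν', hu0, add_zero, sub_self, ← sub_smul] at e1
    have hν0 : rightNormal γ s ≠ 0 := by
      rw [← norm_ne_zero_iff, hΩ.norm_normal]; norm_num
    rcases smul_eq_zero.1 e1.symm with h | h
    · linarith
    · exact absurd h hν0
  have hfr : ∀ s t, 0 < |t| → |t| ≤ δ → collar γ s t ∉ frontier Ω := by
    intro s t h0 h1 hmem
    rw [← hΩ.range_eq] at hmem
    obtain ⟨s', hs'⟩ := hmem
    have := (hinj s s' t 0 h1 (by simpa using hδ0.le) (by rw [← hs']; simp [collar])).1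
    simp [this] at h0
  have hcont : ∀ s, Continuous (collar γ s) := by
    intro s; unfold collar; fun_prop
  refine ⟨δ, hδ0, ?_, hinj, ?_, ?_⟩
  · intro s t ht
    rw [abs_mul]
    calc |t| * |normalCurvature γ s| ≤ δ * K := mul_le_mul ht (hκ s) (abs_nonneg _) hδ0.le
      _ ≤ 1 / 2 := by
        have : 0 ≤ K * δ * (2 / c) := by positivity
        linarith
  · intro s t ht htδ
    obtain ⟨δ', hδ', h⟩ := hΩ.outward s
    have hS : IsPreconnected (collar γ s '' Ioc 0 δ) :=
      isPreconnected_Ioc.image _ (hcont s).continuousOn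
    refine hS.subset_of_disjoint_frontier hΩ.isOpen ?_ ?_ (mem_image_of_mem _ ⟨ht, htδ⟩)
    · rintro _ ⟨r, hr, rfl⟩
      exact hfr s r (abs_pos.2 hr.1.ne') (by rw [abs_of_pos hr.1]; exact hr.2)
    · refine ⟨collar γ s (min (δ' / 2) δ), mem_image_of_mem _ ⟨by positivity, min_le_right _ _⟩, ?_⟩
      exact (h _ ⟨by positivity, (min_le_left _ _).trans_lt (by linarith)⟩).1
  · intro s t ht htδ hcl
    obtain ⟨δ', hδ', h⟩ := hΩ.outward s
    have hS : IsPreconnected (collar γ s '' Ico (-δ) 0) :=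
      isPreconnected_Ico.image _ (hcont s).continuousOn
    have hd : ∀ x ∈ collar γ s '' Ico (-δ) 0, x ∉ frontier Ω := by
      rintro _ ⟨r, hr, rfl⟩
      exact hfr s r (abs_pos.2 hr.2.ne) (by rw [abs_of_neg hr.2]; linarith [hr.1])
    have hm : collar γ s (-t) ∈ collar γ s '' Ico (-δ) 0 :=
      mem_image_of_mem _ ⟨by linarith, by linarith⟩
    have hin : collar γ s (-t) ∈ Ω := by
      by_contra hn
      exact hd _ hm (by rw [hΩ.isOpen.frontier_eq]; exact ⟨hcl, hn⟩)
    have hsub := hS.subset_of_disjoint_frontier hΩ.isOpen hd ⟨_, hm, hin⟩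
    have hr : 0 < min (δ' / 2) δ := by positivity
    have h1 := (h _ ⟨hr, (min_le_left _ _).trans_lt (by linarith)⟩).2
    apply h1
    apply subset_closure
    apply hsub
    refine ⟨-(min (δ' / 2) δ), ⟨neg_le_neg (min_le_right _ _), neg_lt_zero.2 hr⟩, ?_⟩
    simp [collar]

/-- Near the boundary the exterior contains a disc about each point of the outer normal whose
radius is half the distance of that point to the foot of the normal. -/
theorem exists_exterior_discs (hΩ : IsSmoothJordanDomain Ω γ ℓ) :
    ∃ θ₀ > 0, ∀ s θ, 0 < θ → θ ≤ θ₀ → ∀ y : Plane, ‖y - collar γ s (-θ)‖ < θ / 2 →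
      y ∉ closure Ω := by
  obtain ⟨K, hK0, -, hK, -, -⟩ := hΩ.exists_smoothness_bound
  obtain ⟨c, hc0, hc⟩ := hΩ.exists_chord_arc
  obtain ⟨δ, hδ⟩ := hΩ.exists_isCollarWidth
  have hδ0 := hδ.pos
  refine ⟨min δ (c ^ 2 / (9 * K)), by positivity, ?_⟩
  intro s θ hθ hθ₀ y hy hcl
  have hd : ∀ x ∈ Metric.ball (collar γ s (-θ)) (θ / 2), x ∉ frontier Ω := by
    intro x hx hfr
    rw [← hΩ.range_eq] at hfr
    obtain ⟨s', rfl⟩ := hfr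
    rw [mem_ball_iff_norm] at hx
    have e : γ s' - collar γ s (-θ) = γ s' - γ s - θ • rightNormal γ s := by
      simp only [collar, neg_smul]; abel
    rw [e] at hx
    have h1 : ‖γ s' - γ s‖ ≤ 3 / 2 * θ := by
      calc ‖γ s' - γ s‖ = ‖(γ s' - γ s - θ • rightNormal γ s) + θ • rightNormal γ s‖ := by
            congr 1; abel
        _ ≤ _ := norm_add_le _ _
        _ ≤ _ := by
          rw [norm_smul, hΩ.norm_normal, Real.norm_eq_abs, abs_of_pos hθ]; linarith
    obtain ⟨n, hn⟩ := hc s s'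
    obtain ⟨u, hu⟩ : ∃ u, u = s' + n * ℓ - s := ⟨_, rfl⟩
    rw [← hu] at hn
    have hs' : γ s' = γ (s + u) := by rw [← hΩ.apply_add_int_mul s' n]; congr 1; rw [hu]; ring
    have h3 := hK s (s + u)
    rw [add_sub_cancel_left, ← hs'] at h3
    have h4 : inner ℝ (γ s' - γ s - u • deriv γ s) (rightNormal γ s)
        = inner ℝ (γ s' - γ s - θ • rightNormal γ s) (rightNormal γ s) + θ := by
      have h0 : inner ℝ (deriv γ s) (rightNormal γ s) = 0 := inner_self_rotCW _
      simp only [inner_sub_left, real_inner_smul_left, h0,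
          real_inner_self_eq_norm_sq, hΩ.norm_normal]
      ring
    have h5 := abs_real_inner_le_norm (γ s' - γ s - u • deriv γ s) (rightNormal γ s)
    have h6 := abs_real_inner_le_norm (γ s' - γ s - θ • rightNormal γ s) (rightNormal γ s)
    rw [hΩ.norm_normal, mul_one] at h5 h6
    rw [h4] at h5
    have h7 : θ / 2 < K * u ^ 2 := by
      have := le_abs_self (inner ℝ (γ s' - γ s - θ • rightNormal γ s) (rightNormal γ s) + θ)
      have := neg_abs_le (inner ℝ (γ s' - γ s - θ • rightNormal γ s) (rightNormal γ s))
      linarith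
    have h8 : |u| ≤ 3 / 2 * θ / c := by rw [le_div_iff₀ hc0]; linarith
    have h9 : K * u ^ 2 ≤ K * (3 / 2 * θ / c) ^ 2 := by
      rw [← sq_abs]; gcongr
    have h10 : θ ≤ c ^ 2 / (9 * K) := hθ₀.trans (min_le_right _ _)
    have h11 : K * (3 / 2 * θ / c) ^ 2 = (9 * K / (4 * c ^ 2)) * θ * θ := by field_simp; ring
    have h12 : (9 * K / (4 * c ^ 2)) * θ * θ ≤ (9 * K / (4 * c ^ 2)) * (c ^ 2 / (9 * K)) * θ := by
      gcongr
    have h13 : (9 * K / (4 * c ^ 2)) * (c ^ 2 / (9 * K)) = 1 / 4 := by field_simp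
    rw [h13] at h12
    linarith
  have hyb : y ∈ Metric.ball (collar γ s (-θ)) (θ / 2) := by rwa [mem_ball_iff_norm]
  have hin : y ∈ Ω := by
    by_contra hn
    exact hd _ hyb (by rw [hΩ.isOpen.frontier_eq]; exact ⟨hcl, hn⟩)
  have hsub := (convex_ball (collar γ s (-θ)) (θ / 2)).isPreconnected.subset_of_disjoint_frontier
    hΩ.isOpen hd ⟨_, hyb, hin⟩
  exact hδ.notMem s θ hθ (hθ₀.trans (min_le_left _ _))
    (subset_closure (hsub (Metric.mem_ball_self (by positivity))))

/-- The inner normal extends to a Lipschitz field on the plane. -/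
theorem exists_lipschitz_inner_normal (hΩ : IsSmoothJordanDomain Ω γ ℓ) :
    ∃ (C : NNReal) (W : Plane → Plane), LipschitzWith C W ∧ ∀ s, W (γ s) = -rightNormal γ s := by
  obtain ⟨K, hK0, hN, -, -, -⟩ := hΩ.exists_smoothness_bound
  obtain ⟨c, hc0, hc⟩ := hΩ.exists_chord_arc
  have hW₀ : ∀ s, -rightNormal γ (Function.invFun γ (γ s)) = -rightNormal γ s := by
    intro s
    have h : γ (Function.invFun γ (γ s)) = γ s := Function.invFun_eq ⟨s, rfl⟩
    obtain ⟨n, hn⟩ := hΩ.exists_eq_add_int_mul h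
    rw [hn, hΩ.normal_add_int_mul, ← hn]
  have hL : LipschitzOnWith (Real.toNNReal (K / c))
      (fun x => -rightNormal γ (Function.invFun γ x)) (range γ) := by
    apply LipschitzOnWith.of_dist_le_mul
    rintro _ ⟨s, rfl⟩ _ ⟨s', rfl⟩
    rw [hW₀, hW₀, dist_eq_norm, dist_eq_norm, Real.coe_toNNReal _ (by positivity)]
    obtain ⟨n, hn⟩ := hc s' s
    have h := hN (s + n * ℓ) s'
    rw [hΩ.normal_add_int_mul] at h
    calc ‖-rightNormal γ s - -rightNormal γ s'‖ = ‖rightNormal γ s - rightNormal γ s'‖ := by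
          rw [← norm_neg]; congr 1; abel
      _ ≤ K * |s + n * ℓ - s'| := h
      _ = K / c * (c * |s + n * ℓ - s'|) := by field_simp
      _ ≤ _ := by gcongr
  obtain ⟨W, hW, hWe⟩ := hL.extend_finite_dimension
  exact ⟨_, W, hW, fun s => by rw [← hWe (mem_range_self s)]; exact hW₀ s⟩

/-- Moving along a Lipschitz extension of the inner normal for a short time takes the closed
domain into the open one. -/
theorem exists_push (hΩ : IsSmoothJordanDomain Ω γ ℓ) {C : NNReal} {W : Plane → Plane}
    (hW : LipschitzWith C W) (hWγ : ∀ s, W (γ s) = -rightNormal γ s) :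
    ∃ τ₀ > (0 : ℝ), ∀ τ : ℝ, 0 < τ → τ ≤ τ₀ → ∀ x ∈ closure Ω, x + τ • W x ∈ Ω := by
  obtain ⟨θ₀, hθ₀, hext⟩ := hΩ.exists_exterior_discs
  obtain ⟨δ, hδ⟩ := hΩ.exists_isCollarWidth
  have hδ0 := hδ.pos
  have hC : (0 : ℝ) ≤ C := C.2
  refine ⟨min (min θ₀ δ) (1 / (8 * (C + 1))), by positivity, ?_⟩
  intro τ hτ hτ₀ x hx
  have hτ1 : τ ≤ θ₀ := hτ₀.trans ((min_le_left _ _).trans (min_le_left _ _))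
  have hτ2 : τ ≤ δ := hτ₀.trans ((min_le_left _ _).trans (min_le_right _ _))
  have hτ3 : τ ≤ 1 / (8 * (C + 1)) := hτ₀.trans (min_le_right _ _)
  by_cases hxΩ : x ∈ Ω
  · have hS : IsPreconnected ((fun θ : ℝ => x + θ • W x) '' Icc 0 τ) :=
      isPreconnected_Icc.image _ (by fun_prop)
    refine hS.subset_of_disjoint_frontier hΩ.isOpen ?_ ⟨x, ⟨0, ⟨le_rfl, hτ.le⟩, by simp⟩, hxΩ⟩
      ⟨τ, ⟨hτ.le, le_rfl⟩, rfl⟩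
    rintro _ ⟨θ, ⟨hθ, hθτ⟩, rfl⟩ hfr
    rw [← hΩ.range_eq] at hfr
    obtain ⟨s, hs⟩ := hfr
    simp only at hs
    rcases hθ.eq_or_lt with rfl | hθ
    · rw [zero_smul, add_zero] at hs
      exact hΩ.notMem s (hs ▸ hxΩ)
    · have hCθ : C * θ ≤ 1 / 8 := by
        have : (C + 1) * θ ≤ (C + 1) * (1 / (8 * (C + 1))) := by
          gcongr; exact hθτ.trans hτ3
        have h2 : ((C : ℝ) + 1) * (1 / (8 * (C + 1))) = 1 / 8 := by field_simp
        nlinarith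
      have h1 : ‖W x + rightNormal γ s‖ ≤ C * θ * ‖W x‖ := by
        have := hW.dist_le_mul x (γ s)
        rw [hWγ, dist_eq_norm, dist_eq_norm, sub_neg_eq_add, hs] at this
        refine this.trans (le_of_eq ?_)
        rw [← norm_neg, show -(x - (x + θ • W x)) = θ • W x by abel, norm_smul, Real.norm_eq_abs,
          abs_of_pos hθ, mul_assoc]
      have h2 : ‖W x‖ ≤ 2 := by
        have h3 : ‖W x‖ ≤ ‖W x + rightNormal γ s‖ + 1 := by
          have := norm_sub_le (W x + rightNormal γ s) (rightNormal γ s)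
          rwa [add_sub_cancel_right, hΩ.norm_normal] at this
        have : C * θ * ‖W x‖ ≤ 1 / 8 * ‖W x‖ := by gcongr
        linarith
      refine hext s θ hθ (hθτ.trans hτ1) x ?_ hx
      have e : x - collar γ s (-θ) = (-θ) • (W x + rightNormal γ s) := by
        rw [collar, hs, neg_smul, neg_smul, smul_add]; abel
      rw [e, norm_smul, norm_neg, Real.norm_eq_abs, abs_of_pos hθ]
      have : C * θ * ‖W x‖ ≤ 1 / 8 * 2 := by gcongr
      nlinarith
  · have : x ∈ frontier Ω := by rw [hΩ.isOpen.frontier_eq]; exact ⟨hx, hxΩ⟩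
    rw [← hΩ.range_eq] at this
    obtain ⟨s, rfl⟩ := this
    rw [hWγ, smul_neg, ← sub_eq_add_neg]
    exact hδ.mem s τ hτ hτ2

end IsSmoothJordanDomain

/-! ### Change of variables for maps with two real parameters -/

/-- The Cartesian coordinates of the plane as a linear isomorphism. -/
noncomputable def planeCoords : Plane ≃L[ℝ] ℝ × ℝ :=
  LinearEquiv.toContinuousLinearEquiv
    { toFun := fun x => (x 0, x 1)
      invFun := fun z => !₂[z.1, z.2]
      map_add' := fun _ _ => rfl
      map_smul' := fun _ _ => rfl
      left_inv := fun _ => plane_ext rfl rfl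
      right_inv := fun _ => rfl }

theorem planeCoords_apply (x : Plane) : planeCoords x = (x 0, x 1) := rfl

theorem measurePreserving_planeCoords : MeasurePreserving planeCoords :=
  (volume_preserving_finTwoArrow ℝ).comp (PiLp.volume_preserving_ofLp (Fin 2))

theorem measurableEmbedding_planeCoords : MeasurableEmbedding planeCoords :=
  planeCoords.toHomeomorph.measurableEmbedding

/-- The linear map `(u, v) ↦ u A + v B`, the derivative of a map with partial derivatives `A`
and `B`. -/
noncomputable def frameMap (A B : Plane) : ℝ × ℝ →L[ℝ] Plane :=
  (ContinuousLinearMap.fst ℝ ℝ ℝ).smulRight A + (ContinuousLinearMap.snd ℝ ℝ ℝ).smulRight B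

@[simp] theorem frameMap_apply (A B : Plane) (z : ℝ × ℝ) :
    frameMap A B z = z.1 • A + z.2 • B := rfl

/-- The determinant of the frame `A`, `B`. -/
noncomputable def frameDet (A B : Plane) : ℝ := A 0 * B 1 - A 1 * B 0

theorem det_frameMap_comp (A B : Plane) :
    ((frameMap A B).comp (planeCoords : Plane →L[ℝ] ℝ × ℝ)).det = frameDet A B := by
  rw [ContinuousLinearMap.det, ← LinearMap.det_toMatrix (EuclideanSpace.basisFun (Fin 2) ℝ).toBasis,
    Matrix.det_fin_two]
  simp [LinearMap.toMatrix_apply, planeCoords_apply, frameDet]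
  ring

theorem exists_frameMap_equiv {A B : Plane} (h : frameDet A B ≠ 0) :
    ∃ e : (ℝ × ℝ) ≃L[ℝ] Plane, (e : ℝ × ℝ →L[ℝ] Plane) = frameMap A B := by
  have hinj : Function.Injective (frameMap A B : ℝ × ℝ →ₗ[ℝ] Plane) := by
    rw [← LinearMap.ker_eq_bot, LinearMap.ker_eq_bot']
    rintro ⟨u, v⟩ huv
    have h0 := congrArg (fun x : Plane => x 0) huv
    have h1 := congrArg (fun x : Plane => x 1) huv
    simp at h0 h1
    unfold frameDet at h
    have hu : u * (A 0 * B 1 - A 1 * B 0) = 0 := by linear_combination B 1 * h0 - B 0 * h1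
    have hv : v * (A 0 * B 1 - A 1 * B 0) = 0 := by linear_combination A 0 * h1 - A 1 * h0
    simp [(mul_eq_zero.1 hu).resolve_right h, (mul_eq_zero.1 hv).resolve_right h]
  refine ⟨(LinearMap.linearEquivOfInjective _ hinj (by simp)).toContinuousLinearEquiv, ?_⟩
  ext <;> rfl

section ChangeOfVariables

variable {f : ℝ × ℝ → Plane} {A B : ℝ × ℝ → Plane} {S : Set (ℝ × ℝ)}

theorem lintegral_image_frame (hS : MeasurableSet S)
    (hf : ∀ z ∈ S, HasFDerivAt f (frameMap (A z) (B z)) z) (hinj : InjOn f S)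
    (g : Plane → ℝ≥0∞) :
    ∫⁻ x in f '' S, g x = ∫⁻ z in S, ENNReal.ofReal |frameDet (A z) (B z)| * g (f z) := by
  have himg : f '' S = (f ∘ planeCoords) '' (planeCoords ⁻¹' S) := by
    rw [image_comp, image_preimage_eq _ planeCoords.surjective]
  rw [himg, lintegral_image_eq_lintegral_abs_det_fderiv_mul volume
    (planeCoords.continuous.measurable hS)
    (fun x hx => ((hf _ hx).comp x planeCoords.hasFDerivAt).hasFDerivWithinAt)
    (fun x hx y hy h => planeCoords.injective (hinj hx hy h))]
  simp only [det_frameMap_comp]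
  exact measurePreserving_planeCoords.setLIntegral_comp_preimage_emb
    measurableEmbedding_planeCoords
    (fun z => ENNReal.ofReal |frameDet (A z) (B z)| * g (f z)) S

theorem integral_image_frame (hS : MeasurableSet S)
    (hf : ∀ z ∈ S, HasFDerivAt f (frameMap (A z) (B z)) z) (hinj : InjOn f S) (g : Plane → ℝ) :
    ∫ x in f '' S, g x = ∫ z in S, |frameDet (A z) (B z)| * g (f z) := by
  have himg : f '' S = (f ∘ planeCoords) '' (planeCoords ⁻¹' S) := by
    rw [image_comp, image_preimage_eq _ planeCoords.surjective]
  rw [himg, integral_image_eq_integral_abs_det_fderiv_smul volume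
    (planeCoords.continuous.measurable hS)
    (fun x hx => ((hf _ hx).comp x planeCoords.hasFDerivAt).hasFDerivWithinAt)
    (fun x hx y hy h => planeCoords.injective (hinj hx hy h))]
  simp only [det_frameMap_comp, smul_eq_mul]
  exact measurePreserving_planeCoords.setIntegral_preimage_emb
    measurableEmbedding_planeCoords
    (fun z => |frameDet (A z) (B z)| * g (f z)) S

end ChangeOfVariables

/-! ### Smooth cutoff functions in the collar -/

/-- The profile of the cutoff functions: it increases from `0` on `(-∞, 1/3]` to `1` on
`[2/3, ∞)`. -/
noncomputable def profile (u : ℝ) : ℝ := Real.smoothTransition (3 * u - 1)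

theorem contDiff_profile : ContDiff ℝ ∞ profile :=
  Real.smoothTransition.contDiff.comp (by fun_prop)

theorem profile_of_le {u : ℝ} (h : u ≤ 1 / 3) : profile u = 0 :=
  Real.smoothTransition.zero_of_nonpos (by linarith)

theorem profile_of_ge {u : ℝ} (h : 1 ≤ u) : profile u = 1 :=
  Real.smoothTransition.one_of_one_le (by linarith)

theorem profile_nonneg (u : ℝ) : 0 ≤ profile u := Real.smoothTransition.nonneg _

theorem profile_le_one (u : ℝ) : profile u ≤ 1 := Real.smoothTransition.le_one _

/-- The signed depth of a point of the collar of width `δ`, continued by `δ`. -/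
noncomputable def depth (γ : ℝ → Plane) (δ : ℝ) (x : Plane) : ℝ :=
  open Classical in
  if h : ∃ r, |r| ≤ δ ∧ ∃ s, collar γ s r = x then h.choose else δ

/-- The function on the plane that vanishes off `Ω`, and in `Ω` rises from `0` to `1` as the depth
runs from `0` to `t`. -/
noncomputable def cutoff (Ω : Set Plane) (γ : ℝ → Plane) (δ t : ℝ) (x : Plane) : ℝ :=
  open Classical in
  if x ∈ Ω then profile (depth γ δ x / t) else 0

theorem cutoff_nonneg (Ω : Set Plane) (γ : ℝ → Plane) (δ t : ℝ) (x : Plane) :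
    0 ≤ cutoff Ω γ δ t x := by
  unfold cutoff
  split_ifs
  exacts [profile_nonneg _, le_rfl]

theorem cutoff_le_one (Ω : Set Plane) (γ : ℝ → Plane) (δ t : ℝ) (x : Plane) :
    cutoff Ω γ δ t x ≤ 1 := by
  unfold cutoff
  split_ifs
  exacts [profile_le_one _, zero_le_one]

theorem cutoff_of_notMem {Ω : Set Plane} {γ : ℝ → Plane} {δ t : ℝ} {x : Plane} (h : x ∉ Ω) :
    cutoff Ω γ δ t x = 0 := if_neg h

namespace IsSmoothJordanDomain

variable {Ω : Set Plane} {γ : ℝ → Plane} {ℓ δ : ℝ}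

theorem collar_add_int_mul (hΩ : IsSmoothJordanDomain Ω γ ℓ) (s r : ℝ) (n : ℤ) :
    collar γ (s + n * ℓ) r = collar γ s r := by
  simp only [collar, hΩ.apply_add_int_mul, hΩ.normal_add_int_mul]

theorem collar_zero (s : ℝ) : collar γ s 0 = γ s := by simp [collar]

theorem contDiff_collar (hΩ : IsSmoothJordanDomain Ω γ ℓ) :
    ContDiff ℝ ∞ (fun z : ℝ × ℝ => collar γ z.1 z.2) := by
  have h1 := hΩ.smooth
  have h2 := hΩ.contDiff_normal
  unfold collar
  fun_prop

theorem hasDerivAt_collar (s u : ℝ) : HasDerivAt (collar γ s) (-rightNormal γ s) u := by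
  have := ((hasDerivAt_id u).smul_const (rightNormal γ s)).const_sub (γ s)
  rw [one_smul] at this
  exact this

theorem hasFDerivAt_collar (hΩ : IsSmoothJordanDomain Ω γ ℓ) (z : ℝ × ℝ) :
    HasFDerivAt (fun z : ℝ × ℝ => collar γ z.1 z.2)
      (frameMap ((1 - z.2 * normalCurvature γ z.1) • deriv γ z.1) (-rightNormal γ z.1)) z := by
  have h1 := (hΩ.hasDerivAt z.1).hasFDerivAt.comp z hasFDerivAt_fst
  have h2 := (hΩ.hasDerivAt_normal z.1).hasFDerivAt.comp z hasFDerivAt_fst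
  have h3 := h1.sub ((hasFDerivAt_snd (𝕜 := ℝ) (p := z)).smul h2)
  refine h3.congr_fderiv ?_
  ext <;> simp [hΩ.deriv_normal, sub_mul]; ring

theorem frameDet_collar (hΩ : IsSmoothJordanDomain Ω γ ℓ) (z : ℝ × ℝ) :
    frameDet ((1 - z.2 * normalCurvature γ z.1) • deriv γ z.1) (-rightNormal γ z.1) =
      1 - z.2 * normalCurvature γ z.1 := by
  have hu : deriv γ z.1 0 ^ 2 + deriv γ z.1 1 ^ 2 = 1 := by
    rw [← plane_norm_sq, hΩ.unit_speed]; norm_num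
  simp only [frameDet, rightNormal_eq, PiLp.smul_apply, PiLp.neg_apply, rotCW_zero_apply,
    rotCW_one_apply, smul_eq_mul]
  linear_combination (1 - z.2 * normalCurvature γ z.1) * hu

theorem jacobian_pos (hδ : IsCollarWidth Ω γ ℓ δ) {s t : ℝ} (ht : |t| ≤ δ) :
    1 / 2 ≤ 1 - t * normalCurvature γ s ∧ 1 - t * normalCurvature γ s ≤ 3 / 2 := by
  have := abs_le.1 (hδ.jacobian s t ht)
  constructor <;> linarith [this.1, this.2]

/-- The normal coordinates are smooth functions near each point of the collar. -/
theorem exists_collar_inverse (hΩ : IsSmoothJordanDomain Ω γ ℓ) (hδ : IsCollarWidth Ω γ ℓ δ)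
    (s r : ℝ) (hr : |r| ≤ δ) :
    ∃ Ψ : Plane → ℝ × ℝ, ContDiffAt ℝ ∞ Ψ (collar γ s r) ∧ Ψ (collar γ s r) = (s, r) ∧
      ∀ᶠ x in 𝓝 (collar γ s r), collar γ (Ψ x).1 (Ψ x).2 = x := by
  have hd : frameDet ((1 - r * normalCurvature γ s) • deriv γ s) (-rightNormal γ s) ≠ 0 := by
    rw [hΩ.frameDet_collar (s, r)]
    have := (jacobian_pos hδ (s := s) hr).1
    simp only
    linarith
  obtain ⟨e, he⟩ := exists_frameMap_equiv hd
  have h1 : ContDiffAt ℝ ∞ (fun z : ℝ × ℝ => collar γ z.1 z.2) (s, r) :=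
    hΩ.contDiff_collar.contDiffAt
  have h2 : HasFDerivAt (fun z : ℝ × ℝ => collar γ z.1 z.2) (e : ℝ × ℝ →L[ℝ] Plane) (s, r) := by
    rw [he]; exact hΩ.hasFDerivAt_collar (s, r)
  have hn : (∞ : WithTop ℕ∞) ≠ 0 := by simp
  refine ⟨h1.localInverse h2 hn, h1.to_localInverse h2 hn, h1.localInverse_apply_image h2 hn, ?_⟩
  exact (h1.hasStrictFDerivAt' h2 hn).eventually_right_inverse

theorem depth_collar (hδ : IsCollarWidth Ω γ ℓ δ) {s r : ℝ} (hr : |r| ≤ δ) :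
    depth γ δ (collar γ s r) = r := by
  have h : ∃ r', |r'| ≤ δ ∧ ∃ s', collar γ s' r' = collar γ s r := ⟨r, hr, s, rfl⟩
  rw [depth, dif_pos h]
  obtain ⟨h1, s', h2⟩ := h.choose_spec
  exact (hδ.inj _ _ _ _ h1 hr h2).1

theorem collar_mem_iff (hΩ : IsSmoothJordanDomain Ω γ ℓ) (hδ : IsCollarWidth Ω γ ℓ δ) {s r : ℝ}
    (hr : |r| ≤ δ) : collar γ s r ∈ Ω ↔ 0 < r := by
  refine ⟨fun h => ?_, fun h => hδ.mem s r h (le_of_abs_le hr)⟩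
  by_contra hn
  rcases (not_lt.1 hn).eq_or_lt with rfl | h0
  · rw [collar_zero] at h
    exact hΩ.notMem s h
  · have := hδ.notMem s (-r) (by linarith) ((neg_le_abs r).trans hr)
    rw [neg_neg] at this
    exact this (subset_closure h)

theorem cutoff_collar (hΩ : IsSmoothJordanDomain Ω γ ℓ) (hδ : IsCollarWidth Ω γ ℓ δ) {s r t : ℝ}
    (hr : |r| ≤ δ) (ht : 0 < t) : cutoff Ω γ δ t (collar γ s r) = profile (r / t) := by
  unfold cutoff
  split_ifs with h
  · rw [depth_collar hδ hr]
  · rw [hΩ.collar_mem_iff hδ hr, not_lt] at h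
    rw [profile_of_le]
    have := div_nonpos_of_nonpos_of_nonneg h ht.le
    linarith

theorem cutoff_eq_one (hΩ : IsSmoothJordanDomain Ω γ ℓ) (hδ : IsCollarWidth Ω γ ℓ δ) {t : ℝ}
    (ht : 0 < t) (htδ : t ≤ δ) {x : Plane} (hx : x ∈ Ω)
    (hx' : ∀ s r, 0 < r → r < t → collar γ s r ≠ x) : cutoff Ω γ δ t x = 1 := by
  unfold cutoff
  rw [if_pos hx, profile_of_ge]
  rw [one_le_div ht]
  by_cases h : ∃ r, |r| ≤ δ ∧ ∃ s, collar γ s r = x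
  · obtain ⟨r, hr, s, rfl⟩ := h
    rw [depth_collar hδ hr]
    rw [hΩ.collar_mem_iff hδ hr] at hx
    by_contra hlt
    exact hx' s r hx (not_le.1 hlt) rfl
  · rw [depth, dif_neg h]
    exact htδ

theorem eventually_cutoff_eq_one (hΩ : IsSmoothJordanDomain Ω γ ℓ) (hδ : IsCollarWidth Ω γ ℓ δ)
    {x : Plane} (hx : x ∈ Ω) : ∀ᶠ t in 𝓝[>] (0 : ℝ), cutoff Ω γ δ t x = 1 := by
  have hpos : 0 < depth γ δ x := by
    by_cases h : ∃ r, |r| ≤ δ ∧ ∃ s, collar γ s r = x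
    · obtain ⟨r, hr, s, rfl⟩ := h
      rw [depth_collar hδ hr]
      rwa [hΩ.collar_mem_iff hδ hr] at hx
    · rw [depth, dif_neg h]
      exact hδ.pos
  filter_upwards [Ioc_mem_nhdsGT hpos] with t ht
  unfold cutoff
  rw [if_pos hx, profile_of_ge]
  rw [one_le_div ht.1]
  exact ht.2

theorem eventually_cutoff_near_collar (hΩ : IsSmoothJordanDomain Ω γ ℓ)
    (hδ : IsCollarWidth Ω γ ℓ δ) {t : ℝ} (ht : 0 < t) {s r : ℝ} (hr : |r| < δ) :
    ∃ ρ : Plane → ℝ, ContDiffAt ℝ ∞ ρ (collar γ s r) ∧ ρ (collar γ s r) = r ∧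
      cutoff Ω γ δ t =ᶠ[𝓝 (collar γ s r)] fun x => profile (ρ x / t) := by
  obtain ⟨Ψ, h1, h2, h3⟩ := hΩ.exists_collar_inverse hδ s r hr.le
  refine ⟨fun x => (Ψ x).2, contDiff_snd.contDiffAt.comp _ h1, by simp only [h2], ?_⟩
  have h4 : ∀ᶠ x in 𝓝 (collar γ s r), |(Ψ x).2| < δ := by
    have hc : ContinuousAt (fun x => |(Ψ x).2|) (collar γ s r) :=
      (continuous_abs.comp continuous_snd).continuousAt.comp h1.continuousAt
    exact hc.eventually_lt continuousAt_const (by rw [h2]; exact hr)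
  filter_upwards [h3, h4] with x hx hx'
  conv_lhs => rw [← hx]
  rw [hΩ.cutoff_collar hδ hx'.le ht]

theorem contDiff_cutoff (hΩ : IsSmoothJordanDomain Ω γ ℓ) (hδ : IsCollarWidth Ω γ ℓ δ) {t : ℝ}
    (ht : 0 < t) (htδ : t < δ) : ContDiff ℝ ∞ (cutoff Ω γ δ t) := by
  rw [contDiff_iff_contDiffAt]
  intro x
  by_cases hx : ∃ s r, |r| < δ ∧ collar γ s r = x
  · obtain ⟨s, r, hr, rfl⟩ := hx
    obtain ⟨ρ, h1, -, h3⟩ := hΩ.eventually_cutoff_near_collar hδ ht (s := s) hr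
    exact (contDiff_profile.contDiffAt.comp _ (h1.div_const t)).congr_of_eventuallyEq h3
  · push Not at hx
    by_cases hcl : x ∈ closure Ω
    · have hxΩ : x ∈ Ω := by
        by_contra hn
        have : x ∈ frontier Ω := by rw [hΩ.isOpen.frontier_eq]; exact ⟨hcl, hn⟩
        rw [← hΩ.range_eq] at this
        obtain ⟨s, rfl⟩ := this
        exact hx s 0 (by simpa using hδ.pos) (collar_zero s)
      have hQ : IsCompact ((fun z : ℝ × ℝ => collar γ z.1 z.2) '' (Icc 0 ℓ ×ˢ Icc 0 t)) :=
        (isCompact_Icc.prod isCompact_Icc).image hΩ.contDiff_collar.continuous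
      have hxQ : x ∉ (fun z : ℝ × ℝ => collar γ z.1 z.2) '' (Icc 0 ℓ ×ˢ Icc 0 t) := by
        rintro ⟨⟨s, r⟩, ⟨-, hr⟩, rfl⟩
        exact hx s r (by rw [abs_of_nonneg hr.1]; exact hr.2.trans_lt htδ) rfl
      have h1 : cutoff Ω γ δ t =ᶠ[𝓝 x] fun _ => 1 := by
        filter_upwards [hΩ.isOpen.mem_nhds hxΩ, hQ.isClosed.isOpen_compl.mem_nhds hxQ] with y hy hyQ
        refine hΩ.cutoff_eq_one hδ ht htδ.le hy ?_
        rintro s r hr0 hrt rfl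
        refine hyQ ⟨(toIcoMod hΩ.length_pos 0 s, r),
          ⟨Ico_subset_Icc_self (toIcoMod_mem_Ico' _ s), hr0.le, hrt.le⟩, ?_⟩
        simp only [toIcoMod_eq_add_int_mul]
        exact hΩ.collar_add_int_mul s r _
      exact contDiffAt_const.congr_of_eventuallyEq h1
    · have h1 : cutoff Ω γ δ t =ᶠ[𝓝 x] fun _ => 0 := by
        filter_upwards [isClosed_closure.isOpen_compl.mem_nhds hcl] with y hy
        exact cutoff_of_notMem fun h => hy (subset_closure h)
      exact contDiffAt_const.congr_of_eventuallyEq h1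

theorem tsupport_cutoff_subset (hΩ : IsSmoothJordanDomain Ω γ ℓ) (hδ : IsCollarWidth Ω γ ℓ δ)
    {t : ℝ} (ht : 0 < t) : tsupport (cutoff Ω γ δ t) ⊆ Ω := by
  intro x hx
  by_contra hn
  refine (notMem_tsupport_iff_eventuallyEq.2 ?_) hx
  by_cases hcl : x ∈ closure Ω
  · have : x ∈ frontier Ω := by rw [hΩ.isOpen.frontier_eq]; exact ⟨hcl, hn⟩
    rw [← hΩ.range_eq] at this
    obtain ⟨s, rfl⟩ := this
    obtain ⟨ρ, h1, h2, h3⟩ := hΩ.eventually_cutoff_near_collar hδ ht (s := s) (r := 0)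
      (by simpa using hδ.pos)
    rw [collar_zero] at h1 h2 h3
    have h4 : ∀ᶠ x in 𝓝 (γ s), ρ x < t / 3 :=
      h1.continuousAt.eventually_lt continuousAt_const (by rw [h2]; positivity)
    filter_upwards [h3, h4] with x hx hx'
    rw [hx, profile_of_le, Pi.zero_apply]
    rw [div_le_iff₀ ht]
    linarith
  · filter_upwards [isClosed_closure.isOpen_compl.mem_nhds hcl] with y hy
    exact cutoff_of_notMem fun h => hy (subset_closure h)

theorem fderiv_cutoff_eq_zero (hΩ : IsSmoothJordanDomain Ω γ ℓ) (hδ : IsCollarWidth Ω γ ℓ δ)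
    {t : ℝ} (ht : 0 < t) (htδ : t ≤ δ) {x : Plane} (hx : x ∈ Ω)
    (hx' : ∀ s r, 0 < r → r < t → collar γ s r ≠ x) : fderiv ℝ (cutoff Ω γ δ t) x = 0 := by
  apply IsLocalMax.fderiv_eq_zero
  filter_upwards with y
  rw [hΩ.cutoff_eq_one hδ ht htδ hx hx']
  exact cutoff_le_one _ _ _ _ _

/-- In the collar the cutoff function depends on the depth only. -/
theorem fderiv_cutoff_collar (hΩ : IsSmoothJordanDomain Ω γ ℓ) (hδ : IsCollarWidth Ω γ ℓ δ)
    {s r t : ℝ} (ht : 0 < t) (htδ : t < δ) (hr : |r| < δ) (v : Plane) :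
    fderiv ℝ (cutoff Ω γ δ t) (collar γ s r) v =
      -(deriv profile (r / t) / t * inner ℝ v (rightNormal γ s)) := by
  have h1 : HasFDerivAt (cutoff Ω γ δ t) (fderiv ℝ (cutoff Ω γ δ t) (collar γ s r))
      (collar γ s r) :=
    ((hΩ.contDiff_cutoff hδ ht htδ).differentiable (by simp) _).hasFDerivAt
  have h2 := h1.comp (s, r) (hΩ.hasFDerivAt_collar (s, r))
  have h3 : HasDerivAt profile (deriv profile (r / t)) (r / t) :=
    (contDiff_profile.differentiable (by simp) _).hasDerivAt
  have h4 : HasFDerivAt (fun z : ℝ × ℝ => profile (z.2 / t))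
      (deriv profile (r / t) • (t⁻¹ • ContinuousLinearMap.snd ℝ ℝ ℝ)) (s, r) := by
    have h5 : HasFDerivAt (fun z : ℝ × ℝ => z.2 / t)
        (t⁻¹ • ContinuousLinearMap.snd ℝ ℝ ℝ) (s, r) := by
      simpa [div_eq_inv_mul] using (hasFDerivAt_snd (𝕜 := ℝ) (p := (s, r))).const_mul t⁻¹
    have h6 := h3.comp_hasFDerivAt (f := fun z : ℝ × ℝ => z.2 / t) (s, r) h5
    exact h6
  have h5 : (fun z : ℝ × ℝ => cutoff Ω γ δ t (collar γ z.1 z.2)) =ᶠ[𝓝 (s, r)]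
      fun z => profile (z.2 / t) := by
    have : ∀ᶠ z : ℝ × ℝ in 𝓝 (s, r), |z.2| < δ :=
      (continuous_abs.comp continuous_snd).continuousAt.eventually_lt continuousAt_const hr
    filter_upwards [this] with z hz
    exact hΩ.cutoff_collar hδ hz.le ht
  have h6 := h2.unique (h4.congr_of_eventuallyEq h5)
  have hJ := (jacobian_pos hδ (s := s) hr.le).1
  have hJ0 : 1 - r * normalCurvature γ s ≠ 0 := by linarith
  have h7 := congrArg (fun L => L (inner ℝ v (deriv γ s) / (1 - r * normalCurvature γ s),
    -inner ℝ v (rightNormal γ s))) h6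
  simp only [ContinuousLinearMap.comp_apply, frameMap_apply, _root_.smul_apply,
    ContinuousLinearMap.coe_snd', smul_smul, div_mul_cancel₀ _ hJ0, smul_eq_mul] at h7
  have hu : deriv γ s 0 ^ 2 + deriv γ s 1 ^ 2 = 1 := by
    rw [← plane_norm_sq, hΩ.unit_speed]; norm_num
  have hv : (inner ℝ v (deriv γ s) : ℝ) • deriv γ s
      + (-inner ℝ v (rightNormal γ s) : ℝ) • -rightNormal γ s = v := by
    apply plane_ext <;>
      simp only [plane_inner, rightNormal_eq, PiLp.add_apply, PiLp.smul_apply, PiLp.neg_apply,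
        rotCW_zero_apply, rotCW_one_apply, smul_eq_mul]
    · linear_combination v 0 * hu
    · linear_combination v 1 * hu
  rw [hv] at h7
  rw [h7]
  ring

end IsSmoothJordanDomain

/-! ### Traces as limits of averages over thin strips -/

/-- The coordinate rectangle of the strip of width `t` along the boundary. -/
def stripCoords (ℓ t : ℝ) : Set (ℝ × ℝ) := Ioc 0 ℓ ×ˢ Ioo 0 t

/-- The strip of width `t` along the boundary. -/
def strip (γ : ℝ → Plane) (ℓ t : ℝ) : Set Plane :=
  (fun z : ℝ × ℝ => collar γ z.1 z.2) '' stripCoords ℓ t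

theorem measurableSet_stripCoords (ℓ t : ℝ) : MeasurableSet (stripCoords ℓ t) :=
  measurableSet_Ioc.prod measurableSet_Ioo

theorem restrict_stripCoords (ℓ t : ℝ) :
    (volume : Measure (ℝ × ℝ)).restrict (stripCoords ℓ t) =
      (volume.restrict (Ioc 0 ℓ)).prod (volume.restrict (Ioo 0 t)) := by
  rw [stripCoords, Measure.volume_eq_prod, Measure.prod_restrict]

theorem setLIntegral_stripCoords_fst {ℓ t : ℝ} {h : ℝ → ℝ≥0∞}
    (hh : AEMeasurable h (volume.restrict (Ioc 0 ℓ))) :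
    ∫⁻ z in stripCoords ℓ t, h z.1 = ENNReal.ofReal t * ∫⁻ s in Ioc 0 ℓ, h s := by
  rw [restrict_stripCoords, lintegral_prod _ hh.comp_fst]
  simp only [lintegral_const, Measure.restrict_apply_univ, Real.volume_Ioo, sub_zero]
  rw [lintegral_mul_const'' _ hh, mul_comm]

namespace IsSmoothJordanDomain

variable {Ω : Set Plane} {γ : ℝ → Plane} {ℓ δ : ℝ}

theorem injOn_collar (hδ : IsCollarWidth Ω γ ℓ δ) {t : ℝ} (htδ : t ≤ δ) :
    InjOn (fun z : ℝ × ℝ => collar γ z.1 z.2) (stripCoords ℓ t) := by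
  rintro ⟨s, r⟩ ⟨hs, hr⟩ ⟨s', r'⟩ ⟨hs', hr'⟩ h
  simp only at hs hr hs' hr'
  have ha : |r| ≤ δ := by rw [abs_of_pos hr.1]; linarith [hr.2]
  have ha' : |r'| ≤ δ := by rw [abs_of_pos hr'.1]; linarith [hr'.2]
  obtain ⟨h1, n, hn⟩ := hδ.inj s s' r r' ha ha' h
  have hℓ : 0 < ℓ := by linarith [hs.1, hs.2]
  have hn0 : n = 0 := by
    have h2 : (n : ℝ) * ℓ < 1 * ℓ := by linarith [hs.2, hs'.1]
    have h3 : (-1 : ℝ) * ℓ < n * ℓ := by linarith [hs.1, hs'.2]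
    have h4 : (n : ℝ) < 1 := lt_of_mul_lt_mul_right h2 hℓ.le
    have h5 : (-1 : ℝ) < n := lt_of_mul_lt_mul_right h3 hℓ.le
    have h6 : n < 1 := by exact_mod_cast h4
    have h7 : -1 < n := by exact_mod_cast h5
    omega
  rw [hn0, Int.cast_zero, zero_mul, add_zero] at hn
  rw [h1, hn]

theorem strip_subset (hδ : IsCollarWidth Ω γ ℓ δ) {t : ℝ} (htδ : t ≤ δ) :
    strip γ ℓ t ⊆ Ω := by
  rintro _ ⟨⟨s, r⟩, ⟨-, hr⟩, rfl⟩
  exact hδ.mem s r hr.1 (hr.2.le.trans htδ)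

theorem collar_mem_strip (hΩ : IsSmoothJordanDomain Ω γ ℓ) (s : ℝ) {r t : ℝ} (h0 : 0 < r)
    (hrt : r < t) : collar γ s r ∈ strip γ ℓ t := by
  refine ⟨(toIocMod hΩ.length_pos 0 s, r), ⟨?_, h0, hrt⟩, ?_⟩
  · have := toIocMod_mem_Ioc hΩ.length_pos 0 s
    rwa [zero_add] at this
  · have e : toIocMod hΩ.length_pos 0 s = s + (-toIocDiv hΩ.length_pos 0 s : ℤ) * ℓ := by
      rw [← self_sub_toIocDiv_zsmul, zsmul_eq_mul]; push_cast; ring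
    simp only [e]
    exact hΩ.collar_add_int_mul s r _

theorem lintegral_strip (hΩ : IsSmoothJordanDomain Ω γ ℓ) (hδ : IsCollarWidth Ω γ ℓ δ) {t : ℝ}
    (htδ : t ≤ δ) (g : Plane → ℝ≥0∞) :
    ∫⁻ x in strip γ ℓ t, g x = ∫⁻ z in stripCoords ℓ t,
      ENNReal.ofReal |1 - z.2 * normalCurvature γ z.1| * g (collar γ z.1 z.2) := by
  rw [strip, lintegral_image_frame (measurableSet_stripCoords ℓ t)
    (fun z _ => hΩ.hasFDerivAt_collar z) (injOn_collar hδ htδ)]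
  simp only [hΩ.frameDet_collar]

theorem integral_strip (hΩ : IsSmoothJordanDomain Ω γ ℓ) (hδ : IsCollarWidth Ω γ ℓ δ) {t : ℝ}
    (htδ : t ≤ δ) (g : Plane → ℝ) :
    ∫ x in strip γ ℓ t, g x = ∫ z in stripCoords ℓ t,
      |1 - z.2 * normalCurvature γ z.1| * g (collar γ z.1 z.2) := by
  rw [strip, integral_image_frame (measurableSet_stripCoords ℓ t)
    (fun z _ => hΩ.hasFDerivAt_collar z) (injOn_collar hδ htδ)]
  simp only [hΩ.frameDet_collar]

theorem abs_le_of_mem_stripCoords {t : ℝ} (htδ : t ≤ δ) {z : ℝ × ℝ} (hz : z ∈ stripCoords ℓ t) :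
    |z.2| ≤ δ := by
  rw [abs_of_pos hz.2.1]
  exact hz.2.2.le.trans htδ

theorem lintegral_collar_le (hΩ : IsSmoothJordanDomain Ω γ ℓ) (hδ : IsCollarWidth Ω γ ℓ δ) {t : ℝ}
    (htδ : t ≤ δ) (g : Plane → ℝ≥0∞) :
    ∫⁻ z in stripCoords ℓ t, g (collar γ z.1 z.2) ≤ 2 * ∫⁻ x in strip γ ℓ t, g x := by
  rw [hΩ.lintegral_strip hδ htδ, ← lintegral_const_mul' _ _ (by simp)]
  refine setLIntegral_mono' (measurableSet_stripCoords ℓ t) fun z hz => ?_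
  rw [← mul_assoc]
  have h1 := (jacobian_pos hδ (s := z.1) (abs_le_of_mem_stripCoords htδ hz)).1
  have h2 : (1 : ℝ≥0∞) ≤ 2 * ENNReal.ofReal |1 - z.2 * normalCurvature γ z.1| := by
    rw [← ENNReal.ofReal_ofNat, ← ENNReal.ofReal_mul (by norm_num), ← ENNReal.ofReal_one]
    apply ENNReal.ofReal_le_ofReal
    rw [abs_of_pos (by linarith)]
    linarith
  calc g (collar γ z.1 z.2) = 1 * g (collar γ z.1 z.2) := (one_mul _).symm
    _ ≤ _ := by gcongr

theorem volume_strip_le (hΩ : IsSmoothJordanDomain Ω γ ℓ) (hδ : IsCollarWidth Ω γ ℓ δ) {t : ℝ}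
    (htδ : t ≤ δ) : volume (strip γ ℓ t) ≤ 2 * (ENNReal.ofReal t * ENNReal.ofReal ℓ) := by
  have h := hΩ.lintegral_strip hδ htδ 1
  simp only [Pi.one_apply, lintegral_const, Measure.restrict_apply_univ, one_mul, mul_one] at h
  rw [h]
  have h2 := setLIntegral_stripCoords_fst (ℓ := ℓ) (t := t) (h := fun _ => (2 : ℝ≥0∞))
    aemeasurable_const
  have h3 : ∫⁻ z in stripCoords ℓ t, ENNReal.ofReal |1 - z.2 * normalCurvature γ z.1| ≤
      ∫⁻ z in stripCoords ℓ t, (2 : ℝ≥0∞) := by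
    refine setLIntegral_mono' (measurableSet_stripCoords ℓ t) fun z hz => ?_
    have h1 := jacobian_pos hδ (s := z.1) (abs_le_of_mem_stripCoords htδ hz)
    rw [← ENNReal.ofReal_ofNat]
    apply ENNReal.ofReal_le_ofReal
    rw [abs_of_pos (by linarith)]
    linarith
  refine (h3.trans h2.le).trans (le_of_eq ?_)
  simp only [lintegral_const, Measure.restrict_apply_univ, Real.volume_Ioc, sub_zero]
  ring

theorem tendsto_volume_strip (hΩ : IsSmoothJordanDomain Ω γ ℓ) (hδ : IsCollarWidth Ω γ ℓ δ) :
    Tendsto (fun t => volume (strip γ ℓ t)) (𝓝[>] 0) (𝓝 0) := by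
  have h1 : Tendsto (fun t : ℝ => 2 * (ENNReal.ofReal t * ENNReal.ofReal ℓ)) (𝓝[>] 0) (𝓝 0) := by
    have h2 : Tendsto (fun t : ℝ => ENNReal.ofReal t) (𝓝[>] 0) (𝓝 (ENNReal.ofReal 0)) :=
      (ENNReal.continuous_ofReal.tendsto 0).mono_left nhdsWithin_le_nhds
    have h3 := ENNReal.Tendsto.const_mul (a := 2)
      (ENNReal.Tendsto.mul_const (b := ENNReal.ofReal ℓ) h2 (Or.inr (by simp))) (Or.inr (by simp))
    simpa using h3
  refine tendsto_of_tendsto_of_tendsto_of_le_of_le' tendsto_const_nhds h1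
    (Eventually.of_forall fun _ => zero_le) ?_
  filter_upwards [Ioc_mem_nhdsGT hδ.pos] with t ht
  exact hΩ.volume_strip_le hδ ht.2

/-- The deviation of a smooth function on a strip from its boundary values. -/
theorem lintegral_sub_boundary_le_of_smooth (hΩ : IsSmoothJordanDomain Ω γ ℓ)
    (hδ : IsCollarWidth Ω γ ℓ δ) {t : ℝ} (htδ : t ≤ δ) {φ : Plane → ℝ}
    (hφ : ContDiff ℝ ∞ φ) :
    ∫⁻ z in stripCoords ℓ t, ‖φ (collar γ z.1 z.2) - φ (γ z.1)‖ₑ ≤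
      2 * ENNReal.ofReal t * ∫⁻ x in strip γ ℓ t,
        (‖fderiv ℝ φ x (EuclideanSpace.single 0 1)‖ₑ +
          ‖fderiv ℝ φ x (EuclideanSpace.single 1 1)‖ₑ) := by
  set G : Plane → ℝ≥0∞ := fun x => ‖fderiv ℝ φ x (EuclideanSpace.single 0 1)‖ₑ +
          ‖fderiv ℝ φ x (EuclideanSpace.single 1 1)‖ₑ with hG
  have hdc : Continuous (fderiv ℝ φ) := hφ.continuous_fderiv (by simp)
  have hGc : Continuous G := by
    have h0 : Continuous fun x => fderiv ℝ φ x (EuclideanSpace.single 0 1) := by fun_prop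
    have h1 : Continuous fun x => fderiv ℝ φ x (EuclideanSpace.single 1 1) := by fun_prop
    exact h0.enorm.add h1.enorm
  have hcc : Continuous fun z : ℝ × ℝ => collar γ z.1 z.2 := hΩ.contDiff_collar.continuous
  have hγc : Continuous γ := hΩ.smooth.continuous
  have hpt : ∀ s r, 0 < r → r < t →
      ‖φ (collar γ s r) - φ (γ s)‖ₑ ≤ ∫⁻ u in Ioo 0 t, G (collar γ s u) := by
    intro s r h0 hrt
    have hd : ∀ u, HasDerivAt (fun u => φ (collar γ s u))
        (fderiv ℝ φ (collar γ s u) (-rightNormal γ s)) u := by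
      intro u
      exact ((hφ.differentiable (by simp) _).hasFDerivAt).comp_hasDerivAt u
        (hasDerivAt_collar s u)
    have hcd : Continuous fun u => fderiv ℝ φ (collar γ s u) (-rightNormal γ s) := by
      have : Continuous fun u => collar γ s u := by unfold collar; fun_prop
      fun_prop
    have hftc := intervalIntegral.integral_eq_sub_of_hasDerivAt (a := 0) (b := r)
      (fun u _ => hd u) (hcd.intervalIntegrable _ _)
    rw [collar_zero] at hftc
    rw [← hftc, intervalIntegral.integral_of_le h0.le]
    refine (enorm_integral_le_lintegral_enorm _).trans ?_
    refine (lintegral_mono' (Measure.restrict_mono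
      (fun u (hu : u ∈ Ioc 0 r) => (⟨hu.1, hu.2.trans_lt hrt⟩ : u ∈ Ioo 0 t)) le_rfl)
      (fun u => ?_))
    have hν : -rightNormal γ s = (-rightNormal γ s 0) • EuclideanSpace.single 0 (1 : ℝ) +
        (-rightNormal γ s 1) • EuclideanSpace.single 1 (1 : ℝ) := by
      apply plane_ext <;> simp
    have hb : ∀ i, ‖-rightNormal γ s i‖ₑ ≤ 1 := by
      intro i
      rw [enorm_neg, ← ofReal_norm, ← ENNReal.ofReal_one]
      apply ENNReal.ofReal_le_ofReal
      exact (PiLp.norm_apply_le _ i).trans_eq (hΩ.norm_normal s)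
    rw [hν, map_add, map_smul, map_smul, smul_eq_mul, smul_eq_mul]
    refine (enorm_add_le _ _).trans ?_
    rw [enorm_mul, enorm_mul]
    refine add_le_add ?_ ?_
    · exact (mul_le_mul_left (hb 0) _).trans_eq (one_mul _)
    · exact (mul_le_mul_left (hb 1) _).trans_eq (one_mul _)
  have hm : Measurable fun z : ℝ × ℝ => G (collar γ z.1 z.2) := (hGc.comp hcc).measurable
  have hms : Measurable fun s => ∫⁻ u in Ioo 0 t, G (collar γ s u) := hm.lintegral_prod_right'
  calc ∫⁻ z in stripCoords ℓ t, ‖φ (collar γ z.1 z.2) - φ (γ z.1)‖ₑ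
      ≤ ∫⁻ z in stripCoords ℓ t, ∫⁻ u in Ioo 0 t, G (collar γ z.1 u) :=
        setLIntegral_mono' (measurableSet_stripCoords ℓ t) fun z hz => hpt z.1 z.2 hz.2.1 hz.2.2
    _ = ENNReal.ofReal t * ∫⁻ s in Ioc 0 ℓ, ∫⁻ u in Ioo 0 t, G (collar γ s u) :=
        setLIntegral_stripCoords_fst hms.aemeasurable
    _ = ENNReal.ofReal t * ∫⁻ z in stripCoords ℓ t, G (collar γ z.1 z.2) := by
        rw [restrict_stripCoords, lintegral_prod _ hm.aemeasurable]
    _ ≤ ENNReal.ofReal t * (2 * ∫⁻ x in strip γ ℓ t, G x) := by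
        gcongr
        exact hΩ.lintegral_collar_le hδ htδ G
    _ = _ := by ring

theorem _root_.MeasureTheory.tendsto_lintegral_enorm_of_tendsto_eLpNorm_two {α : Type*}
    [MeasurableSpace α] {μ : Measure α} [IsFiniteMeasure μ] {f : ℕ → α → ℝ}
    (hf : ∀ k, AEStronglyMeasurable (f k) μ)
    (h : Tendsto (fun k => eLpNorm (f k) 2 μ) atTop (𝓝 0)) :
    Tendsto (fun k => ∫⁻ x, ‖f k x‖ₑ ∂μ) atTop (𝓝 0) := by
  have h1 : Tendsto (fun k => eLpNorm (f k) 2 μ * μ univ ^ (1 / (1 : ℝ≥0∞).toReal -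
      1 / (2 : ℝ≥0∞).toReal)) atTop (𝓝 0) := by
    have := ENNReal.Tendsto.mul_const (b := μ univ ^ (1 / (1 : ℝ≥0∞).toReal -
      1 / (2 : ℝ≥0∞).toReal)) h (Or.inr (ENNReal.rpow_ne_top_of_nonneg (by norm_num)
        (measure_ne_top μ univ)))
    rwa [zero_mul] at this
  refine tendsto_of_tendsto_of_tendsto_of_le_of_le tendsto_const_nhds h1
    (fun _ => zero_le) fun k => ?_
  simp only
  rw [← eLpNorm_one_eq_lintegral_enorm]
  exact eLpNorm_le_eLpNorm_mul_rpow_measure_univ (by norm_num) (hf k)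

theorem isFiniteMeasure_restrict (hΩ : IsSmoothJordanDomain Ω γ ℓ) :
    IsFiniteMeasure ((volume : Measure Plane).restrict Ω) :=
  ⟨by rw [Measure.restrict_apply_univ]; exact hΩ.isBounded.measure_lt_top⟩

/-- The deviation of an `H¹` function on a strip from its trace, by approximation. -/
theorem lintegral_sub_trace_le (hΩ : IsSmoothJordanDomain Ω γ ℓ)
    (hδ : IsCollarWidth Ω γ ℓ δ) {t : ℝ} (htδ : t ≤ δ) {g : Plane → ℝ} {τ : ℝ → ℝ}
    {dg : Fin 2 → Plane → ℝ} {φ : ℕ → Plane → ℝ}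
    (hg : AEStronglyMeasurable g (volume.restrict Ω))
    (hτ : AEStronglyMeasurable τ (volume.restrict (Ioc 0 ℓ)))
    (hdg : ∀ i, AEStronglyMeasurable (dg i) (volume.restrict Ω))
    (hφ : ∀ k, ContDiff ℝ ∞ (φ k))
    (h1 : Tendsto (fun k => eLpNorm (fun x => φ k x - g x) 2 (volume.restrict Ω)) atTop (𝓝 0))
    (h2 : ∀ i, Tendsto (fun k => eLpNorm
      (fun x => fderiv ℝ (φ k) x (EuclideanSpace.single i 1) - dg i x) 2 (volume.restrict Ω))
      atTop (𝓝 0))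
    (h3 : Tendsto (fun k => eLpNorm (fun s => φ k (γ s) - τ s) 2 (volume.restrict (Ioc 0 ℓ)))
      atTop (𝓝 0)) :
    ∫⁻ z in stripCoords ℓ t, ‖g (collar γ z.1 z.2) - τ z.1‖ₑ ≤
      2 * ENNReal.ofReal t * ∫⁻ x in strip γ ℓ t, (‖dg 0 x‖ₑ + ‖dg 1 x‖ₑ) := by
  have := hΩ.isFiniteMeasure_restrict
  have hγc : Continuous γ := hΩ.smooth.continuous
  have hcc : Continuous fun z : ℝ × ℝ => collar γ z.1 z.2 := hΩ.contDiff_collar.continuous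
  have hdφ : ∀ k i, Continuous fun x => fderiv ℝ (φ k) x (EuclideanSpace.single i 1) := by
    intro k i
    have : Continuous (fderiv ℝ (φ k)) := (hφ k).continuous_fderiv (by simp)
    fun_prop
  have e1 := tendsto_lintegral_enorm_of_tendsto_eLpNorm_two
    (fun k => (hφ k).continuous.aestronglyMeasurable.sub hg) h1
  have e2 := fun i => tendsto_lintegral_enorm_of_tendsto_eLpNorm_two
    (fun k => (hdφ k i).aestronglyMeasurable.sub (hdg i)) (h2 i)
  have e3 := tendsto_lintegral_enorm_of_tendsto_eLpNorm_two
    (fun k => (((hφ k).continuous.comp hγc).aestronglyMeasurable).sub hτ) h3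
  have hsub : (volume : Measure Plane).restrict (strip γ ℓ t) ≤ volume.restrict Ω :=
    Measure.restrict_mono (strip_subset hδ htδ) le_rfl
  set I := ∫⁻ x in strip γ ℓ t, (‖dg 0 x‖ₑ + ‖dg 1 x‖ₑ) with hI
  have key : ∀ k, ∫⁻ z in stripCoords ℓ t, ‖g (collar γ z.1 z.2) - τ z.1‖ₑ ≤
      2 * (∫⁻ x in Ω, ‖φ k x - g x‖ₑ) + (2 * ENNReal.ofReal t * (I +
        ((∫⁻ x in Ω, ‖fderiv ℝ (φ k) x (EuclideanSpace.single 0 1) - dg 0 x‖ₑ) +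
        ∫⁻ x in Ω, ‖fderiv ℝ (φ k) x (EuclideanSpace.single 1 1) - dg 1 x‖ₑ))
        + ENNReal.ofReal t * ∫⁻ s in Ioc 0 ℓ, ‖φ k (γ s) - τ s‖ₑ) := by
    intro k
    have hφc := (hφ k).continuous
    have hB : Measurable fun z : ℝ × ℝ => ‖φ k (collar γ z.1 z.2) - φ k (γ z.1)‖ₑ := by
      have : Continuous fun z : ℝ × ℝ => φ k (collar γ z.1 z.2) - φ k (γ z.1) := by fun_prop
      exact this.enorm.measurable
    have hc : AEMeasurable (fun s => ‖φ k (γ s) - τ s‖ₑ) (volume.restrict (Ioc 0 ℓ)) :=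
      ((hφc.comp hγc).aestronglyMeasurable.sub hτ).enorm
    have hC : AEMeasurable (fun z : ℝ × ℝ => ‖φ k (γ z.1) - τ z.1‖ₑ)
        (volume.restrict (stripCoords ℓ t)) := by
      rw [restrict_stripCoords]
      exact hc.comp_fst
    have hBC : AEMeasurable (fun z : ℝ × ℝ => ‖φ k (collar γ z.1 z.2) - φ k (γ z.1)‖ₑ +
        ‖φ k (γ z.1) - τ z.1‖ₑ) (volume.restrict (stripCoords ℓ t)) := hB.aemeasurable.add hC
    calc ∫⁻ z in stripCoords ℓ t, ‖g (collar γ z.1 z.2) - τ z.1‖ₑ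
        ≤ ∫⁻ z in stripCoords ℓ t, (‖φ k (collar γ z.1 z.2) - g (collar γ z.1 z.2)‖ₑ +
          (‖φ k (collar γ z.1 z.2) - φ k (γ z.1)‖ₑ + ‖φ k (γ z.1) - τ z.1‖ₑ)) := by
          refine lintegral_mono fun z => ?_
          have : g (collar γ z.1 z.2) - τ z.1 =
            -(φ k (collar γ z.1 z.2) - g (collar γ z.1 z.2)) +
              ((φ k (collar γ z.1 z.2) - φ k (γ z.1)) + (φ k (γ z.1) - τ z.1)) := by ring
          rw [this]
          refine (enorm_add_le _ _).trans ?_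
          rw [enorm_neg]
          gcongr
          exact enorm_add_le _ _
      _ = (∫⁻ z in stripCoords ℓ t, ‖φ k (collar γ z.1 z.2) - g (collar γ z.1 z.2)‖ₑ) +
          ((∫⁻ z in stripCoords ℓ t, ‖φ k (collar γ z.1 z.2) - φ k (γ z.1)‖ₑ) +
            ∫⁻ z in stripCoords ℓ t, ‖φ k (γ z.1) - τ z.1‖ₑ) := by
          rw [lintegral_add_right' _ hBC, lintegral_add_left hB]
      _ ≤ _ := by
          refine add_le_add ?_ (add_le_add ?_ ?_)
          · refine (hΩ.lintegral_collar_le hδ htδ (fun x => ‖φ k x - g x‖ₑ)).trans ?_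
            gcongr
          · refine (hΩ.lintegral_sub_boundary_le_of_smooth hδ htδ (hφ k)).trans ?_
            gcongr
            have hm : ∀ i, AEMeasurable (fun x => ‖fderiv ℝ (φ k) x (EuclideanSpace.single i 1)
                - dg i x‖ₑ) (volume.restrict (strip γ ℓ t)) := fun i =>
              ((hdφ k i).aestronglyMeasurable.sub ((hdg i).mono_measure hsub)).enorm
            calc ∫⁻ x in strip γ ℓ t, (‖fderiv ℝ (φ k) x (EuclideanSpace.single 0 1)‖ₑ +
                  ‖fderiv ℝ (φ k) x (EuclideanSpace.single 1 1)‖ₑ)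
                ≤ ∫⁻ x in strip γ ℓ t, ((‖dg 0 x‖ₑ + ‖dg 1 x‖ₑ) +
                  (‖fderiv ℝ (φ k) x (EuclideanSpace.single 0 1) - dg 0 x‖ₑ +
                  ‖fderiv ℝ (φ k) x (EuclideanSpace.single 1 1) - dg 1 x‖ₑ)) := by
                  refine lintegral_mono fun x => ?_
                  have h (a b : ℝ) : ‖a‖ₑ ≤ ‖b‖ₑ + ‖a - b‖ₑ := by
                    calc ‖a‖ₑ = ‖b + (a - b)‖ₑ := by congr 1; ring
                      _ ≤ _ := enorm_add_le _ _
                  calc _ ≤ _ := add_le_add (h _ (dg 0 x)) (h _ (dg 1 x))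
                    _ = _ := by ring
              _ = I + ((∫⁻ x in strip γ ℓ t,
                    ‖fderiv ℝ (φ k) x (EuclideanSpace.single 0 1) - dg 0 x‖ₑ) +
                  ∫⁻ x in strip γ ℓ t,
                    ‖fderiv ℝ (φ k) x (EuclideanSpace.single 1 1) - dg 1 x‖ₑ) := by
                  have hm2 : AEMeasurable (fun x =>
                      ‖fderiv ℝ (φ k) x (EuclideanSpace.single 0 1) - dg 0 x‖ₑ +
                      ‖fderiv ℝ (φ k) x (EuclideanSpace.single 1 1) - dg 1 x‖ₑ)
                      (volume.restrict (strip γ ℓ t)) := (hm 0).add (hm 1)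
                  rw [lintegral_add_right' _ hm2, lintegral_add_left' (hm 0)]
              _ ≤ _ := by gcongr
          · exact (setLIntegral_stripCoords_fst hc).le
  have hlim : Tendsto (fun k => 2 * (∫⁻ x in Ω, ‖φ k x - g x‖ₑ) + (2 * ENNReal.ofReal t * (I +
        ((∫⁻ x in Ω, ‖fderiv ℝ (φ k) x (EuclideanSpace.single 0 1) - dg 0 x‖ₑ) +
        ∫⁻ x in Ω, ‖fderiv ℝ (φ k) x (EuclideanSpace.single 1 1) - dg 1 x‖ₑ))
        + ENNReal.ofReal t * ∫⁻ s in Ioc 0 ℓ, ‖φ k (γ s) - τ s‖ₑ)) atTop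
      (𝓝 (2 * 0 + (2 * ENNReal.ofReal t * (I + (0 + 0)) + ENNReal.ofReal t * 0))) := by
    refine Tendsto.add (ENNReal.Tendsto.const_mul e1 (Or.inr (by simp))) (Tendsto.add ?_ ?_)
    · exact ENNReal.Tendsto.const_mul (tendsto_const_nhds.add ((e2 0).add (e2 1)))
        (Or.inr (ENNReal.mul_ne_top (by simp) (by simp)))
    · exact ENNReal.Tendsto.const_mul e3 (Or.inr (by simp))
  have := ge_of_tendsto' hlim key
  simpa using this

/-- The mean deviation of an `H¹` function on a strip from its trace tends to zero with the width
of the strip. -/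
theorem tendsto_average_sub_trace (hΩ : IsSmoothJordanDomain Ω γ ℓ)
    (hδ : IsCollarWidth Ω γ ℓ δ) {g g' T : Plane → ℝ} (hT : HasTrace Ω γ ℓ g T)
    (hg' : g' =ᵐ[volume.restrict Ω] g) :
    Tendsto (fun t => (ENNReal.ofReal t)⁻¹ *
      ∫⁻ z in stripCoords ℓ t, ‖g' (collar γ z.1 z.2) - T (γ z.1)‖ₑ) (𝓝[>] 0) (𝓝 0) := by
  obtain ⟨hg, hτ, dg, φ, hdg, hφ, h1, h2, h3⟩ := hT
  have hfin := hΩ.isFiniteMeasure_restrict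
  have h1' : Tendsto (fun k => eLpNorm (fun x => φ k x - g' x) 2 (volume.restrict Ω)) atTop
      (𝓝 0) := by
    refine h1.congr fun k => eLpNorm_congr_ae ?_
    filter_upwards [hg'] with x hx
    rw [hx]
  have hI : ∀ i, ∫⁻ x in Ω, ‖dg i x‖ₑ ≠ ⊤ := by
    intro i
    exact ((hdg i).2.integrable (by norm_num)).2.ne
  have hI2 : ∫⁻ x in Ω, (‖dg 0 x‖ₑ + ‖dg 1 x‖ₑ) ≠ ⊤ := by
    rw [lintegral_add_left' (hdg 0).2.1.enorm]
    exact ENNReal.add_ne_top.2 ⟨hI 0, hI 1⟩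
  have hvol : Tendsto ((volume.restrict Ω) ∘ strip γ ℓ) (𝓝[>] 0) (𝓝 0) :=
    tendsto_of_tendsto_of_tendsto_of_le_of_le tendsto_const_nhds (hΩ.tendsto_volume_strip hδ)
      (fun _ => zero_le) fun t => Measure.restrict_apply_le Ω _
  have hz := tendsto_setLIntegral_zero hI2 hvol
  have hz2 := ENNReal.Tendsto.const_mul (a := 2) hz (Or.inr (by simp))
  rw [mul_zero] at hz2
  refine tendsto_of_tendsto_of_tendsto_of_le_of_le' tendsto_const_nhds hz2
    (Eventually.of_forall fun _ => zero_le) ?_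
  filter_upwards [Ioc_mem_nhdsGT hδ.pos] with t ht
  have h := hΩ.lintegral_sub_trace_le hδ ht.2 (hg.1.congr hg'.symm) hτ.1 (fun i => (hdg i).2.1) hφ
    h1' h2 h3
  rw [Measure.restrict_restrict_of_subset (strip_subset hδ ht.2)]
  have ht0 : ENNReal.ofReal t ≠ 0 := by simpa using ht.1
  calc _ ≤ (ENNReal.ofReal t)⁻¹ * (2 * ENNReal.ofReal t *
        ∫⁻ x in strip γ ℓ t, (‖dg 0 x‖ₑ + ‖dg 1 x‖ₑ)) := by gcongr
    _ = ((ENNReal.ofReal t)⁻¹ * ENNReal.ofReal t) * (2 *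
        ∫⁻ x in strip γ ℓ t, (‖dg 0 x‖ₑ + ‖dg 1 x‖ₑ)) := by ring
    _ = _ := by rw [ENNReal.inv_mul_cancel ht0 (by simp), one_mul]

end IsSmoothJordanDomain

/-! ### The flux through the boundary -/

/-- `F` takes the boundary values `σ` along `γ` in the mean: its mean deviation from them on a strip
tends to zero with the width of the strip. -/
def HasMeanBoundaryValue (γ : ℝ → Plane) (ℓ : ℝ) (F : Plane → Plane) (σ : ℝ → Plane) : Prop :=
  Tendsto (fun t => (ENNReal.ofReal t)⁻¹ *
    ∫⁻ z in stripCoords ℓ t, ‖F (collar γ z.1 z.2) - σ z.1‖ₑ) (𝓝[>] 0) (𝓝 0)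

theorem tendsto_average_of_continuous {ℓ : ℝ} (hℓ : 0 < ℓ) {H : ℝ × ℝ → ℝ} (hH : Continuous H)
    (h0 : ∀ s, H (s, 0) = 0) :
    Tendsto (fun t => (ENNReal.ofReal t)⁻¹ * ∫⁻ z in stripCoords ℓ t, ‖H z‖ₑ) (𝓝[>] 0) (𝓝 0) := by
  rw [ENNReal.tendsto_nhds_zero]
  intro ε hε
  obtain ⟨e, he0, he⟩ : ∃ e : ℝ, 0 < e ∧ ENNReal.ofReal e * ENNReal.ofReal ℓ ≤ ε := by
    rcases eq_or_ne ε ⊤ with rfl | hε'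
    · exact ⟨1, one_pos, le_top⟩
    · refine ⟨ε.toReal / ℓ, div_pos (ENNReal.toReal_pos hε.ne' hε') hℓ, ?_⟩
      rw [← ENNReal.ofReal_mul (by positivity), div_mul_cancel₀ _ hℓ.ne', ENNReal.ofReal_toReal hε']
  obtain ⟨u, v, -, hv, hu, h0v, huv⟩ := generalized_tube_lemma (s := Icc 0 ℓ) isCompact_Icc
    (t := {(0 : ℝ)}) isCompact_singleton (n := {z | ‖H z‖ < e})
    (isOpen_lt hH.norm continuous_const) (by
      rintro ⟨s, r⟩ ⟨-, hr⟩
      have hr : r = 0 := hr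
      change ‖H (s, r)‖ < e
      rw [hr, h0, norm_zero]
      exact he0)
  obtain ⟨d, hd, hdv⟩ := Metric.isOpen_iff.1 hv 0 (h0v rfl)
  filter_upwards [Ioc_mem_nhdsGT hd] with t ht
  have h1 : ∫⁻ z in stripCoords ℓ t, ‖H z‖ₑ ≤ ∫⁻ z in stripCoords ℓ t, ENNReal.ofReal e := by
    refine setLIntegral_mono' (measurableSet_stripCoords ℓ t) fun z hz => ?_
    have hz2 : z.2 ∈ v := hdv (by
      rw [Metric.mem_ball, Real.dist_0_eq_abs, abs_of_pos hz.2.1]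
      exact hz.2.2.trans_le ht.2)
    have : ‖H z‖ < e := huv (mk_mem_prod (hu (Ioc_subset_Icc_self hz.1)) hz2)
    rw [← ofReal_norm]
    exact ENNReal.ofReal_le_ofReal this.le
  have h2 := setLIntegral_stripCoords_fst (ℓ := ℓ) (t := t) (h := fun _ => ENNReal.ofReal e)
    aemeasurable_const
  simp only [lintegral_const, Measure.restrict_apply_univ, Real.volume_Ioc, sub_zero] at h1 h2
  rw [h2] at h1
  have ht0 : ENNReal.ofReal t ≠ 0 := by simpa using ht.1
  calc _ ≤ (ENNReal.ofReal t)⁻¹ * (ENNReal.ofReal t * (ENNReal.ofReal e * ENNReal.ofReal ℓ)) := by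
        gcongr
    _ = ENNReal.ofReal e * ENNReal.ofReal ℓ := by
        rw [← mul_assoc, ENNReal.inv_mul_cancel ht0 (by simp), one_mul]
    _ ≤ ε := he

theorem integral_deriv_profile {t : ℝ} (ht : 0 < t) :
    ∫ r in Ioo 0 t, deriv profile (r / t) / t = 1 := by
  rw [← integral_Ioc_eq_integral_Ioo, ← intervalIntegral.integral_of_le ht.le]
  have hd : ∀ r, HasDerivAt (fun r => profile (r / t)) (deriv profile (r / t) / t) r := by
    intro r
    have h1 : HasDerivAt profile (deriv profile (r / t)) (r / t) :=
      (contDiff_profile.differentiable (by simp) _).hasDerivAt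
    have h2 := HasDerivAt.comp (h₂ := profile) r h1 ((hasDerivAt_id r).div_const t)
    rw [mul_one_div] at h2
    exact h2
  have hc : Continuous fun r => deriv profile (r / t) / t := by
    have : Continuous (deriv profile) := contDiff_profile.continuous_deriv (by simp)
    fun_prop
  rw [intervalIntegral.integral_eq_sub_of_hasDerivAt (fun r _ => hd r) (hc.intervalIntegrable _ _),
    div_self ht.ne', profile_of_ge le_rfl, zero_div, profile_of_le (by norm_num), sub_zero]

namespace IsSmoothJordanDomain

variable {Ω : Set Plane} {γ : ℝ → Plane} {ℓ δ : ℝ}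

theorem continuous_normalCurvature (hΩ : IsSmoothJordanDomain Ω γ ℓ) :
    Continuous (normalCurvature γ) := by
  have h1 := (contDiff_infty_iff_deriv.1 hΩ.contDiff_normal).2.continuous
  have h2 := hΩ.contDiff_deriv.continuous
  unfold normalCurvature
  fun_prop

theorem isCompact_closure (hΩ : IsSmoothJordanDomain Ω γ ℓ) : IsCompact (closure Ω) :=
  hΩ.isBounded.isCompact_closure

theorem exists_bound_on (hΩ : IsSmoothJordanDomain Ω γ ℓ) {E : Type*} [SeminormedAddCommGroup E]
    {f : Plane → E} (hf : Continuous f) : ∃ C, 0 ≤ C ∧ ∀ x ∈ closure Ω, ‖f x‖ ≤ C := by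
  obtain ⟨C, hC⟩ := hΩ.isCompact_closure.exists_bound_of_continuousOn hf.continuousOn
  exact ⟨max C 0, le_max_right _ _, fun x hx => (hC x hx).trans (le_max_left _ _)⟩

theorem integrableOn_of_continuous_mul (hΩ : IsSmoothJordanDomain Ω γ ℓ) {F : Plane → Plane}
    (hF : Measurable F) {M : ℝ} (hFM : ∀ x, ‖F x‖ ≤ M) {L : Plane → Plane →L[ℝ] ℝ}
    (hL : Continuous L) : IntegrableOn (fun x => L x (F x)) Ω := by
  obtain ⟨C, hC0, hC⟩ := hΩ.exists_bound_on hL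
  have hm : Measurable fun x => L x (F x) := by
    have h1 : Continuous fun z : (Plane →L[ℝ] ℝ) × Plane => z.1 z.2 := by fun_prop
    exact h1.measurable.comp (hL.measurable.prodMk hF)
  refine Measure.integrableOn_of_bounded (M := C * M) hΩ.isBounded.measure_lt_top.ne
    hm.aestronglyMeasurable ?_
  refine (ae_restrict_iff' hΩ.isOpen.measurableSet).2 (Eventually.of_forall fun x hx => ?_)
  exact ((L x).le_opNorm _).trans
    (mul_le_mul (hC x (subset_closure hx)) (hFM x) (norm_nonneg _) hC0)

/-- The gradients of the cutoff functions pick out the normal component of the boundary values. -/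
theorem tendsto_integral_mul_fderiv_cutoff (hΩ : IsSmoothJordanDomain Ω γ ℓ)
    (hδ : IsCollarWidth Ω γ ℓ δ) {F : Plane → Plane} {σ : ℝ → Plane} (hF : Measurable F) {M : ℝ}
    (hFM : ∀ x, ‖F x‖ ≤ M) (hσ : Integrable σ (volume.restrict (Ioc 0 ℓ)))
    (hFσ : HasMeanBoundaryValue γ ℓ F σ) {φ : Plane → ℝ} (hφ : Continuous φ) :
    Tendsto (fun t => ∫ x in Ω, φ x * fderiv ℝ (cutoff Ω γ δ t) x (F x)) (𝓝[>] 0)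
      (𝓝 (-∫ s in Ioc 0 ℓ, φ (γ s) * inner ℝ (σ s) (rightNormal γ s))) := by
  have hγc : Continuous γ := hΩ.smooth.continuous
  have hνc : Continuous (rightNormal γ) := hΩ.contDiff_normal.continuous
  have hκc := hΩ.continuous_normalCurvature
  have hcc : Continuous fun z : ℝ × ℝ => collar γ z.1 z.2 := hΩ.contDiff_collar.continuous
  have hM0 : 0 ≤ M := (norm_nonneg _).trans (hFM 0)
  obtain ⟨Cφ, hCφ0, hCφ⟩ := hΩ.exists_bound_on hφ
  have hpc : Continuous (deriv profile) := contDiff_profile.continuous_deriv (by simp)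
  obtain ⟨Cη, hCη⟩ := (isCompact_Icc (a := (0 : ℝ)) (b := 1)).exists_bound_of_continuousOn
    hpc.continuousOn
  have hCη0 : 0 ≤ Cη := (norm_nonneg _).trans (hCη 0 (by simp))
  set H : ℝ × ℝ → ℝ := fun z =>
    (1 - z.2 * normalCurvature γ z.1) * φ (collar γ z.1 z.2) - φ (γ z.1) with hHdef
  have hHc : Continuous H := by fun_prop
  have hHt := tendsto_average_of_continuous hΩ.length_pos hHc
    (fun s => by simp [hHdef, collar_zero])
  set h : ℝ → ℝ := fun s => φ (γ s) * inner ℝ (σ s) (rightNormal γ s) with hh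
  have hhint : Integrable h (volume.restrict (Ioc 0 ℓ)) := by
    have h1 : Integrable (fun s => inner ℝ (σ s) (rightNormal γ s)) (volume.restrict (Ioc 0 ℓ)) := by
      refine hσ.norm.mono' (hσ.1.inner hνc.aestronglyMeasurable) (Eventually.of_forall fun s => ?_)
      have := norm_inner_le_norm (𝕜 := ℝ) (σ s) (rightNormal γ s)
      rwa [hΩ.norm_normal, mul_one] at this
    refine h1.bdd_mul (c := Cφ) (hφ.comp hγc).aestronglyMeasurable
      (Eventually.of_forall fun s => hCφ _ ?_)
    exact frontier_subset_closure (hΩ.mem_frontier s)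
  set f : ℝ → ℝ × ℝ → ℝ := fun t z => |1 - z.2 * normalCurvature γ z.1| * (φ (collar γ z.1 z.2) *
    -(deriv profile (z.2 / t) / t * inner ℝ (F (collar γ z.1 z.2)) (rightNormal γ z.1))) with hf
  set g : ℝ → ℝ × ℝ → ℝ := fun t z => -(h z.1 * (deriv profile (z.2 / t) / t)) with hg
  have hA : ∀ t, 0 < t → t < δ →
      ∫ x in Ω, φ x * fderiv ℝ (cutoff Ω γ δ t) x (F x) = ∫ z in stripCoords ℓ t, f t z := by
    intro t ht htδ
    rw [setIntegral_eq_of_subset_of_forall_sdiff_eq_zero hΩ.isOpen.measurableSet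
      (strip_subset hδ htδ.le), hΩ.integral_strip hδ htδ.le]
    · refine setIntegral_congr_fun (measurableSet_stripCoords ℓ t) fun z hz => ?_
      simp only [hf]
      rw [hΩ.fderiv_cutoff_collar hδ ht htδ]
      rw [abs_of_pos hz.2.1]
      exact hz.2.2.trans htδ
    · rintro x ⟨hxΩ, hx⟩
      rw [hΩ.fderiv_cutoff_eq_zero hδ ht htδ.le hxΩ]
      · simp
      · rintro s r hr hrt rfl
        exact hx (hΩ.collar_mem_strip s hr hrt)
  have hpint : ∀ t, IntegrableOn (fun r => deriv profile (r / t) / t) (Ioo 0 t) := by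
    intro t
    have : Continuous fun r => deriv profile (r / t) / t := by fun_prop
    exact (this.integrableOn_Icc (a := 0) (b := t)).mono_set Ioo_subset_Icc_self
  have hB : ∀ t, 0 < t → ∫ z in stripCoords ℓ t, g t z = -∫ s in Ioc 0 ℓ, h s := by
    intro t ht
    rw [integral_neg, restrict_stripCoords, integral_prod_mul h (fun r => deriv profile (r / t) / t),
      integral_deriv_profile ht, mul_one]
  have hgint : ∀ t, IntegrableOn (g t) (stripCoords ℓ t) := by
    intro t
    have := hhint.mul_prod (hpint t)
    rw [← restrict_stripCoords] at this
    exact this.neg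
  have hpb : ∀ t, 0 < t → ∀ z ∈ stripCoords ℓ t, |deriv profile (z.2 / t)| ≤ Cη := by
    intro t ht z hz
    refine hCη _ ⟨div_nonneg hz.2.1.le ht.le, ?_⟩
    rw [div_le_one ht]
    exact hz.2.2.le
  have hfint : ∀ t, 0 < t → t < δ → IntegrableOn (f t) (stripCoords ℓ t) := by
    intro t ht htδ
    have hfin : volume (stripCoords ℓ t) ≠ ⊤ := by
      rw [stripCoords, Measure.volume_eq_prod, Measure.prod_prod, Real.volume_Ioc, Real.volume_Ioo]
      exact ENNReal.mul_ne_top (by simp) (by simp)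
    refine Measure.integrableOn_of_bounded (M := 3 / 2 * (Cφ * (Cη / t * M))) hfin ?_ ?_
    · have hFm : Measurable fun z : ℝ × ℝ => F (collar γ z.1 z.2) := hF.comp hcc.measurable
      have h1 : Continuous fun z : ℝ × ℝ => rightNormal γ z.1 := by fun_prop
      have h2 : Measurable fun z : ℝ × ℝ =>
          (inner ℝ (F (collar γ z.1 z.2)) (rightNormal γ z.1) : ℝ) := hFm.inner h1.measurable
      have h3 : Measurable fun z : ℝ × ℝ => |1 - z.2 * normalCurvature γ z.1| := by
        have : Continuous fun z : ℝ × ℝ => |1 - z.2 * normalCurvature γ z.1| := by fun_prop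
        exact this.measurable
      have h4 : Measurable fun z : ℝ × ℝ => φ (collar γ z.1 z.2) :=
        (hφ.comp hcc).measurable
      have h5 : Measurable fun z : ℝ × ℝ => deriv profile (z.2 / t) / t := by
        have : Continuous fun z : ℝ × ℝ => deriv profile (z.2 / t) / t := by fun_prop
        exact this.measurable
      exact (h3.mul (h4.mul (h5.mul h2).neg)).aestronglyMeasurable
    · refine (ae_restrict_iff' (measurableSet_stripCoords ℓ t)).2
        (Eventually.of_forall fun z hz => ?_)
      have hJ := jacobian_pos hδ (s := z.1) (abs_le_of_mem_stripCoords htδ.le hz)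
      have h2 : |(inner ℝ (F (collar γ z.1 z.2)) (rightNormal γ z.1) : ℝ)| ≤ M := by
        have := abs_real_inner_le_norm (F (collar γ z.1 z.2)) (rightNormal γ z.1)
        rw [hΩ.norm_normal, mul_one] at this
        exact this.trans (hFM _)
      have h3 : |φ (collar γ z.1 z.2)| ≤ Cφ :=
        hCφ _ (subset_closure (strip_subset hδ htδ.le (mem_image_of_mem _ hz)))
      simp only [hf]
      rw [Real.norm_eq_abs, abs_mul, abs_mul, abs_neg, abs_mul, abs_div, abs_abs, abs_of_pos ht,
        abs_of_pos (show (0 : ℝ) < 1 - z.2 * normalCurvature γ z.1 by linarith)]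
      have := hpb t ht z hz
      gcongr
      exact hJ.2
  have hfg : ∀ t, 0 < t → t < δ → ∀ z ∈ stripCoords ℓ t, ‖f t z - g t z‖ₑ ≤
      ENNReal.ofReal Cη * (ENNReal.ofReal t)⁻¹ * (ENNReal.ofReal M * ‖H z‖ₑ +
        ENNReal.ofReal Cφ * ‖F (collar γ z.1 z.2) - σ z.1‖ₑ) := by
    intro t ht htδ z hz
    have hJ := jacobian_pos hδ (s := z.1) (abs_le_of_mem_stripCoords htδ.le hz)
    have e : f t z - g t z = deriv profile (z.2 / t) * t⁻¹ *
        -(H z * inner ℝ (F (collar γ z.1 z.2)) (rightNormal γ z.1) +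
          φ (γ z.1) * inner ℝ (F (collar γ z.1 z.2) - σ z.1) (rightNormal γ z.1)) := by
      simp only [hf, hg, hh, hHdef, inner_sub_left]
      rw [abs_of_pos (show (0 : ℝ) < 1 - z.2 * normalCurvature γ z.1 by linarith)]
      ring
    have hν : ‖rightNormal γ z.1‖ₑ = 1 := by
      rw [← ofReal_norm, hΩ.norm_normal, ENNReal.ofReal_one]
    have hin : ∀ v : Plane, ‖(inner ℝ v (rightNormal γ z.1) : ℝ)‖ₑ ≤ ‖v‖ₑ := by
      intro v
      rw [← ofReal_norm, ← ofReal_norm]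
      apply ENNReal.ofReal_le_ofReal
      have := norm_inner_le_norm (𝕜 := ℝ) v (rightNormal γ z.1)
      rwa [hΩ.norm_normal, mul_one] at this
    have hF' : ‖F (collar γ z.1 z.2)‖ₑ ≤ ENNReal.ofReal M := by
      rw [← ofReal_norm]; exact ENNReal.ofReal_le_ofReal (hFM _)
    have hφ' : ‖φ (γ z.1)‖ₑ ≤ ENNReal.ofReal Cφ := by
      rw [← ofReal_norm]
      exact ENNReal.ofReal_le_ofReal (hCφ _ (frontier_subset_closure (hΩ.mem_frontier _)))
    have hη' : ‖deriv profile (z.2 / t)‖ₑ ≤ ENNReal.ofReal Cη := by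
      rw [← ofReal_norm]; exact ENNReal.ofReal_le_ofReal (hpb t ht z hz)
    have ht' : ‖t⁻¹‖ₑ = (ENNReal.ofReal t)⁻¹ := by
      rw [← ofReal_norm, Real.norm_eq_abs, abs_of_pos (inv_pos.2 ht), ENNReal.ofReal_inv_of_pos ht]
    rw [e, enorm_mul, enorm_mul, enorm_neg, ht']
    gcongr
    refine (enorm_add_le _ _).trans ?_
    rw [enorm_mul, enorm_mul, mul_comm]
    gcongr
    · exact (hin _).trans hF'
    · exact hin _
  rw [tendsto_iff_edist_tendsto_0]
  have hlim : Tendsto (fun t => ENNReal.ofReal Cη * (ENNReal.ofReal M * ((ENNReal.ofReal t)⁻¹ *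
      ∫⁻ z in stripCoords ℓ t, ‖H z‖ₑ) + ENNReal.ofReal Cφ * ((ENNReal.ofReal t)⁻¹ *
      ∫⁻ z in stripCoords ℓ t, ‖F (collar γ z.1 z.2) - σ z.1‖ₑ))) (𝓝[>] 0)
      (𝓝 (ENNReal.ofReal Cη * (ENNReal.ofReal M * 0 + ENNReal.ofReal Cφ * 0))) :=
    ENNReal.Tendsto.const_mul (Tendsto.add
      (ENNReal.Tendsto.const_mul hHt (Or.inr (by simp)))
      (ENNReal.Tendsto.const_mul hFσ (Or.inr (by simp)))) (Or.inr (by simp))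
  simp only [mul_zero, add_zero] at hlim
  refine tendsto_of_tendsto_of_tendsto_of_le_of_le' tendsto_const_nhds hlim
    (Eventually.of_forall fun _ => zero_le) ?_
  filter_upwards [Ioo_mem_nhdsGT hδ.pos] with t ht
  rw [edist_eq_enorm_sub, hA t ht.1 ht.2, ← hB t ht.1,
    ← integral_sub (hfint t ht.1 ht.2) (hgint t)]
  refine (enorm_integral_le_lintegral_enorm _).trans ?_
  have hHm : Measurable fun z => ENNReal.ofReal M * ‖H z‖ₑ := hHc.enorm.measurable.const_mul _
  calc ∫⁻ z in stripCoords ℓ t, ‖f t z - g t z‖ₑ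
      ≤ ∫⁻ z in stripCoords ℓ t, ENNReal.ofReal Cη * (ENNReal.ofReal t)⁻¹ *
        (ENNReal.ofReal M * ‖H z‖ₑ + ENNReal.ofReal Cφ * ‖F (collar γ z.1 z.2) - σ z.1‖ₑ) :=
        setLIntegral_mono' (measurableSet_stripCoords ℓ t) (hfg t ht.1 ht.2)
    _ = _ := by
        have ht0 : (ENNReal.ofReal t)⁻¹ ≠ ⊤ := by
          rw [ne_eq, ENNReal.inv_eq_top]
          simpa using ht.1
        rw [lintegral_const_mul' _ _ (ENNReal.mul_ne_top (by simp) ht0), lintegral_add_left hHm,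
          lintegral_const_mul' _ _ (by simp), lintegral_const_mul' _ _ (by simp)]
        ring

/-- Green's formula for a bounded divergence-free field with boundary values in the mean. -/
theorem integral_fderiv_eq_boundary (hΩ : IsSmoothJordanDomain Ω γ ℓ)
    {F : Plane → Plane} {σ : ℝ → Plane} (hF : Measurable F) {M : ℝ}
    (hFM : ∀ x, ‖F x‖ ≤ M) (hσ : Integrable σ (volume.restrict (Ioc 0 ℓ)))
    (hFσ : HasMeanBoundaryValue γ ℓ F σ)
    (hdiv : ∀ φ, IsTestFunction Ω φ → ∫ x in Ω, fderiv ℝ φ x (F x) = 0)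
    {φ : Plane → ℝ} (hφ : ContDiff ℝ ∞ φ) :
    ∫ x in Ω, fderiv ℝ φ x (F x) =
      ∫ s in Ioc 0 ℓ, φ (γ s) * inner ℝ (σ s) (rightNormal γ s) := by
  obtain ⟨δ, hδ⟩ := hΩ.exists_isCollarWidth
  have h1 := hΩ.tendsto_integral_mul_fderiv_cutoff hδ hF hFM hσ hFσ hφ.continuous
  have hdφ : Continuous (fderiv ℝ φ) := hφ.continuous_fderiv (by simp)
  have hint := hΩ.integrableOn_of_continuous_mul hF hFM hdφ
  have h2 : Tendsto (fun t => ∫ x in Ω, cutoff Ω γ δ t x * fderiv ℝ φ x (F x)) (𝓝[>] 0)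
      (𝓝 (∫ x in Ω, fderiv ℝ φ x (F x))) := by
    refine tendsto_integral_filter_of_dominated_convergence (fun x => ‖fderiv ℝ φ x (F x)‖)
      ?_ ?_ hint.norm ?_
    · filter_upwards [Ioo_mem_nhdsGT hδ.pos] with t ht
      exact (hΩ.contDiff_cutoff hδ ht.1 ht.2).continuous.aestronglyMeasurable.mul hint.1
    · refine Eventually.of_forall fun t => Eventually.of_forall fun x => ?_
      rw [norm_mul, Real.norm_eq_abs, abs_of_nonneg (cutoff_nonneg _ _ _ _ _)]
      exact mul_le_of_le_one_left (norm_nonneg _) (cutoff_le_one _ _ _ _ _)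
    · refine (ae_restrict_iff' hΩ.isOpen.measurableSet).2 (Eventually.of_forall fun x hx => ?_)
      refine tendsto_const_nhds.congr' ?_
      filter_upwards [hΩ.eventually_cutoff_eq_one hδ hx] with t ht
      rw [ht, one_mul]
  have h3 : ∀ᶠ t in 𝓝[>] (0 : ℝ), (∫ x in Ω, cutoff Ω γ δ t x * fderiv ℝ φ x (F x)) +
      ∫ x in Ω, φ x * fderiv ℝ (cutoff Ω γ δ t) x (F x) = 0 := by
    filter_upwards [Ioo_mem_nhdsGT hδ.pos] with t ht
    have hχ := hΩ.contDiff_cutoff hδ ht.1 ht.2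
    have hsupp : tsupport (fun x => cutoff Ω γ δ t x * φ x) ⊆ tsupport (cutoff Ω γ δ t) :=
      closure_mono (Function.support_mul_subset_left _ _)
    have htest : IsTestFunction Ω (fun x => cutoff Ω γ δ t x * φ x) := by
      refine ⟨hχ.mul hφ, ?_, hsupp.trans (hΩ.tsupport_cutoff_subset hδ ht.1)⟩
      exact Metric.isCompact_of_isClosed_isBounded (isClosed_tsupport _)
        (hΩ.isBounded.subset (hsupp.trans (hΩ.tsupport_cutoff_subset hδ ht.1)))
    rw [← hdiv _ htest, ← integral_add]
    · refine integral_congr_ae (Eventually.of_forall fun x => ?_)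
      simp only
      rw [fderiv_fun_mul (hχ.differentiable (by simp) x) (hφ.differentiable (by simp) x)]
      simp
    · have := hΩ.integrableOn_of_continuous_mul hF hFM (hχ.continuous.smul hdφ)
      simpa [IntegrableOn] using this
    · have := hΩ.integrableOn_of_continuous_mul hF hFM
        (hφ.continuous.smul (hχ.continuous_fderiv (by simp)))
      simpa [IntegrableOn] using this
  have h4 := tendsto_nhds_unique (tendsto_const_nhds.congr' (h3.mono fun _ h => h.symm)) (h2.add h1)
  linarith

end IsSmoothJordanDomain

/-! ### The current of a solution -/

theorem norm_superCurrent_le {p : Plane} (hp : ‖p‖ ≤ 1) :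
    ‖superCurrent p‖ ≤ 2 / (3 * Real.sqrt 3) := by
  have h0 := norm_nonneg p
  have h1 : 0 ≤ 1 - ‖p‖ ^ 2 := by nlinarith
  rw [superCurrent, norm_smul, Real.norm_eq_abs, abs_of_nonneg h1]
  have h3 : Real.sqrt 3 ^ 2 = 3 := Real.sq_sqrt (by norm_num)
  have h4 : 0 < Real.sqrt 3 := Real.sqrt_pos.2 (by norm_num)
  rw [le_div_iff₀ (by positivity)]
  -- `2 - 3w(1 - r²) = (wr - 1)² (wr + 2)` for `w = √3`, `r = |p|`
  have h5 : 0 ≤ (Real.sqrt 3 * ‖p‖ - 1) ^ 2 * (Real.sqrt 3 * ‖p‖ + 2) := by positivity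
  have h6 : Real.sqrt 3 ^ 3 = 3 * Real.sqrt 3 := by rw [pow_succ, h3]
  have h7 : (Real.sqrt 3 * ‖p‖ - 1) ^ 2 * (Real.sqrt 3 * ‖p‖ + 2) =
      Real.sqrt 3 ^ 3 * ‖p‖ ^ 3 - 3 * Real.sqrt 3 * ‖p‖ + 2 := by ring
  rw [h7, h6] at h5
  nlinarith

theorem norm_superCurrent_sub_le {p q : Plane} (hp : ‖p‖ ≤ 1) (hq : ‖q‖ ≤ 1) :
    ‖superCurrent p - superCurrent q‖ ≤ 3 * ‖p - q‖ := by
  have e : superCurrent p - superCurrent q =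
      (1 - ‖p‖ ^ 2) • (p - q) + (‖q‖ ^ 2 - ‖p‖ ^ 2) • q := by
    simp only [superCurrent, smul_sub, sub_smul]; abel
  have h1 : |1 - ‖p‖ ^ 2| ≤ 1 := by
    rw [abs_le]; constructor <;> nlinarith [norm_nonneg p]
  have h2 : |‖q‖ ^ 2 - ‖p‖ ^ 2| ≤ 2 * ‖p - q‖ := by
    rw [show ‖q‖ ^ 2 - ‖p‖ ^ 2 = (‖q‖ - ‖p‖) * (‖q‖ + ‖p‖) by ring, abs_mul, mul_comm,
      abs_of_nonneg (add_nonneg (norm_nonneg q) (norm_nonneg p)), norm_sub_rev]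
    gcongr
    · linarith
    · exact abs_norm_sub_norm_le q p
  rw [e]
  refine (norm_add_le _ _).trans ?_
  rw [norm_smul, norm_smul, Real.norm_eq_abs, Real.norm_eq_abs]
  calc _ ≤ 1 * ‖p - q‖ + 2 * ‖p - q‖ * 1 := by gcongr
    _ = _ := by ring

theorem continuous_superCurrent : Continuous superCurrent := by
  unfold superCurrent; fun_prop

theorem enorm_le_coords (v : Plane) : ‖v‖ₑ ≤ ‖v 0‖ₑ + ‖v 1‖ₑ := by
  conv_lhs => rw [eq_sum_single v]
  refine (enorm_add_le _ _).trans ?_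
  simp [norm_smul, ← ofReal_norm]

theorem aestronglyMeasurable_of_coords {α : Type*} [MeasurableSpace α] {μ : Measure α}
    {f : α → Plane} (h : ∀ i, AEStronglyMeasurable (fun x => f x i) μ) :
    AEStronglyMeasurable f μ := by
  have e : f = fun x => f x 0 • EuclideanSpace.single 0 (1 : ℝ) +
      f x 1 • EuclideanSpace.single 1 (1 : ℝ) := funext fun x => eq_sum_single (f x)
  rw [e]
  exact ((h 0).smul_const _).add ((h 1).smul_const _)

theorem exists_measurable_bounded_of_ae {α : Type*} [MeasurableSpace α] {μ : Measure α}
    {p : α → Plane} (hp : AEStronglyMeasurable p μ) (hb : ∀ᵐ x ∂μ, ‖p x‖ ≤ 1) :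
    ∃ q : α → Plane, Measurable q ∧ (∀ x, ‖q x‖ ≤ 1) ∧ q =ᵐ[μ] p := by
  have hm : Measurable (hp.mk p) := hp.stronglyMeasurable_mk.measurable
  refine ⟨{x | ‖hp.mk p x‖ ≤ 1}.indicator (hp.mk p),
    hm.indicator (measurableSet_le hm.norm measurable_const), fun x => ?_, ?_⟩
  · by_cases h : x ∈ {x | ‖hp.mk p x‖ ≤ 1}
    · rw [indicator_of_mem h]; exact h
    · rw [indicator_of_notMem h, norm_zero]; exact zero_le_one
  · filter_upwards [hp.ae_eq_mk, hb] with x h1 h2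
    rw [indicator_of_mem, h1]
    change ‖hp.mk p x‖ ≤ 1
    rwa [← h1]

namespace IsSmoothJordanDomain

variable {Ω : Set Plane} {γ : ℝ → Plane} {ℓ δ : ℝ}

theorem hasMeanBoundaryValue_of_coords (hΩ : IsSmoothJordanDomain Ω γ ℓ) {q : Plane → Plane}
    {τ : ℝ → Plane} (hq : Measurable q)
    (hτ : AEStronglyMeasurable τ (volume.restrict (Ioc 0 ℓ)))
    (h : ∀ i, Tendsto (fun t => (ENNReal.ofReal t)⁻¹ *
      ∫⁻ z in stripCoords ℓ t, ‖q (collar γ z.1 z.2) i - τ z.1 i‖ₑ) (𝓝[>] 0) (𝓝 0)) :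
    HasMeanBoundaryValue γ ℓ q τ := by
  have hcc : Continuous fun z : ℝ × ℝ => collar γ z.1 z.2 := hΩ.contDiff_collar.continuous
  have hs := (h 0).add (h 1)
  rw [add_zero] at hs
  refine tendsto_of_tendsto_of_tendsto_of_le_of_le tendsto_const_nhds hs (fun _ => zero_le)
    fun t => ?_
  simp only
  have hm : AEMeasurable (fun z : ℝ × ℝ => ‖q (collar γ z.1 z.2) 0 - τ z.1 0‖ₑ)
      (volume.restrict (stripCoords ℓ t)) := by
    have h1 : AEMeasurable (fun z : ℝ × ℝ => τ z.1) (volume.restrict (stripCoords ℓ t)) := by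
      rw [restrict_stripCoords]; exact hτ.aemeasurable.comp_fst
    have h2 : Measurable fun v : Plane => v 0 := by fun_prop
    exact ((h2.comp (hq.comp hcc.measurable)).aemeasurable.sub (h2.comp_aemeasurable h1)).enorm
  rw [← mul_add, ← lintegral_add_left' hm]
  gcongr with z
  exact enorm_le_coords _

/-- Boundary values in the mean inherit a pointwise bound. -/
theorem ae_norm_le_one_of_hasMeanBoundaryValue {q : Plane → Plane}
    {τ : ℝ → Plane} (hq1 : ∀ x, ‖q x‖ ≤ 1)
    (hτ : AEStronglyMeasurable τ (volume.restrict (Ioc 0 ℓ)))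
    (h : HasMeanBoundaryValue γ ℓ q τ) : ∀ᵐ s ∂volume.restrict (Ioc 0 ℓ), ‖τ s‖ ≤ 1 := by
  have hm : AEMeasurable (fun s => ‖τ s‖ₑ - 1) (volume.restrict (Ioc 0 ℓ)) :=
    hτ.enorm.sub aemeasurable_const
  have hle : ∀ᶠ t in 𝓝[>] (0 : ℝ), ∫⁻ s in Ioc 0 ℓ, (‖τ s‖ₑ - 1) ≤ (ENNReal.ofReal t)⁻¹ *
      ∫⁻ z in stripCoords ℓ t, ‖q (collar γ z.1 z.2) - τ z.1‖ₑ := by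
    filter_upwards [self_mem_nhdsWithin] with t ht
    have ht0 : ENNReal.ofReal t ≠ 0 := by simpa using ht
    have e : ∫⁻ s in Ioc 0 ℓ, (‖τ s‖ₑ - 1) = (ENNReal.ofReal t)⁻¹ *
        ∫⁻ z in stripCoords ℓ t, (‖τ z.1‖ₑ - 1) := by
      rw [setLIntegral_stripCoords_fst hm, ← mul_assoc, ENNReal.inv_mul_cancel ht0 (by simp),
        one_mul]
    rw [e]
    gcongr with z
    rw [tsub_le_iff_right, add_comm]
    have h1 : ‖q (collar γ z.1 z.2)‖ₑ ≤ 1 := by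
      rw [← ofReal_norm, ← ENNReal.ofReal_one]
      exact ENNReal.ofReal_le_ofReal (hq1 _)
    calc ‖τ z.1‖ₑ = ‖q (collar γ z.1 z.2) - (q (collar γ z.1 z.2) - τ z.1)‖ₑ := by
          congr 1; abel
      _ ≤ ‖q (collar γ z.1 z.2)‖ₑ + ‖q (collar γ z.1 z.2) - τ z.1‖ₑ := enorm_sub_le
      _ ≤ _ := by gcongr
  have h0 : ∫⁻ s in Ioc 0 ℓ, (‖τ s‖ₑ - 1) = 0 :=
    le_antisymm (ge_of_tendsto h hle) zero_le
  filter_upwards [(lintegral_eq_zero_iff' hm).1 h0] with s hs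
  simp only [Pi.zero_apply, tsub_eq_zero_iff_le] at hs
  rw [← ofReal_norm, ← ENNReal.ofReal_one] at hs
  exact (ENNReal.ofReal_le_ofReal_iff zero_le_one).1 hs

theorem hasMeanBoundaryValue_superCurrent {q : Plane → Plane}
    {τ : ℝ → Plane} (hq1 : ∀ x, ‖q x‖ ≤ 1)
    (hτ1 : ∀ᵐ s ∂volume.restrict (Ioc 0 ℓ), ‖τ s‖ ≤ 1)
    (h : HasMeanBoundaryValue γ ℓ q τ) :
    HasMeanBoundaryValue γ ℓ (fun x => superCurrent (q x)) (fun s => superCurrent (τ s)) := by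
  have h3 := ENNReal.Tendsto.const_mul (a := 3) h (Or.inr (by simp))
  rw [mul_zero] at h3
  refine tendsto_of_tendsto_of_tendsto_of_le_of_le tendsto_const_nhds h3 (fun _ => zero_le)
    fun t => ?_
  simp only
  have hc := lintegral_const_mul' (μ := volume.restrict (stripCoords ℓ t)) 3
    (fun z => ‖q (collar γ z.1 z.2) - τ z.1‖ₑ) (by simp)
  rw [mul_left_comm, ← hc]
  refine mul_le_mul_right (lintegral_mono_ae ?_) _
  have hae : ∀ᵐ z ∂(volume : Measure (ℝ × ℝ)).restrict (stripCoords ℓ t), ‖τ z.1‖ ≤ 1 := by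
    rw [restrict_stripCoords]
    exact Measure.quasiMeasurePreserving_fst.ae hτ1
  filter_upwards [hae] with z hz
  have h3 : (3 : ℝ≥0∞) = ENNReal.ofReal 3 := by simp
  rw [← ofReal_norm, ← ofReal_norm, h3, ← ENNReal.ofReal_mul (by norm_num)]
  exact ENNReal.ofReal_le_ofReal (norm_superCurrent_sub_le (hq1 _) hz)

/-- The current of a solution, as a bounded field whose flux through the boundary is `j` in the
weak sense, up to the boundary. -/
theorem exists_bounded_current (hΩ : IsSmoothJordanDomain Ω γ ℓ) {j ζ : Plane → ℝ}
    (hsol : IsOuterSolution Ω γ ℓ j ζ) :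
    ∃ F : Plane → Plane, Measurable F ∧ (∀ x, ‖F x‖ ≤ 2 / (3 * Real.sqrt 3)) ∧
      ∀ φ : Plane → ℝ, ContDiff ℝ ∞ φ →
        ∫ x in Ω, fderiv ℝ φ x (F x) = ∫ s in Ioc 0 ℓ, φ (γ s) * j (γ s) := by
  obtain ⟨-, p, T, -, hp1, ⟨-, -, hdiv⟩, hT, hj, -, -⟩ := hsol
  obtain ⟨δ, hδ⟩ := hΩ.exists_isCollarWidth
  have hpm : AEStronglyMeasurable p (volume.restrict Ω) :=
    aestronglyMeasurable_of_coords fun i => (hT i).1.1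
  obtain ⟨q, hq, hq1, hqp⟩ := exists_measurable_bounded_of_ae hpm hp1
  have hτ : AEStronglyMeasurable (fun s => T (γ s)) (volume.restrict (Ioc 0 ℓ)) :=
    aestronglyMeasurable_of_coords fun i => (hT i).2.1.1
  have hmean : HasMeanBoundaryValue γ ℓ q (fun s => T (γ s)) := by
    refine hΩ.hasMeanBoundaryValue_of_coords hq hτ fun i => ?_
    have hqi : (fun x => q x i) =ᵐ[volume.restrict Ω] fun x => p x i := by
      filter_upwards [hqp] with x hx
      rw [hx]
    have h := hΩ.tendsto_average_sub_trace (g := fun x => p x i) (T := fun x => T x i) hδ (hT i) hqi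
    exact h
  have hτ1 := ae_norm_le_one_of_hasMeanBoundaryValue hq1 hτ hmean
  have hmeanS := hasMeanBoundaryValue_superCurrent hq1 hτ1 hmean
  have hSm : Measurable fun x => superCurrent (q x) := continuous_superCurrent.measurable.comp hq
  have hσ : Integrable (fun s => superCurrent (T (γ s))) (volume.restrict (Ioc 0 ℓ)) := by
    refine Integrable.mono' (integrable_const (2 / (3 * Real.sqrt 3)))
      (continuous_superCurrent.comp_aestronglyMeasurable hτ) ?_
    filter_upwards [hτ1] with s hs using norm_superCurrent_le hs
  refine ⟨fun x => superCurrent (q x), hSm, fun x => norm_superCurrent_le (hq1 x),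
    fun φ hφ => ?_⟩
  rw [hΩ.integral_fderiv_eq_boundary hSm (fun x => norm_superCurrent_le (hq1 x)) hσ hmeanS ?_ hφ]
  · refine integral_congr_ae ?_
    filter_upwards [hj] with s hs
    rw [← hs, superCurrent, real_inner_smul_left]
  · intro ψ hψ
    have h1 := hdiv ψ hψ
    simp only [zero_mul, integral_zero, neg_zero] at h1
    rw [← h1]
    refine integral_congr_ae ?_
    filter_upwards [hqp] with x hx
    rw [hx]

end IsSmoothJordanDomain

/-! ### Smoothing and the stream function -/

/-- `η` is a smooth nonnegative kernel of total mass one, vanishing outside the disc of radius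
`ε`. -/
structure IsMollifier (η : Plane → ℝ) (ε : ℝ) : Prop where
  contDiff : ContDiff ℝ ∞ η
  nonneg : ∀ x, 0 ≤ η x
  eq_zero : ∀ x, ε ≤ ‖x‖ → η x = 0
  integral_eq : ∫ x, η x = 1

theorem exists_isMollifier {ε : ℝ} (hε : 0 < ε) : ∃ η, IsMollifier η ε := by
  let f : ContDiffBump (0 : Plane) := ⟨ε / 2, ε, by positivity, by linarith⟩
  refine ⟨f.normed volume, f.contDiff_normed, f.nonneg_normed, fun x hx => ?_, f.integral_normed⟩
  have : x ∉ Function.support (f.normed volume) := by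
    rw [f.support_normed_eq, mem_ball_zero_iff, not_lt]
    exact hx
  simpa using this

namespace IsMollifier

variable {η : Plane → ℝ} {ε : ℝ}

theorem hasCompactSupport (hη : IsMollifier η ε) : HasCompactSupport η :=
  HasCompactSupport.intro (isCompact_closedBall (0 : Plane) ε) fun x hx => by
    rw [mem_closedBall_zero_iff, not_le] at hx
    exact hη.eq_zero x hx.le

theorem integrable (hη : IsMollifier η ε) : Integrable η :=
  hη.contDiff.continuous.integrable_of_hasCompactSupport hη.hasCompactSupport

theorem exists_bound (hη : IsMollifier η ε) : ∃ C, ∀ x, ‖η x‖ ≤ C :=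
  hη.hasCompactSupport.exists_bound_of_continuous hη.contDiff.continuous

theorem exists_bound_fderiv (hη : IsMollifier η ε) : ∃ C, ∀ x, ‖fderiv ℝ η x‖ ≤ C :=
  (hη.hasCompactSupport.fderiv (𝕜 := ℝ)).exists_bound_of_continuous
    (hη.contDiff.continuous_fderiv (by simp))

theorem integrable_smul {α : Type*} [MeasurableSpace α] {μ : Measure α} (hη : IsMollifier η ε)
    {q w : α → Plane} (hq : Measurable q) (hw : Integrable w μ) (x : Plane) :
    Integrable (fun a => η (x - q a) • w a) μ := by
  obtain ⟨C, hC⟩ := hη.exists_bound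
  exact hw.bdd_smul C
    (hη.contDiff.continuous.measurable.comp (hq.const_sub x)).aestronglyMeasurable
    (Eventually.of_forall fun a => hC _)

theorem integrable_fderiv_smulRight {α : Type*} [MeasurableSpace α] {μ : Measure α}
    (hη : IsMollifier η ε) {q w : α → Plane} (hq : Measurable q) (hw : Integrable w μ)
    (x : Plane) : Integrable (fun a => (fderiv ℝ η (x - q a)).smulRight (w a)) μ := by
  obtain ⟨C, hC⟩ := hη.exists_bound_fderiv
  have hdc := hη.contDiff.continuous_fderiv (by simp)
  refine Integrable.mono' (hw.norm.const_mul C) ?_ (Eventually.of_forall fun a => ?_)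
  · have h1 : Continuous fun z : (Plane →L[ℝ] ℝ) × Plane => z.1.smulRight z.2 := by fun_prop
    exact h1.comp_aestronglyMeasurable₂
      (hdc.measurable.comp (hq.const_sub x)).aestronglyMeasurable hw.1
  · rw [ContinuousLinearMap.norm_smulRight_apply]
    gcongr
    exact hC _

theorem hasFDerivAt_integral {α : Type*} [MeasurableSpace α] {μ : Measure α}
    (hη : IsMollifier η ε) {q w : α → Plane} (hq : Measurable q) (hw : Integrable w μ)
    (x : Plane) : HasFDerivAt (fun x => ∫ a, η (x - q a) • w a ∂μ)
      (∫ a, (fderiv ℝ η (x - q a)).smulRight (w a) ∂μ) x := by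
  obtain ⟨C, hC⟩ := hη.exists_bound_fderiv
  refine hasFDerivAt_integral_of_dominated_of_fderiv_le (s := univ) univ_mem
    (F' := fun x a => (fderiv ℝ η (x - q a)).smulRight (w a))
    (bound := fun a => C * ‖w a‖)
    (Eventually.of_forall fun x => (hη.integrable_smul hq hw x).1) (hη.integrable_smul hq hw x)
    (hη.integrable_fderiv_smulRight hq hw x).1 ?_ (hw.norm.const_mul C) ?_
  · refine Eventually.of_forall fun a y _ => ?_
    rw [ContinuousLinearMap.norm_smulRight_apply]
    gcongr
    exact hC _
  · refine Eventually.of_forall fun a y _ => ?_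
    have h1 : HasFDerivAt η (fderiv ℝ η (y - q a)) (y - q a) :=
      (hη.contDiff.differentiable (by simp) _).hasFDerivAt
    have h2 := h1.comp y ((hasFDerivAt_id y).sub_const (q a))
    rw [ContinuousLinearMap.comp_id] at h2
    exact h2.smul_const (w a)

end IsMollifier

/-- The trace of an endomorphism of the plane. -/
noncomputable def planeTrace : (Plane →L[ℝ] Plane) →L[ℝ] ℝ :=
  (EuclideanSpace.proj 0).comp
      (ContinuousLinearMap.apply ℝ Plane (EuclideanSpace.single (0 : Fin 2) (1 : ℝ))) +
    (EuclideanSpace.proj 1).comp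
      (ContinuousLinearMap.apply ℝ Plane (EuclideanSpace.single (1 : Fin 2) (1 : ℝ)))

theorem planeTrace_apply (L : Plane →L[ℝ] Plane) : planeTrace L =
    L (EuclideanSpace.single 0 1) 0 + L (EuclideanSpace.single 1 1) 1 := rfl

theorem planeTrace_smulRight (L : Plane →L[ℝ] ℝ) (w : Plane) :
    planeTrace (L.smulRight w) = L w := by
  rw [planeTrace_apply]
  conv_rhs => rw [eq_sum_single w, map_add, map_smul, map_smul]
  simp only [ContinuousLinearMap.smulRight_apply, PiLp.smul_apply, smul_eq_mul]
  ring

/-- A linear field turned by a right angle is a symmetric form if and only if it is trace-free. -/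
theorem inner_rotCW_comm {L : Plane →L[ℝ] Plane} (hL : planeTrace L = 0) (k h : Plane) :
    inner ℝ (rotCW (L k)) h = inner ℝ (rotCW (L h)) k := by
  rw [planeTrace_apply] at hL
  rw [eq_sum_single k, eq_sum_single h]
  simp only [plane_inner, rotCW_zero_apply, rotCW_one_apply, map_add, map_smul, PiLp.add_apply,
    PiLp.smul_apply, smul_eq_mul, PiLp.single_apply]
  simp
  linear_combination (h 0 * k 1 - k 0 * h 1) * hL

/-- A trace-free differentiable field on the plane has a stream function. -/
theorem exists_streamFunction {V : Plane → Plane} {V' : Plane → Plane →L[ℝ] Plane}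
    (hV : ∀ x, HasFDerivAt V (V' x) x) (htr : ∀ x, planeTrace (V' x) = 0) :
    ∃ ψ : Plane → ℝ, ∀ x, HasFDerivAt ψ (innerSL ℝ (rotCW (V x))) x := by
  have hω : ∀ x, HasFDerivAt (fun x => innerSL ℝ (rotCW (V x)))
      (((innerSL ℝ : Plane →L[ℝ] Plane →L[ℝ] ℝ).comp rotCW).comp (V' x)) x := fun x =>
    ((innerSL ℝ : Plane →L[ℝ] Plane →L[ℝ] ℝ).comp rotCW).hasFDerivAt.comp x (hV x)
  obtain ⟨ψ, hψ⟩ := convex_univ.exists_forall_hasFDerivAt_of_fderiv_symmetric isOpen_univ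
    (fun x _ => (hω x).differentiableAt.differentiableWithinAt) (fun x _ k h => by
      rw [(hω x).fderiv]
      exact inner_rotCW_comm (htr x) k h)
  exact ⟨ψ, fun x => hψ x (mem_univ x)⟩

/-! ### The current, closed up along the boundary -/

/-- The flux through the boundary arc from `γ 0` to `γ s`. -/
noncomputable def boundaryFlux (γ : ℝ → Plane) (j : Plane → ℝ) (s : ℝ) : ℝ :=
  ∫ u in (0 : ℝ)..s, j (γ u)

/-- The smoothing by `η` of the field that is `F` in `Ω` and on `∂Ω` carries the tangential
current of density `boundaryFlux`, which makes it divergence-free in the plane. -/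
noncomputable def smoothedField (Ω : Set Plane) (γ : ℝ → Plane) (ℓ : ℝ) (j : Plane → ℝ)
    (F : Plane → Plane) (η : Plane → ℝ) (x : Plane) : Plane :=
  (∫ y in Ω, η (x - y) • F y) +
    ∫ s in Ioc 0 ℓ, η (x - γ s) • (boundaryFlux γ j s • deriv γ s)

namespace IsSmoothJordanDomain

variable {Ω : Set Plane} {γ : ℝ → Plane} {ℓ δ : ℝ} {j : Plane → ℝ} {F : Plane → Plane} {M : ℝ}
  {η : Plane → ℝ} {ε : ℝ}

theorem intervalIntegrable_boundary (hΩ : IsSmoothJordanDomain Ω γ ℓ)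
    (hj : IntervalIntegrable (fun s => j (γ s)) volume 0 ℓ) (a b : ℝ) :
    IntervalIntegrable (fun s => j (γ s)) volume a b := by
  have hp : Function.Periodic (fun s => j (γ s)) ℓ := fun s => congrArg j (hΩ.periodic s)
  exact hp.intervalIntegrable₀ hΩ.length_pos.ne' hj a b

theorem boundaryFlux_sub (hΩ : IsSmoothJordanDomain Ω γ ℓ)
    (hj : IntervalIntegrable (fun s => j (γ s)) volume 0 ℓ) (a b : ℝ) :
    boundaryFlux γ j b - boundaryFlux γ j a = ∫ s in a..b, j (γ s) :=
  intervalIntegral.integral_interval_sub_left (hΩ.intervalIntegrable_boundary hj _ _)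
    (hΩ.intervalIntegrable_boundary hj _ _)

theorem continuous_boundaryFlux (hΩ : IsSmoothJordanDomain Ω γ ℓ)
    (hj : IntervalIntegrable (fun s => j (γ s)) volume 0 ℓ) : Continuous (boundaryFlux γ j) :=
  intervalIntegral.continuous_primitive (hΩ.intervalIntegrable_boundary hj) 0

theorem periodic_boundaryFlux (hΩ : IsSmoothJordanDomain Ω γ ℓ)
    (hj : IntervalIntegrable (fun s => j (γ s)) volume 0 ℓ)
    (hj0 : ∫ s in (0 : ℝ)..ℓ, j (γ s) = 0) : Function.Periodic (boundaryFlux γ j) ℓ := by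
  intro s
  have hp : Function.Periodic (fun s => j (γ s)) ℓ := fun s => congrArg j (hΩ.periodic s)
  have h1 := hΩ.boundaryFlux_sub hj s (s + ℓ)
  have h2 := hp.intervalIntegral_add_eq s 0
  rw [zero_add, hj0] at h2
  rw [h2] at h1
  linarith

/-- Integration by parts along the boundary. -/
theorem integral_boundaryFlux_mul_fderiv (hΩ : IsSmoothJordanDomain Ω γ ℓ)
    (hj : IntervalIntegrable (fun s => j (γ s)) volume 0 ℓ)
    (hj0 : ∫ s in (0 : ℝ)..ℓ, j (γ s) = 0) {φ : Plane → ℝ} (hφ : ContDiff ℝ ∞ φ) :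
    ∫ s in Ioc 0 ℓ, boundaryFlux γ j s * fderiv ℝ φ (γ s) (deriv γ s) =
      -∫ s in Ioc 0 ℓ, φ (γ s) * j (γ s) := by
  have hp := hΩ.length_pos
  have hac := hj.absolutelyContinuousOnInterval_intervalIntegral (c := 0) left_mem_uIcc
  have hcomp : ContDiff ℝ ∞ (fun s => φ (γ s)) := hφ.comp hΩ.smooth
  have hac2 : AbsolutelyContinuousOnInterval (fun s => φ (γ s)) 0 ℓ :=
    (hcomp.of_le (by simp)).contDiffOn.absolutelyContinuousOnInterval
  have h := hac.integral_mul_deriv_eq_deriv_mul hac2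
  have h0 : boundaryFlux γ j 0 = 0 := by simp [boundaryFlux]
  have hℓ : boundaryFlux γ j ℓ = 0 := hj0
  change ∫ x in (0 : ℝ)..ℓ, boundaryFlux γ j x * deriv (fun s => φ (γ s)) x =
    boundaryFlux γ j ℓ * φ (γ ℓ) - boundaryFlux γ j 0 * φ (γ 0) - _ at h
  rw [h0, hℓ, zero_mul, zero_mul, sub_zero, zero_sub, intervalIntegral.integral_of_le hp.le,
    intervalIntegral.integral_of_le hp.le] at h
  have e1 : ∀ s, deriv (fun s => φ (γ s)) s = fderiv ℝ φ (γ s) (deriv γ s) := fun s =>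
    (((hφ.differentiable (by simp) _).hasFDerivAt).comp_hasDerivAt s (hΩ.hasDerivAt s)).deriv
  simp only [e1] at h
  rw [h]
  congr 1
  refine integral_congr_ae ?_
  filter_upwards [ae_restrict_of_ae hj.ae_hasDerivAt_integral,
    ae_restrict_mem measurableSet_Ioc] with s hs hmem
  have hs' : s ∈ uIcc 0 ℓ := by rw [uIcc_of_le hp.le]; exact Ioc_subset_Icc_self hmem
  rw [(hs hs' 0 left_mem_uIcc).deriv, mul_comm]

theorem integrable_boundaryFlux_smul (hΩ : IsSmoothJordanDomain Ω γ ℓ)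
    (hj : IntervalIntegrable (fun s => j (γ s)) volume 0 ℓ) :
    Integrable (fun s => boundaryFlux γ j s • deriv γ s) (volume.restrict (Ioc 0 ℓ)) := by
  have h1 := hΩ.continuous_boundaryFlux hj
  have h2 := hΩ.contDiff_deriv.continuous
  exact ((h1.smul h2).integrableOn_Icc).mono_set Ioc_subset_Icc_self

theorem integrable_of_bounded (hΩ : IsSmoothJordanDomain Ω γ ℓ) (hF : Measurable F)
    (hFM : ∀ x, ‖F x‖ ≤ M) : Integrable F (volume.restrict Ω) := by
  have := hΩ.isFiniteMeasure_restrict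
  exact (integrable_const M).mono' hF.aestronglyMeasurable (Eventually.of_forall hFM)

theorem exists_streamFunction_smoothedField (hΩ : IsSmoothJordanDomain Ω γ ℓ)
    (hj : IntervalIntegrable (fun s => j (γ s)) volume 0 ℓ)
    (hj0 : ∫ s in (0 : ℝ)..ℓ, j (γ s) = 0) (hF : Measurable F) (hFM : ∀ x, ‖F x‖ ≤ M)
    (hweak : ∀ φ : Plane → ℝ, ContDiff ℝ ∞ φ →
      ∫ x in Ω, fderiv ℝ φ x (F x) = ∫ s in Ioc 0 ℓ, φ (γ s) * j (γ s))
    (hη : IsMollifier η ε) :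
    ∃ ψ : Plane → ℝ, ∀ x,
      HasFDerivAt ψ (innerSL ℝ (rotCW (smoothedField Ω γ ℓ j F η x))) x := by
  have hFi := hΩ.integrable_of_bounded hF hFM
  have hJi := hΩ.integrable_boundaryFlux_smul hj
  have hγm : Measurable γ := hΩ.smooth.continuous.measurable
  refine exists_streamFunction (fun x => (hη.hasFDerivAt_integral measurable_id hFi x).add
    (hη.hasFDerivAt_integral hγm hJi x)) fun x => ?_
  rw [map_add, ← ContinuousLinearMap.integral_comp_comm _
      (hη.integrable_fderiv_smulRight measurable_id hFi x),
    ← ContinuousLinearMap.integral_comp_comm _ (hη.integrable_fderiv_smulRight hγm hJi x)]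
  simp only [planeTrace_smulRight, map_smul, smul_eq_mul, id]
  have hφ : ContDiff ℝ ∞ (fun y => η (x - y)) := hη.contDiff.comp (contDiff_const.sub contDiff_id)
  have hd : ∀ y, fderiv ℝ (fun y => η (x - y)) y = -fderiv ℝ η (x - y) := by
    intro y
    have h1 : HasFDerivAt η (fderiv ℝ η (x - y)) (x - y) :=
      (hη.contDiff.differentiable (by simp) _).hasFDerivAt
    have h2 := (h1.comp y ((hasFDerivAt_id y).const_sub x)).fderiv
    rw [ContinuousLinearMap.comp_neg, ContinuousLinearMap.comp_id] at h2
    exact h2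
  have h1 := hweak _ hφ
  have h2 := hΩ.integral_boundaryFlux_mul_fderiv hj hj0 hφ
  simp only [hd, _root_.neg_apply, mul_neg, integral_neg] at h1 h2
  linarith

theorem norm_bulk_le (hFM : ∀ x, ‖F x‖ ≤ M) (hη : IsMollifier η ε) (x : Plane) :
    ‖∫ y in Ω, η (x - y) • F y‖ ≤ M := by
  have hi : Integrable (fun y => η (x - y)) := hη.integrable.comp_sub_left x
  have hM : 0 ≤ M := (norm_nonneg _).trans (hFM 0)
  calc ‖∫ y in Ω, η (x - y) • F y‖ ≤ ∫ y in Ω, η (x - y) * M := by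
        refine norm_integral_le_of_norm_le (hi.integrableOn.mul_const M)
          (Eventually.of_forall fun y => ?_)
        rw [norm_smul, Real.norm_eq_abs, abs_of_nonneg (hη.nonneg _)]
        exact mul_le_mul_of_nonneg_left (hFM y) (hη.nonneg _)
    _ = (∫ y in Ω, η (x - y)) * M := integral_mul_const M _
    _ ≤ (∫ y, η (x - y)) * M := by
        gcongr
        · exact Eventually.of_forall fun y => hη.nonneg _
        · exact Measure.restrict_le_self
    _ = M := by rw [integral_sub_left_eq_self η volume x, hη.integral_eq, one_mul]

theorem boundary_part_eq_zero (hη : IsMollifier η ε) {x : Plane} (hx : ∀ s, ε ≤ ‖x - γ s‖) :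
    ∫ s in Ioc 0 ℓ, η (x - γ s) • (boundaryFlux γ j s • deriv γ s) = 0 := by
  simp only [fun s => hη.eq_zero _ (hx s), zero_smul, integral_zero]

theorem norm_smoothedField_le (hFM : ∀ x, ‖F x‖ ≤ M) (hη : IsMollifier η ε) {x : Plane}
    (hx : ∀ s, ε ≤ ‖x - γ s‖) : ‖smoothedField Ω γ ℓ j F η x‖ ≤ M := by
  rw [smoothedField, boundary_part_eq_zero hη hx, add_zero]
  exact norm_bulk_le hFM hη x

theorem smoothedField_eq_zero (hΩ : IsSmoothJordanDomain Ω γ ℓ) (hη : IsMollifier η ε) {x : Plane}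
    (hx : ∀ y ∈ closure Ω, ε ≤ ‖x - y‖) : smoothedField Ω γ ℓ j F η x = 0 := by
  rw [smoothedField, boundary_part_eq_zero hη
    (fun s => hx _ (frontier_subset_closure (hΩ.mem_frontier s))), add_zero]
  rw [← integral_zero Plane Plane (μ := volume.restrict Ω)]
  refine setIntegral_congr_fun hΩ.isOpen.measurableSet fun y hy => ?_
  rw [hη.eq_zero _ (hx y (subset_closure hy)), zero_smul]

end IsSmoothJordanDomain

/-! ### Crossing the boundary -/

namespace IsSmoothJordanDomain

variable {Ω : Set Plane} {γ : ℝ → Plane} {ℓ δ : ℝ} {j : Plane → ℝ} {F : Plane → Plane} {M : ℝ}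
  {η : Plane → ℝ} {ε : ℝ}

/-- The derivative of `(r, s) ↦ γ s - collar γ a r`. -/
theorem hasFDerivAt_sub_collar (hΩ : IsSmoothJordanDomain Ω γ ℓ) (a : ℝ) (z : ℝ × ℝ) :
    HasFDerivAt (fun z : ℝ × ℝ => γ z.2 - collar γ a z.1)
      (frameMap (rightNormal γ a) (deriv γ z.2)) z := by
  have h1 := (hΩ.hasDerivAt z.2).hasFDerivAt.comp z hasFDerivAt_snd
  have h2 := (hasFDerivAt_fst (𝕜 := ℝ) (p := z)).smul_const (rightNormal γ a)
  have h3 := h1.sub (h2.const_sub (γ a))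
  refine h3.congr_fderiv ?_
  ext <;> simp

theorem frameDet_sub_collar (a s : ℝ) :
    frameDet (rightNormal γ a) (deriv γ s) = inner ℝ (deriv γ s) (deriv γ a) := by
  simp only [frameDet, rightNormal_eq, rotCW_zero_apply, rotCW_one_apply, plane_inner]
  ring

/-- The line integral of a smoothed tangential boundary current across the boundary tends to the
density of the current at the point of crossing. -/
theorem exists_crossing_estimate (hΩ : IsSmoothJordanDomain Ω γ ℓ) (hδ : IsCollarWidth Ω γ ℓ δ)
    {J : ℝ → ℝ} (hJc : Continuous J) (hJp : Function.Periodic J ℓ) (a : ℝ) {t : ℝ} (ht : 0 < t)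
    (htδ : t ≤ δ) {e : ℝ} (he : 0 < e) :
    ∃ ε₀ > 0, ∀ ε ≤ ε₀, ∀ η, IsMollifier η ε →
      |(∫ r in (-t)..t, ∫ s in Ioc 0 ℓ,
        η (collar γ a r - γ s) * (J s * inner ℝ (deriv γ s) (deriv γ a))) - J a| ≤ e := by
  have hp := hΩ.length_pos
  have hγc : Continuous γ := hΩ.smooth.continuous
  have hdc : Continuous (deriv γ) := hΩ.contDiff_deriv.continuous
  have hcol : Continuous (collar γ a) := by unfold collar; fun_prop
  -- the part of the curve near `γ a` is a graph over the tangent there, with `J` nearly constant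
  have hloc : ∀ᶠ s in 𝓝 a, 0 < (inner ℝ (deriv γ s) (deriv γ a) : ℝ) ∧ |J s - J a| < e := by
    have h1 : Continuous fun s => (inner ℝ (deriv γ s) (deriv γ a) : ℝ) := by fun_prop
    have h2 : Continuous fun s => |J s - J a| := by fun_prop
    refine (h1.continuousAt.eventually (lt_mem_nhds ?_)).and
      (h2.continuousAt.eventually (gt_mem_nhds ?_))
    · simp only [real_inner_self_eq_norm_sq, hΩ.unit_speed]; norm_num
    · simpa using he
  obtain ⟨ρ', hρ', hball⟩ := Metric.eventually_nhds_iff.1 hloc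
  obtain ⟨ρ, hρ⟩ : ∃ ρ, ρ = min ρ' (ℓ / 2) := ⟨_, rfl⟩
  have hρ0 : 0 < ρ := by rw [hρ]; positivity
  have hρℓ : ρ ≤ ℓ / 2 := by rw [hρ]; exact min_le_right _ _
  have hin : ∀ s ∈ Ioo (a - ρ) (a + ρ), 0 < (inner ℝ (deriv γ s) (deriv γ a) : ℝ) ∧
      |J s - J a| < e := by
    intro s hs
    apply hball
    rw [Real.dist_eq, abs_lt]
    have : ρ ≤ ρ' := by rw [hρ]; exact min_le_left _ _
    constructor <;> linarith [hs.1, hs.2]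
  set Θ : ℝ × ℝ → Plane := fun z => γ z.2 - collar γ a z.1 with hΘ
  have hΘc : Continuous Θ := by fun_prop
  set R : Set (ℝ × ℝ) := Ioc (-t) t ×ˢ Ioo (a - ρ) (a + ρ) with hR
  have hRm : MeasurableSet R := measurableSet_Ioc.prod measurableSet_Ioo
  have hinj : InjOn Θ R := by
    have hmono : StrictMonoOn (fun s => (inner ℝ (γ s) (deriv γ a) : ℝ)) (Ioo (a - ρ) (a + ρ)) := by
      refine strictMonoOn_of_deriv_pos (convex_Ioo _ _) (by fun_prop) fun s hs => ?_
      rw [interior_Ioo] at hs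
      have hd : HasDerivAt (fun s => (inner ℝ (γ s) (deriv γ a) : ℝ))
          (inner ℝ (deriv γ s) (deriv γ a)) s := by
        simpa using (hΩ.hasDerivAt s).inner ℝ (hasDerivAt_const s (deriv γ a))
      rw [hd.deriv]
      exact (hin s hs).1
    rintro ⟨r, s⟩ ⟨-, hs⟩ ⟨r', s'⟩ ⟨-, hs'⟩ h
    have hν : (inner ℝ (rightNormal γ a) (deriv γ a) : ℝ) = 0 := inner_normal_deriv a
    have h1 := congrArg (fun v => (inner ℝ v (deriv γ a) : ℝ)) h
    simp only [hΘ, collar, inner_sub_left, real_inner_smul_left, hν, mul_zero, sub_zero] at h1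
    have h2 : s = s' := hmono.injOn hs hs' (by simpa using h1)
    subst h2
    simp only [hΘ, collar, sub_right_inj] at h
    have h3 := congrArg (fun v => (inner ℝ v (rightNormal γ a) : ℝ)) h
    simp only [real_inner_smul_left, real_inner_self_eq_norm_sq, hΩ.norm_normal] at h3
    rw [show r = r' by linarith]
  have hnhds : Θ '' R ∈ 𝓝 (0 : Plane) := by
    have hd : frameDet (rightNormal γ a) (deriv γ a) ≠ 0 := by
      rw [frameDet_sub_collar, real_inner_self_eq_norm_sq, hΩ.unit_speed]; norm_num
    obtain ⟨L, hL⟩ := exists_frameMap_equiv hd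
    have h1 : ContDiff ℝ 1 Θ := by
      have h2 : ContDiff ℝ 1 γ := hΩ.smooth.of_le (by simp)
      simp only [hΘ, collar]
      fun_prop
    have h2 : HasStrictFDerivAt Θ (L : ℝ × ℝ →L[ℝ] Plane) (0, a) := by
      rw [hL]
      exact h1.contDiffAt.hasStrictFDerivAt' (hΩ.hasFDerivAt_sub_collar a (0, a)) (by simp)
    have h3 := h2.map_nhds_eq_of_equiv
    have h4 : Θ (0, a) = 0 := by simp [hΘ, collar_zero]
    rw [h4] at h3
    rw [← h3]
    exact image_mem_map (prod_mem_nhds (Ioc_mem_nhds (by linarith) ht)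
      (Ioo_mem_nhds (by linarith) (by linarith)))
  obtain ⟨ε₁, hε₁, hε₁R⟩ := Metric.mem_nhds_iff.1 hnhds
  -- the rest of the curve stays away from the crossing segment
  obtain ⟨m, hm0, hm⟩ := (isCompact_Icc.prod ((isCompact_Icc (a := a - ℓ / 2) (b := a + ℓ / 2)).diff
    (isOpen_Ioo (a := a - ρ) (b := a + ρ)))).exists_forall_le' (s := Icc (-t) t ×ˢ
      (Icc (a - ℓ / 2) (a + ℓ / 2) \ Ioo (a - ρ) (a + ρ))) (f := fun z => ‖Θ z‖) (a := 0)
    hΘc.norm.continuousOn (by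
      rintro ⟨r, s⟩ ⟨hr, hs, hs'⟩
      rw [norm_pos_iff, hΘ]
      simp only [ne_eq, sub_eq_zero]
      intro h
      rw [← collar_zero (γ := γ) s] at h
      obtain ⟨-, n, hn⟩ := hδ.inj s a 0 r (by simpa using hδ.pos.le)
        ((abs_le.2 hr).trans htδ) h
      simp only at hs hs'
      rcases eq_or_ne n 0 with rfl | hn0
      · apply hs'
        rw [← hn]
        constructor <;> simp [hρ0]
      · have h1 : (1 : ℝ) ≤ |(n : ℝ)| := by exact_mod_cast Int.one_le_abs hn0
        have h2 : |(n : ℝ) * ℓ| ≤ ℓ / 2 := by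
          rw [abs_le]; constructor <;> linarith [hs.1, hs.2]
        rw [abs_mul, abs_of_pos hp] at h2
        nlinarith)
  refine ⟨min ε₁ m, lt_min hε₁ hm0, fun ε hε η hη => ?_⟩
  set k : ℝ × ℝ → ℝ := fun z =>
    η (-Θ z) * (J z.2 * inner ℝ (deriv γ z.2) (deriv γ a)) with hk
  have hηc : Continuous η := hη.contDiff.continuous
  have hkc : Continuous k := by fun_prop
  have hkint : ∀ S ⊆ Icc (-t) t ×ˢ Icc (a - ℓ / 2) (a + ℓ / 2), IntegrableOn k S := fun S hS =>
    (hkc.continuousOn.integrableOn_compact (isCompact_Icc.prod isCompact_Icc)).mono_set hS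
  have hsub : R ⊆ Ioc (-t) t ×ˢ Ioc (a - ℓ / 2) (a + ℓ / 2) :=
    prod_mono_right fun s hs => ⟨by linarith [hs.1], by linarith [hs.2]⟩
  have hstep1 : (∫ r in (-t)..t, ∫ s in Ioc 0 ℓ,
      η (collar γ a r - γ s) * (J s * inner ℝ (deriv γ s) (deriv γ a))) = ∫ z in R, k z := by
    have h1 : ∀ r, ∫ s in Ioc 0 ℓ, η (collar γ a r - γ s) *
        (J s * inner ℝ (deriv γ s) (deriv γ a)) = ∫ s in Ioc (a - ℓ / 2) (a + ℓ / 2), k (r, s) := by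
      intro r
      have hper : Function.Periodic (fun s => η (collar γ a r - γ s) *
          (J s * inner ℝ (deriv γ s) (deriv γ a))) ℓ := by
        intro s
        simp only [hΩ.periodic s, hJp s, hΩ.periodic_deriv s]
      have h2 := hper.intervalIntegral_add_eq 0 (a - ℓ / 2)
      rw [zero_add, show a - ℓ / 2 + ℓ = a + ℓ / 2 by ring, intervalIntegral.integral_of_le hp.le,
        intervalIntegral.integral_of_le (by linarith)] at h2
      rw [h2]
      simp only [hk, hΘ, neg_sub]
    simp only [h1]
    rw [intervalIntegral.integral_of_le (by linarith)]
    have hQ := setIntegral_prod (μ := volume) (ν := volume) (s := Ioc (-t) t)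
      (t := Ioc (a - ℓ / 2) (a + ℓ / 2)) k
      (hkint _ (prod_mono Ioc_subset_Icc_self Ioc_subset_Icc_self))
    rw [← hQ]
    refine setIntegral_eq_of_subset_of_forall_sdiff_eq_zero
      (measurableSet_Ioc.prod measurableSet_Ioc) hsub ?_
    rintro ⟨r, s⟩ ⟨⟨hr, hs⟩, hn⟩
    have h3 : m ≤ ‖Θ (r, s)‖ := hm _ ⟨Ioc_subset_Icc_self hr, Ioc_subset_Icc_self hs,
      fun h => hn ⟨hr, h⟩⟩
    simp only [hk]
    rw [hη.eq_zero _ (by rw [norm_neg]; exact (hε.trans (min_le_right _ _)).trans h3), zero_mul]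
  have hmass : ∫ z in R, η (-Θ z) * inner ℝ (deriv γ z.2) (deriv γ a) = 1 := by
    have h1 := integral_image_frame hRm (fun z _ => hΩ.hasFDerivAt_sub_collar a z) hinj
      (fun x => η (-x))
    have h2 : ∫ x in Θ '' R, η (-x) = 1 := by
      rw [setIntegral_eq_integral_of_forall_compl_eq_zero, integral_neg_eq_self, hη.integral_eq]
      intro x hx
      apply hη.eq_zero
      rw [norm_neg]
      by_contra hlt
      rw [not_le] at hlt
      exact hx (hε₁R (by
        rw [mem_ball_zero_iff]
        exact hlt.trans_le (hε.trans (min_le_left _ _))))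
    rw [h2] at h1
    rw [h1]
    refine setIntegral_congr_fun hRm fun z hz => ?_
    simp only [frameDet_sub_collar]
    rw [abs_of_pos (hin _ hz.2).1, mul_comm]
  rw [hstep1]
  have hw : Continuous fun z : ℝ × ℝ => η (-Θ z) * inner ℝ (deriv γ z.2) (deriv γ a) := by fun_prop
  have hwint : IntegrableOn (fun z : ℝ × ℝ => η (-Θ z) * inner ℝ (deriv γ z.2) (deriv γ a)) R :=
    (hw.continuousOn.integrableOn_compact (isCompact_Icc.prod isCompact_Icc)).mono_set
      (hsub.trans (prod_mono Ioc_subset_Icc_self Ioc_subset_Icc_self))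
  have hdiff : (∫ z in R, k z) - J a = ∫ z in R, (k z -
      η (-Θ z) * inner ℝ (deriv γ z.2) (deriv γ a) * J a) := by
    rw [integral_sub (hkint R (hsub.trans (prod_mono Ioc_subset_Icc_self Ioc_subset_Icc_self)))
      (hwint.mul_const _), integral_mul_const, hmass, one_mul]
  rw [hdiff, ← Real.norm_eq_abs]
  calc _ ≤ ∫ z in R, η (-Θ z) * inner ℝ (deriv γ z.2) (deriv γ a) * e := by
        refine norm_integral_le_of_norm_le (hwint.mul_const _) ?_
        refine (ae_restrict_iff' hRm).2 (Eventually.of_forall fun z hz => ?_)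
        have h1 := hin _ hz.2
        have h2 : k z - η (-Θ z) * inner ℝ (deriv γ z.2) (deriv γ a) * J a =
            η (-Θ z) * inner ℝ (deriv γ z.2) (deriv γ a) * (J z.2 - J a) := by
          simp only [hk]; ring
        have h3 : 0 ≤ η (-Θ z) * inner ℝ (deriv γ z.2) (deriv γ a) :=
          mul_nonneg (hη.nonneg _) h1.1.le
        rw [h2, norm_mul, Real.norm_eq_abs, Real.norm_eq_abs, abs_of_nonneg h3]
        exact mul_le_mul_of_nonneg_left h1.2.le h3
    _ = e := by rw [integral_mul_const, hmass, one_mul]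

theorem continuous_smoothedField (hΩ : IsSmoothJordanDomain Ω γ ℓ)
    (hj : IntervalIntegrable (fun s => j (γ s)) volume 0 ℓ) (hF : Measurable F)
    (hFM : ∀ x, ‖F x‖ ≤ M) (hη : IsMollifier η ε) :
    Continuous (smoothedField Ω γ ℓ j F η) ∧ Continuous fun x => ∫ y in Ω, η (x - y) • F y := by
  have hFi := hΩ.integrable_of_bounded hF hFM
  have hJi := hΩ.integrable_boundaryFlux_smul hj
  have h1 : Continuous fun x => ∫ y in Ω, η (x - y) • F y :=
    continuous_iff_continuousAt.2 fun x => (hη.hasFDerivAt_integral measurable_id hFi x).continuousAt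
  have h2 : Continuous fun x => ∫ s in Ioc 0 ℓ, η (x - γ s) • (boundaryFlux γ j s • deriv γ s) :=
    continuous_iff_continuousAt.2 fun x =>
      (hη.hasFDerivAt_integral hΩ.smooth.continuous.measurable hJi x).continuousAt
  exact ⟨h1.add h2, h1⟩

/-- The jump of the stream function across the boundary. -/
theorem exists_jump_estimate (hΩ : IsSmoothJordanDomain Ω γ ℓ) (hδ : IsCollarWidth Ω γ ℓ δ)
    (hj : IntervalIntegrable (fun s => j (γ s)) volume 0 ℓ)
    (hj0 : ∫ s in (0 : ℝ)..ℓ, j (γ s) = 0) (hF : Measurable F) (hFM : ∀ x, ‖F x‖ ≤ M)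
    (a : ℝ) {t : ℝ} (ht : 0 < t) (htδ : t ≤ δ) {e : ℝ} (he : 0 < e) :
    ∃ ε₀ > 0, ∀ ε ≤ ε₀, ∀ η, IsMollifier η ε → ∀ ψ : Plane → ℝ,
      (∀ x, HasFDerivAt ψ (innerSL ℝ (rotCW (smoothedField Ω γ ℓ j F η x))) x) →
      |ψ (collar γ a t) - ψ (collar γ a (-t)) + boundaryFlux γ j a| ≤ 2 * t * M + e := by
  obtain ⟨ε₀, hε₀, h⟩ := hΩ.exists_crossing_estimate hδ (hΩ.continuous_boundaryFlux hj)
    (hΩ.periodic_boundaryFlux hj hj0) a ht htδ he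
  refine ⟨ε₀, hε₀, fun ε hε η hη ψ hψ => ?_⟩
  have hest := h ε hε η hη
  have hcol : Continuous (collar γ a) := by unfold collar; fun_prop
  obtain ⟨hVc, hBc⟩ := hΩ.continuous_smoothedField hj hF hFM hη
  have hJi := hΩ.integrable_boundaryFlux_smul hj
  have hγm : Measurable γ := hΩ.smooth.continuous.measurable
  set B : ℝ → ℝ := fun r => inner ℝ (∫ y in Ω, η (collar γ a r - y) • F y) (deriv γ a) with hB
  have hBcont : Continuous B := by
    have := hBc.comp hcol
    exact this.inner continuous_const
  set S : ℝ → ℝ := fun r => ∫ s in Ioc 0 ℓ,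
    η (collar γ a r - γ s) * (boundaryFlux γ j s * inner ℝ (deriv γ s) (deriv γ a)) with hS
  have hVBS : ∀ r, inner ℝ (smoothedField Ω γ ℓ j F η (collar γ a r)) (deriv γ a) = B r + S r := by
    intro r
    have h1 := (innerSL ℝ (deriv γ a)).integral_comp_comm
      (hη.integrable_smul hγm hJi (collar γ a r))
    simp only [innerSL_apply_apply] at h1
    rw [smoothedField, inner_add_left]
    congr 1
    rw [real_inner_comm, ← h1]
    simp only [hS, real_inner_smul_right, real_inner_comm]
  have hScont : Continuous S := by
    have h1 : S = fun r =>
        inner ℝ (smoothedField Ω γ ℓ j F η (collar γ a r)) (deriv γ a) - B r := by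
      funext r; rw [hVBS]; ring
    rw [h1]
    exact ((hVc.comp hcol).inner continuous_const).sub hBcont
  have hd : ∀ r, HasDerivAt (fun r => ψ (collar γ a r)) (-(B r + S r)) r := by
    intro r
    have h2 := (hψ (collar γ a r)).comp_hasDerivAt r (hasDerivAt_collar a r)
    refine h2.congr_deriv ?_
    rw [← hVBS, innerSL_apply_apply, inner_neg_right, rightNormal_eq]
    simp only [plane_inner, rotCW_zero_apply, rotCW_one_apply]
    ring
  have hftc := intervalIntegral.integral_eq_sub_of_hasDerivAt (a := -t) (b := t)
    (fun r _ => hd r) ((hBcont.add hScont).neg.intervalIntegrable _ _)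
  rw [intervalIntegral.integral_neg, intervalIntegral.integral_add
    (hBcont.intervalIntegrable _ _) (hScont.intervalIntegrable _ _)] at hftc
  have hBle : |∫ r in (-t)..t, B r| ≤ M * (2 * t) := by
    have := intervalIntegral.norm_integral_le_of_norm_le_const (a := -t) (b := t) (f := B) (C := M)
      (fun r _ => by
        refine (norm_inner_le_norm (𝕜 := ℝ) _ _).trans ?_
        rw [hΩ.unit_speed, mul_one]
        exact norm_bulk_le hFM hη _)
    rwa [Real.norm_eq_abs, show t - -t = 2 * t by ring, abs_of_pos (by linarith : 0 < 2 * t)] at this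
  rw [← hftc, ← abs_neg]
  calc _ = |(∫ r in (-t)..t, B r) + ((∫ r in (-t)..t, S r) - boundaryFlux γ j a)| := by
        congr 1; ring
    _ ≤ M * (2 * t) + e := (abs_add_le _ _).trans (add_le_add hBle hest)
    _ = _ := by ring

/-! ### The bound along a path -/

theorem streamFunction_sub_le_of_path {γ : ℝ → Plane} {ψ : Plane → ℝ} {V : Plane → Plane} {ε M : ℝ}
    (hε : 0 < ε)
    (hψ : ∀ x, HasFDerivAt ψ (innerSL ℝ (rotCW (V x))) x)
    (hV : ∀ x, (∀ s, ε ≤ ‖x - γ s‖) → ‖V x‖ ≤ M) {c : ℝ → Plane} (hc : ContinuousOn c (Icc 0 1))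
    (hdist : ∀ u ∈ Icc (0 : ℝ) 1, ∀ s, 2 * ε ≤ ‖c u - γ s‖) :
    ENNReal.ofReal |ψ (c 1) - ψ (c 0)| ≤ ENNReal.ofReal M * eVariationOn c (Icc 0 1) := by
  have hlip : ∀ u ∈ Icc (0 : ℝ) 1, ∀ y, ‖y - c u‖ < ε → |ψ y - ψ (c u)| ≤ M * ‖y - c u‖ := by
    intro u hu y hy
    have hb : ∀ x ∈ Metric.ball (c u) ε, ‖innerSL ℝ (rotCW (V x))‖ ≤ M := by
      intro x hx
      rw [innerSL_apply_norm, norm_rotCW]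
      refine hV x fun s => ?_
      rw [mem_ball_iff_norm] at hx
      have h1 := hdist u hu s
      have h2 : ‖c u - γ s‖ ≤ ‖x - γ s‖ + ‖x - c u‖ := by
        calc ‖c u - γ s‖ = ‖(x - γ s) - (x - c u)‖ := by congr 1; abel
          _ ≤ _ := norm_sub_le _ _
      linarith
    exact (convex_ball (c u) ε).norm_image_sub_le_of_norm_hasFDerivWithin_le
      (fun x _ => (hψ x).hasFDerivWithinAt) hb (Metric.mem_ball_self hε)
      (by rwa [mem_ball_iff_norm])
  have huc := isCompact_Icc.uniformContinuousOn_of_continuous hc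
  obtain ⟨d, hd, hdε⟩ := Metric.uniformContinuousOn_iff.1 huc ε hε
  obtain ⟨N, hN⟩ := exists_nat_one_div_lt hd
  set v : ℕ → ℝ := fun i => min (i / (N + 1 : ℝ)) 1 with hv
  have hN0 : (0 : ℝ) < N + 1 := by positivity
  have hvm : Monotone v := by
    intro i k hik
    have : (i : ℝ) ≤ k := by exact_mod_cast hik
    simp only [hv]
    gcongr
  have hvI : ∀ i, v i ∈ Icc (0 : ℝ) 1 := fun i => ⟨by positivity, min_le_right _ _⟩
  have hvstep : ∀ i, dist (v (i + 1)) (v i) < d := by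
    intro i
    refine lt_of_le_of_lt ?_ hN
    have h1 : v i ≤ v (i + 1) := hvm (Nat.le_succ i)
    rw [Real.dist_eq, abs_of_nonneg (by linarith)]
    have h2 : ((i + 1 : ℕ) : ℝ) / (N + 1) = i / (N + 1) + 1 / (N + 1) := by push_cast; ring
    simp only [hv]
    rw [h2, sub_le_iff_le_add]
    have h3 : (0 : ℝ) < 1 / (N + 1) := by positivity
    rcases min_cases ((i : ℝ) / (N + 1)) 1 with h | h
    · rw [h.1]; exact (min_le_left _ _).trans (by linarith)
    · rw [h.1]; exact (min_le_right _ _).trans (by linarith)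
  have hv0 : v 0 = 0 := by simp [hv]
  have hv1 : v (N + 1) = 1 := by
    simp only [hv]; push_cast; rw [div_self hN0.ne', min_self]
  have hstep : ∀ i, edist (ψ (c (v (i + 1)))) (ψ (c (v i))) ≤
      ENNReal.ofReal M * edist (c (v (i + 1))) (c (v i)) := by
    intro i
    have h1 := hdε (v (i + 1)) (hvI _) (v i) (hvI _) (hvstep i)
    rw [dist_eq_norm] at h1
    have h2 := hlip (v i) (hvI i) _ h1
    rw [edist_dist, edist_dist, ← ENNReal.ofReal_mul' dist_nonneg, Real.dist_eq, dist_eq_norm]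
    exact ENNReal.ofReal_le_ofReal h2
  calc ENNReal.ofReal |ψ (c 1) - ψ (c 0)| = edist (ψ (c (v 0))) (ψ (c (v (N + 1)))) := by
        rw [hv0, hv1, edist_comm, edist_dist, Real.dist_eq]
    _ ≤ ∑ i ∈ Finset.range (N + 1), edist (ψ (c (v i))) (ψ (c (v (i + 1)))) :=
        edist_le_range_sum_edist (fun i => ψ (c (v i))) (N + 1)
    _ ≤ ∑ i ∈ Finset.range (N + 1), ENNReal.ofReal M * edist (c (v (i + 1))) (c (v i)) := by
        gcongr with i _
        rw [edist_comm]
        exact hstep i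
    _ = ENNReal.ofReal M * ∑ i ∈ Finset.range (N + 1), edist (c (v (i + 1))) (c (v i)) := by
        rw [Finset.mul_sum]
    _ ≤ _ := by
        gcongr
        exact eVariationOn.sum_le hvm hvI

theorem streamFunction_eq_of_path {ψ : Plane → ℝ} {V : Plane → Plane}
    (hψ : ∀ x, HasFDerivAt ψ (innerSL ℝ (rotCW (V x))) x) {p p' : ℝ → Plane}
    (hp : ∀ u, HasDerivAt p (p' u) u) {a b : ℝ} (h0 : ∀ u ∈ uIcc a b, V (p u) = 0) :
    ψ (p b) = ψ (p a) := by
  have hd : ∀ u ∈ uIcc a b, HasDerivWithinAt (fun u => ψ (p u)) 0 (uIcc a b) u := by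
    intro u hu
    have h1 := (hψ (p u)).comp_hasDerivAt u (hp u)
    have h2 : innerSL ℝ (rotCW (V (p u))) (p' u) = 0 := by rw [h0 u hu]; simp
    rw [h2] at h1
    exact h1.hasDerivWithinAt
  have h3 := (convex_uIcc a b).norm_image_sub_le_of_norm_hasDerivWithin_le (C := 0) hd
    (fun u _ => by simp) left_mem_uIcc right_mem_uIcc
  rwa [zero_mul, norm_le_zero_iff, sub_eq_zero] at h3

/-- The flux through a boundary arc is bounded by the length of any path in the closed domain
between its end points. -/
theorem abs_boundaryFlux_sub_le (hΩ : IsSmoothJordanDomain Ω γ ℓ)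
    (hj : IntervalIntegrable (fun s => j (γ s)) volume 0 ℓ)
    (hj0 : ∫ s in (0 : ℝ)..ℓ, j (γ s) = 0) (hF : Measurable F) (hFM : ∀ x, ‖F x‖ ≤ M)
    (hweak : ∀ φ : Plane → ℝ, ContDiff ℝ ∞ φ →
      ∫ x in Ω, fderiv ℝ φ x (F x) = ∫ s in Ioc 0 ℓ, φ (γ s) * j (γ s))
    {a b : ℝ} {c : ℝ → Plane} (hc : ContinuousOn c (Icc 0 1))
    (hcm : MapsTo c (Icc 0 1) (closure Ω)) (hca : c 0 = γ a) (hcb : c 1 = γ b)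
    (hL : eVariationOn c (Icc 0 1) ≠ ⊤) :
    |boundaryFlux γ j b - boundaryFlux γ j a| ≤ M * (eVariationOn c (Icc 0 1)).toReal := by
  have hM0 : 0 ≤ M := (norm_nonneg _).trans (hFM 0)
  obtain ⟨C, W, hW, hWγ⟩ := hΩ.exists_lipschitz_inner_normal
  obtain ⟨τ₀, hτ₀, hpush⟩ := hΩ.exists_push hW hWγ
  obtain ⟨δ, hδ⟩ := hΩ.exists_isCollarWidth
  set L := (eVariationOn c (Icc 0 1)).toReal
  have hfrc : IsCompact (range γ) := by
    rw [hΩ.range_eq]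
    exact hΩ.isCompact_closure.of_isClosed_subset isClosed_frontier frontier_subset_closure
  have main : ∀ τ : ℝ, 0 < τ → τ ≤ τ₀ → τ ≤ δ → ∀ e : ℝ, 0 < e →
      |boundaryFlux γ j b - boundaryFlux γ j a| ≤ M * ((1 + C * τ) * L) + 4 * τ * M + 2 * e := by
    intro τ hτ hττ₀ hτδ e he
    set g : Plane → Plane := fun x => x + τ • W x with hg
    have hgl : LipschitzWith (1 + Real.toNNReal τ * C) g := by
      refine LipschitzWith.of_dist_le_mul fun x y => ?_
      have h1 := hW.dist_le_mul x y
      simp only [hg, NNReal.coe_add, NNReal.coe_one, NNReal.coe_mul, Real.coe_toNNReal τ hτ.le]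
      calc dist (x + τ • W x) (y + τ • W y) ≤ dist x y + dist (τ • W x) (τ • W y) :=
            dist_add_add_le _ _ _ _
        _ = dist x y + τ * dist (W x) (W y) := by
            rw [dist_smul₀, Real.norm_eq_abs, abs_of_pos hτ]
        _ ≤ dist x y + τ * (C * dist x y) := by gcongr
        _ = _ := by ring
    have hgc : ContinuousOn (g ∘ c) (Icc 0 1) := hgl.continuous.comp_continuousOn hc
    have hgΩ : ∀ u ∈ Icc (0 : ℝ) 1, g (c u) ∈ Ω := fun u hu => hpush τ hτ hττ₀ _ (hcm hu)
    have hga : ∀ s, g (γ s) = collar γ s τ := by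
      intro s
      simp only [hg, hWγ, collar, smul_neg, sub_eq_add_neg]
    obtain ⟨m₁, hm₁, hdist₁⟩ := (isCompact_Icc.prod hfrc).exists_forall_le'
      (f := fun z : ℝ × Plane => ‖g (c z.1) - z.2‖) (a := 0)
      (by
        have h1 : ContinuousOn (fun z : ℝ × Plane => g (c z.1)) (Icc 0 1 ×ˢ range γ) :=
          hgc.comp continuousOn_fst fun z hz => hz.1
        exact (h1.sub continuousOn_snd).norm) (by
        rintro ⟨u, _⟩ ⟨hu, s, rfl⟩
        rw [norm_pos_iff, sub_ne_zero]
        intro h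
        have h' : g (c u) = γ s := h
        exact hΩ.notMem s (h' ▸ hgΩ u hu))
    obtain ⟨m₂, hm₂, hdist₂⟩ := ((isCompact_uIcc (a := a) (b := b)).prod
      hΩ.isCompact_closure).exists_forall_le'
      (f := fun z : ℝ × Plane => ‖collar γ z.1 (-τ) - z.2‖) (a := 0)
      (by
        have h1 := hΩ.contDiff_collar.continuous
        have h2 : Continuous fun z : ℝ × Plane => collar γ z.1 (-τ) :=
          h1.comp (continuous_fst.prodMk continuous_const)
        exact (h2.sub continuous_snd).norm.continuousOn) (by
        rintro ⟨u, y⟩ ⟨-, hy⟩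
        rw [norm_pos_iff, sub_ne_zero]
        intro h
        have h' : collar γ u (-τ) = y := h
        exact hδ.notMem u τ hτ hτδ (h' ▸ hy))
    obtain ⟨εa, hεa, hja⟩ := hΩ.exists_jump_estimate hδ hj hj0 hF hFM a hτ hτδ he
    obtain ⟨εb, hεb, hjb⟩ := hΩ.exists_jump_estimate hδ hj hj0 hF hFM b hτ hτδ he
    -- The smoothing radius is small enough for the pushed path to stay out of reach of the
    -- boundary, for the outer parallel curve to stay out of reach of the closed domain, and for both jump
    -- estimates to hold.
    obtain ⟨ε, hε⟩ : ∃ ε, ε = min (min (m₁ / 2) m₂) (min εa εb) := ⟨_, rfl⟩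
    have hε0 : 0 < ε := by rw [hε]; positivity
    have hε1 : 2 * ε ≤ m₁ := by
      have : ε ≤ m₁ / 2 := by rw [hε]; exact (min_le_left _ _).trans (min_le_left _ _)
      linarith
    have hε2 : ε ≤ m₂ := by rw [hε]; exact (min_le_left _ _).trans (min_le_right _ _)
    have hε3 : ε ≤ εa := by rw [hε]; exact (min_le_right _ _).trans (min_le_left _ _)
    have hε4 : ε ≤ εb := by rw [hε]; exact (min_le_right _ _).trans (min_le_right _ _)
    obtain ⟨η, hη⟩ := exists_isMollifier hε0
    obtain ⟨ψ, hψ⟩ := hΩ.exists_streamFunction_smoothedField hj hj0 hF hFM hweak hη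
    have e1 := hja ε hε3 η hη ψ hψ
    have e2 := hjb ε hε4 η hη ψ hψ
    have e3 : ψ (collar γ b (-τ)) = ψ (collar γ a (-τ)) := by
      refine streamFunction_eq_of_path hψ (p := fun u => collar γ u (-τ)) (fun u =>
        (hΩ.hasDerivAt u).sub ((hΩ.hasDerivAt_normal u).const_smul (-τ))) fun u hu => ?_
      exact hΩ.smoothedField_eq_zero hη (fun y hy => hε2.trans (hdist₂ (u, y) ⟨hu, hy⟩))
    have e4 : |ψ (collar γ b τ) - ψ (collar γ a τ)| ≤ M * ((1 + C * τ) * L) := by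
      have h1 := streamFunction_sub_le_of_path hε0 hψ
        (fun x hx => norm_smoothedField_le hFM hη hx) hgc
        (fun u hu s => hε1.trans (hdist₁ (u, γ s) ⟨hu, mem_range_self s⟩))
      simp only [Function.comp_apply, hca, hcb, hga] at h1
      have h2 := hgl.lipschitzOnWith (s := univ).comp_eVariationOn_le (g := c) (s := Icc 0 1)
        (mapsTo_univ _ _)
      have h3 : ENNReal.ofReal |ψ (collar γ b τ) - ψ (collar γ a τ)| ≤
          ENNReal.ofReal (M * ((1 + C * τ) * L)) := by
        refine h1.trans ?_
        rw [ENNReal.ofReal_mul hM0, ENNReal.ofReal_mul (by positivity), ENNReal.ofReal_toReal hL]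
        gcongr
        refine h2.trans (le_of_eq ?_)
        congr 1
        rw [← ENNReal.ofReal_coe_nnreal]
        congr 1
        simp only [NNReal.coe_add, NNReal.coe_one, NNReal.coe_mul, Real.coe_toNNReal τ hτ.le]
        ring
      exact (ENNReal.ofReal_le_ofReal_iff (by positivity)).1 h3
    rw [abs_le] at e1 e2 e4 ⊢
    constructor <;> linarith [e1.1, e1.2, e2.1, e2.2, e4.1, e4.2]
  have hlim : Tendsto (fun τ : ℝ => M * ((1 + C * τ) * L) + 4 * τ * M + 2 * τ) (𝓝[>] 0)
      (𝓝 (M * L)) := by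
    have h1 : Continuous fun τ : ℝ => M * ((1 + C * τ) * L) + 4 * τ * M + 2 * τ := by fun_prop
    have h2 := (h1.tendsto 0).mono_left (nhdsWithin_le_nhds (s := Ioi 0))
    simpa using h2
  refine ge_of_tendsto hlim ?_
  have hδ0 := hδ.pos
  filter_upwards [Ioc_mem_nhdsGT (lt_min hτ₀ hδ0)] with τ hτ
  exact main τ hτ.1 (hτ.2.trans (min_le_left _ _)) (hτ.2.trans (min_le_right _ _)) τ hτ.1

theorem intrinsicDist_pos {K : Set Plane} {x y : Plane} (h : x ≠ y) : 0 < intrinsicDist K x y := by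
  refine lt_of_lt_of_le (edist_pos.2 h) ?_
  refine le_iInf fun c => le_iInf fun _ => le_iInf fun _ => le_iInf fun h0 => le_iInf fun h1 => ?_
  rw [← h0, ← h1]
  exact eVariationOn.edist_le c (by simp) (by simp)

theorem intrinsicDist_lt_top (hΩ : IsSmoothJordanDomain Ω γ ℓ) (a b : ℝ) :
    intrinsicDist (closure Ω) (γ a) (γ b) < ⊤ := by
  have hc : ContDiff ℝ 1 (fun u : ℝ => γ (a + u * (b - a))) :=
    (hΩ.smooth.of_le (by simp)).comp (by fun_prop)
  have hv := hc.contDiffOn (s := uIcc 0 1).absolutelyContinuousOnInterval.boundedVariationOn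
  rw [uIcc_of_le zero_le_one] at hv
  refine lt_of_le_of_lt ?_ hv.lt_top
  exact iInf_le_of_le _ (iInf_le_of_le hc.continuous.continuousOn (iInf_le_of_le
    (fun u _ => frontier_subset_closure (hΩ.mem_frontier _)) (iInf_le_of_le (by simp)
      (iInf_le_of_le (by simp) le_rfl))))

end IsSmoothJordanDomain

/-! ### The flux bound -/

theorem proposition2p1 (Ω : Set Plane) (γ : ℝ → Plane) (ℓ : ℝ)
    (hΩ : IsSmoothJordanDomain Ω γ ℓ) (j : Plane → ℝ)
    (hsol : ∃ ζ : Plane → ℝ, IsOuterSolution Ω γ ℓ j ζ) :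
    ∀ x ∈ frontier Ω, ∀ y ∈ frontier Ω, x ≠ y →
      0 < intrinsicDist (closure Ω) x y ∧ intrinsicDist (closure Ω) x y < ⊤ ∧
      ∀ a b : ℝ, γ a = x → γ b = y → |b - a| ≤ ℓ →
        |∫ s in a..b, j (γ s)| / (intrinsicDist (closure Ω) x y).toReal
          ≤ 2 / (3 * Real.sqrt 3) := by
  obtain ⟨ζ, hζ⟩ := hsol
  obtain ⟨F, hF, hFM, hweak⟩ := hΩ.exists_bounded_current hζ
  obtain ⟨-, -, -, -, -, -, -, -, hj, hj0⟩ := hζ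
  intro x hx y hy hxy
  have hpos : 0 < intrinsicDist (closure Ω) x y := IsSmoothJordanDomain.intrinsicDist_pos hxy
  have htop : intrinsicDist (closure Ω) x y < ⊤ := by
    rw [← hΩ.range_eq] at hx hy
    obtain ⟨a, rfl⟩ := hx
    obtain ⟨b, rfl⟩ := hy
    exact hΩ.intrinsicDist_lt_top a b
  refine ⟨hpos, htop, fun a b ha hb _ => ?_⟩
  have hM : (0 : ℝ) < 2 / (3 * Real.sqrt 3) := by positivity
  rw [div_le_iff₀ (ENNReal.toReal_pos hpos.ne' htop.ne), ← hΩ.boundaryFlux_sub hj]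
  have hle : ENNReal.ofReal (|boundaryFlux γ j b - boundaryFlux γ j a| / (2 / (3 * Real.sqrt 3))) ≤
      intrinsicDist (closure Ω) x y := by
    refine le_iInf fun c => le_iInf fun hc => le_iInf fun hcm => le_iInf fun h0 =>
      le_iInf fun h1 => ?_
    -- A path of infinite length bounds nothing; its `toReal` would be `0`.
    rcases eq_or_ne (eVariationOn c (Icc 0 1)) ⊤ with h | h
    · rw [h]; exact le_top
    · refine ENNReal.ofReal_le_of_le_toReal ?_
      rw [div_le_iff₀ hM, mul_comm]
      exact hΩ.abs_boundaryFlux_sub_le hj hj0 hF hFM hweak hc hcm (h0.trans ha.symm)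
        (h1.trans hb.symm) h
  have h2 := (ENNReal.ofReal_le_iff_le_toReal htop.ne).1 hle
  rwa [div_le_iff₀ hM, mul_comm] at h2
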